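/- Let $k$ be a field of characteristic $0$ and let $\mathbb N$ be the positive integers. For a field $K$ and $q\in K^\times$ let $B_q=K\langle X,g,g^{-1}\rangle/(gg^{-1}=g^{-1}g=1,\ Xg=qgX)$, a Hopf algebra with $\Delta X=X\otimes1+g\otimes X$, $\Delta g=g\otimes g$, $\varepsilon(X)=0$, $\varepsilon(g)=1$, $S(X)=-g^{-1}X$, $S(g)=g^{-1}$. Put $C(B_+)=B_1$ over $k$ (so $C(B_+)=k[X,g,g^{-1}]$) and $C_q(B_+)=U_q(\mathfrak b_+)=B_q$ over the field of rational functions $k(q)$. Let $U(\mathfrak b_+)$ be the enveloping algebra of the Lie algebra with basis $X,H$ and $[H,X]=X$. The Hopf pairing of $U(\mathfrak b_+)$ with $C(B_+)$ is determined by $\langle X,X\rangle=\langle H,g\rangle=1$, $\langle X,g\rangle=\langle H,X\rangle=0$, and the self-pairing of $B_q$ by $\langle X,X\rangle=1$, $\langle g,g\rangle=q^{-1}$, $\langle X,g\rangle=\langle g,X\rangle=0$. A differential calculus $(\Gamma,d)$ over a Hopf algebra $A$ is a first order bicovariant differential calculus in the sense of Woronowicz, taken up to isomorphism; $\dim\Gamma$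 is the dimension of its space of right invariant elements. Write $\omega(v)=(dv_{(1)})S(v_{(2)})$ and $M_\Gamma=\{v\in\ker\varepsilon:\omega(v)=0\}$. Let $U$ be a Hopf algebra paired with $A$. A quantum tangent space is a subspace $L\subseteq\ker\varepsilon\subseteq U$ invariant under the adjoint action $h\triangleright x=h_{(1)}xS(h_{(2)})$ of $U$ and the coregular action $a\triangleright x=\langle x_{(1)},a\rangle x_{(2)}$ of $A$, each followed by the projection $x\mapsto x-\varepsilon(x)1$ to $\ker\varepsilon$. The one corresponding to $\Gamma$ is $L_\Gamma=\{x\in\ker\varepsilon\subseteq U:\langle x,v\rangle=0\ \forall v\in M_\Gamma\}$. For $x\in L_\Gamma$ put $\partial_x(a)=\langle x,a_{(1)}\rangle a_{(2)}$. For finite $I\subset\mathbb N$ let $M^q_I\subseteq B_q$ be the left ideal generated by the elements $X^m\prod_{n\in I,\,n>m}(1-q^{1-n}g)$, $m\ge0$. Here $[a,\eta]=a\eta-\eta a$. **Proposition.** (a) The finite dimensional differential calculi $\Gamma$ on $C(B_+)$ and the finite dimensional quantum tangent spaces $L$ on $U(\mathfrak b_+)$ are each in one-to-one correspondence with the non-empty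 finite sets $I\subset\mathbb N$: $\Gamma$ corresponds to $I$ if and only if $M_\Gamma=M^1_I$, and then $L=L_\Gamma$ corresponds to $I$. Moreover $\dim\Gamma=\dim L=\sum_{n\in I}n-1$. The calculi with $1\in I$ are in one-to-one correspondence with the finite dimensional calculi $\Gamma$ on $C_q(B_+)$ and with the finite dimensional quantum tangent spaces $L$ on $U_q(\mathfrak b_+)$: these are likewise in one-to-one correspondence with the finite sets $I\ni1$, by $M_\Gamma=M^q_I$ and $L=L_\Gamma$, again with $\dim\Gamma=\dim L=\sum_{n\in I}n-1$. (b) Let $n\ge2$. On $C_q(B_+)$, a finite dimensional calculus is coirreducible (nonzero, with no quotient calculi except $0$ and itself) of dimension $n$ if and only if it corresponds to $I=\{1,n\}$. The calculus on $C(B_+)$ corresponding to $\{1,n\}$ has dimension $n$ and a right invariant basis $\eta_0,\dots,\eta_{n-1}$ (as a right module) such that $$dX=\eta_1+\eta_0X,\qquad dg=\eta_0g,\qquad [g,\eta_i]=0\ \ \forall i,\qquad [X,\eta_i]=\begin{cases}0& i=0\text{ or }i=n-1,\\ \eta_{i+1}&0<i<n-1.\end{cases}$$ For the dual basis $\phi_0,\dots,\phi_{n-1}$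 of $L_\Gamma$ (that is, $\langle\phi_i,v\rangle=\delta_{ij}$ whenever $\omega(v)=\eta_j$) the braided derivations $\partial_i=\partial_{\phi_i}$ are, for all $f\in C(B_+)$, $$\partial_if=\frac1{i!}\Big(\frac{\partial}{\partial X}\Big)^if\quad(1\le i\le n-1),\qquad \partial_0f=\Big(X\frac{\partial}{\partial X}+g\frac{\partial}{\partial g}\Big)f,$$ and $df=\sum_i\eta_i\,\partial_i(f)$. (c) Let $n\ge2$. The calculus on $C(B_+)$ corresponding to $\{n\}$ has dimension $n-1$ and is described as in (b), except that $\eta_0=0$ and $\partial_0=0$: it has a right invariant basis $\eta_1,\dots,\eta_{n-1}$ satisfying the relations of (b) with $\eta_0=0$, and for the dual basis $\phi_1,\dots,\phi_{n-1}$ of $L_\Gamma$ one has $\partial_if=\frac1{i!}(\partial/\partial X)^if$ and $df=\sum_{i\ge1}\eta_i\,\partial_i(f)$. -/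

import Mathlib

open scoped TensorProduct
open MulOpposite Coalgebra HopfAlgebra

universe u

noncomputable section

/-! ### A criterion for antipodes -/

section AntipodeCriterion

variable {K A : Type*} [Field K] [Ring A] [Bialgebra K A]

/-- The linear map underlying an anti-homomorphism. -/
def antiLin (S : A →ₐ[K] Aᵐᵒᵖ) : A →ₗ[K] A :=
  (MulOpposite.opLinearEquiv K).symm.toLinearMap ∘ₗ S.toLinearMap

theorem antiLin_mul (S : A →ₐ[K] Aᵐᵒᵖ) (a b : A) :
    antiLin S (a * b) = antiLin S b * antiLin S a := by
  simp [antiLin]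

theorem antiLin_left_mul (S : A →ₐ[K] Aᵐᵒᵖ) {a b : A}
    (ha : LinearMap.mul' K A ((antiLin S).rTensor A (comul a)) = algebraMap K A (counit a))
    (hb : LinearMap.mul' K A ((antiLin S).rTensor A (comul b)) = algebraMap K A (counit b)) :
    LinearMap.mul' K A ((antiLin S).rTensor A (comul (a * b))) =
      algebraMap K A (counit (a * b)) := by
  obtain ra := ℛ K a
  obtain rb := ℛ K b
  have h1 : ∑ i ∈ ra.index, antiLin S (ra.left i) * ra.right i = algebraMap K A (counit a) := by
    rw [← ha, ← ra.eq]; simp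
  have h2 : ∑ i ∈ rb.index, antiLin S (rb.left i) * rb.right i = algebraMap K A (counit b) := by
    rw [← hb, ← rb.eq]; simp
  have h3 : LinearMap.mul' K A ((antiLin S).rTensor A (comul (a * b))) =
      ∑ j ∈ rb.index, antiLin S (rb.left j) *
        (∑ i ∈ ra.index, antiLin S (ra.left i) * ra.right i) * rb.right j := by
    rw [Bialgebra.comul_mul, ← ra.eq, ← rb.eq, Finset.sum_mul_sum, Finset.sum_comm]
    simp [antiLin_mul, Finset.mul_sum, Finset.sum_mul, mul_assoc]
  rw [h3, h1, Bialgebra.counit_mul, map_mul, ← h2, Finset.mul_sum]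
  refine Finset.sum_congr rfl fun j _ => ?_
  rw [← Algebra.commutes, mul_assoc]

theorem antiLin_right_mul (S : A →ₐ[K] Aᵐᵒᵖ) {a b : A}
    (ha : LinearMap.mul' K A ((antiLin S).lTensor A (comul a)) = algebraMap K A (counit a))
    (hb : LinearMap.mul' K A ((antiLin S).lTensor A (comul b)) = algebraMap K A (counit b)) :
    LinearMap.mul' K A ((antiLin S).lTensor A (comul (a * b))) =
      algebraMap K A (counit (a * b)) := by
  obtain ra := ℛ K a
  obtain rb := ℛ K b
  have h1 : ∑ i ∈ ra.index, ra.left i * antiLin S (ra.right i) = algebraMap K A (counit a) := by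
    rw [← ha, ← ra.eq]; simp
  have h2 : ∑ i ∈ rb.index, rb.left i * antiLin S (rb.right i) = algebraMap K A (counit b) := by
    rw [← hb, ← rb.eq]; simp
  have h3 : LinearMap.mul' K A ((antiLin S).lTensor A (comul (a * b))) =
      ∑ i ∈ ra.index, ra.left i *
        (∑ j ∈ rb.index, rb.left j * antiLin S (rb.right j)) * antiLin S (ra.right i) := by
    rw [Bialgebra.comul_mul, ← ra.eq, ← rb.eq, Finset.sum_mul_sum]
    simp [antiLin_mul, Finset.mul_sum, Finset.sum_mul, mul_assoc]
  rw [h3, h2, Bialgebra.counit_mul, map_mul, ← h1, Finset.sum_mul]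
  refine Finset.sum_congr rfl fun j _ => ?_
  rw [← Algebra.commutes, mul_assoc, Algebra.commutes]

/-- An anti-homomorphism is an antipode as soon as the antipode identities hold on generators. -/
@[reducible] def hopfOfGenerators (S : A →ₐ[K] Aᵐᵒᵖ) (s : Set A) (hs : Algebra.adjoin K s = ⊤)
    (hl : ∀ a ∈ s,
      LinearMap.mul' K A ((antiLin S).rTensor A (comul a)) = algebraMap K A (counit a))
    (hr : ∀ a ∈ s,
      LinearMap.mul' K A ((antiLin S).lTensor A (comul a)) = algebraMap K A (counit a)) :
    HopfAlgebra K A where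
  antipode := antiLin S
  mul_antipode_rTensor_comul := by
    ext a
    have ha : a ∈ Algebra.adjoin K s := hs ▸ Algebra.mem_top
    show LinearMap.mul' K A ((antiLin S).rTensor A (comul a)) = algebraMap K A (counit a)
    induction ha using Algebra.adjoin_induction with
    | mem x hx => exact hl x hx
    | algebraMap r => simp [Algebra.algebraMap_eq_smul_one, antiLin, Algebra.TensorProduct.one_def]
    | add x y _ _ h1 h2 => simp [h1, h2]
    | mul x y _ _ h1 h2 => exact antiLin_left_mul S h1 h2
  mul_antipode_lTensor_comul := by
    ext a
    have ha : a ∈ Algebra.adjoin K s := hs ▸ Algebra.mem_top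
    show LinearMap.mul' K A ((antiLin S).lTensor A (comul a)) = algebraMap K A (counit a)
    induction ha using Algebra.adjoin_induction with
    | mem x hx => exact hr x hx
    | algebraMap r => simp [Algebra.algebraMap_eq_smul_one, antiLin, Algebra.TensorProduct.one_def]
    | add x y _ _ h1 h2 => simp [h1, h2]
    | mul x y _ _ h1 h2 => exact antiLin_right_mul S h1 h2

end AntipodeCriterion

/-! ### The Hopf algebra `K⟨X, g, g⁻¹⟩` with `X g = q g X` -/

/-- Names of the generators `X`, `g`, `g⁻¹`. -/
inductive QGen : Type
  | X | g | ginv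

/-- The relations `g g⁻¹ = 1 = g⁻¹ g` and `X g = q g X`. -/
inductive QRel (K : Type u) [Field K] (q : Kˣ) :
    FreeAlgebra K QGen → FreeAlgebra K QGen → Prop
  | g_ginv : QRel K q (FreeAlgebra.ι K QGen.g * FreeAlgebra.ι K QGen.ginv) 1
  | ginv_g : QRel K q (FreeAlgebra.ι K QGen.ginv * FreeAlgebra.ι K QGen.g) 1
  | X_g : QRel K q (FreeAlgebra.ι K QGen.X * FreeAlgebra.ι K QGen.g)
      ((q : K) • (FreeAlgebra.ι K QGen.g * FreeAlgebra.ι K QGen.X))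

/-- The algebra `K⟨X, g, g⁻¹⟩ / (g g⁻¹ = g⁻¹ g = 1, X g = q g X)`. -/
def QBorel (K : Type u) [Field K] (q : Kˣ) : Type u := RingQuot (QRel K q)

namespace QBorel

variable {K : Type u} [Field K] {q : Kˣ}

instance : Ring (QBorel K q) := inferInstanceAs (Ring (RingQuot (QRel K q)))
instance : Algebra K (QBorel K q) := inferInstanceAs (Algebra K (RingQuot (QRel K q)))

variable (K q) in
/-- The projection from the free algebra. -/
def mk : FreeAlgebra K QGen →ₐ[K] QBorel K q := RingQuot.mkAlgHom K (QRel K q)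

/-- The generator `X`. -/
def X : QBorel K q := mk K q (FreeAlgebra.ι K QGen.X)
/-- The generator `g`. -/
def g : QBorel K q := mk K q (FreeAlgebra.ι K QGen.g)
/-- The generator `g⁻¹`. -/
def ginv : QBorel K q := mk K q (FreeAlgebra.ι K QGen.ginv)

theorem g_mul_ginv : (g * ginv : QBorel K q) = 1 := by
  have := RingQuot.mkAlgHom_rel K (QRel.g_ginv (K := K) (q := q))
  simpa [g, ginv, mk] using! this

theorem ginv_mul_g : (ginv * g : QBorel K q) = 1 := by
  have := RingQuot.mkAlgHom_rel K (QRel.ginv_g (K := K) (q := q))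
  simpa [g, ginv, mk] using! this

theorem X_mul_g : (X * g : QBorel K q) = (q : K) • (g * X) := by
  have := RingQuot.mkAlgHom_rel K (QRel.X_g (K := K) (q := q))
  simpa [g, X, mk] using! this

section Lift

variable {B : Type*} [Ring B] [Algebra K B]

/-- The universal property of the presentation. -/
def lift (x y z : B) (h1 : y * z = 1) (h2 : z * y = 1) (h3 : x * y = (q : K) • (y * x)) :
    QBorel K q →ₐ[K] B :=
  RingQuot.liftAlgHom K ⟨FreeAlgebra.lift K (fun s => QGen.casesOn s x y z), by
    intro a b h
    cases h <;> simp [h1, h2, h3]⟩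

variable (x y z : B) (h1 : y * z = 1) (h2 : z * y = 1) (h3 : x * y = (q : K) • (y * x))

@[simp] theorem lift_X : lift (q := q) x y z h1 h2 h3 X = x := by
  refine (RingQuot.liftAlgHom_mkAlgHom_apply K _ _ _).trans ?_
  simp

@[simp] theorem lift_g : lift (q := q) x y z h1 h2 h3 g = y := by
  refine (RingQuot.liftAlgHom_mkAlgHom_apply K _ _ _).trans ?_
  simp

@[simp] theorem lift_ginv : lift (q := q) x y z h1 h2 h3 ginv = z := by
  refine (RingQuot.liftAlgHom_mkAlgHom_apply K _ _ _).trans ?_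
  simp

theorem hom_ext {f f' : QBorel K q →ₐ[K] B} (hX : f X = f' X) (hg : f g = f' g)
    (hi : f ginv = f' ginv) : f = f' := by
  refine RingQuot.ringQuot_ext' (S := K) (s := QRel K q) f f' ?_
  refine FreeAlgebra.hom_ext ?_
  funext s
  cases s
  · exact hX
  · exact hg
  · exact hi

end Lift

theorem adjoin_eq_top : Algebra.adjoin K ({X, g, ginv} : Set (QBorel K q)) = ⊤ := by
  set S := Algebra.adjoin K ({X, g, ginv} : Set (QBorel K q)) with hS
  have hX : (X : QBorel K q) ∈ S := Algebra.subset_adjoin (by simp)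
  have hg : (g : QBorel K q) ∈ S := Algebra.subset_adjoin (by simp)
  have hi : (ginv : QBorel K q) ∈ S := Algebra.subset_adjoin (by simp)
  let f : QBorel K q →ₐ[K] S := lift ⟨X, hX⟩ ⟨g, hg⟩ ⟨ginv, hi⟩
    (Subtype.ext g_mul_ginv) (Subtype.ext ginv_mul_g) (Subtype.ext X_mul_g)
  have hf : S.val.comp f = AlgHom.id K _ := hom_ext (by simp [f]) (by simp [f]) (by simp [f])
  refine eq_top_iff.mpr fun a _ => ?_
  have := congrArg (fun h => h a) hf
  simp only [AlgHom.comp_apply, AlgHom.id_apply] at this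
  rw [← this]
  exact (f a).2

/-- The coproduct: `ΔX = X ⊗ 1 + g ⊗ X`, `Δg = g ⊗ g`. -/
def comulHom : QBorel K q →ₐ[K] QBorel K q ⊗[K] QBorel K q :=
  lift (X ⊗ₜ 1 + g ⊗ₜ X) (g ⊗ₜ g) (ginv ⊗ₜ ginv)
    (by simp [g_mul_ginv, Algebra.TensorProduct.one_def])
    (by simp [ginv_mul_g, Algebra.TensorProduct.one_def])
    (by simp [add_mul, mul_add, X_mul_g, TensorProduct.smul_tmul', smul_add])

/-- The counit: `ε(X) = 0`, `ε(g) = 1`. -/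
def counitHom : QBorel K q →ₐ[K] K := lift 0 1 1 (by simp) (by simp) (by simp)

/-- The antipode as an anti-homomorphism: `S(X) = -g⁻¹ X`, `S(g) = g⁻¹`. -/
def antipodeHom : QBorel K q →ₐ[K] (QBorel K q)ᵐᵒᵖ :=
  lift (op (-(ginv * X))) (op ginv) (op g)
    (by rw [← op_mul, g_mul_ginv, op_one])
    (by rw [← op_mul, ginv_mul_g, op_one])
    (by
      rw [← op_mul, ← op_mul, ← op_smul]
      congr 1
      have h : (ginv * X : QBorel K q) = (q : K) • (X * ginv) := by
        have := congrArg (fun t : QBorel K q => ginv * t * ginv) (X_mul_g (K := K) (q := q))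
        simp only [mul_smul_comm, smul_mul_assoc, mul_assoc, g_mul_ginv, mul_one] at this
        rw [this, ← mul_assoc ginv g, ginv_mul_g, one_mul]
      have h' : (ginv * X * ginv : QBorel K q) = ginv * (X * ginv) := mul_assoc _ _ _
      rw [mul_neg, neg_mul, smul_neg, h', ← mul_smul_comm, ← h])

instance : Bialgebra K (QBorel K q) :=
  Bialgebra.ofAlgHom comulHom counitHom
    (hom_ext
      (by simp [comulHom, TensorProduct.add_tmul, TensorProduct.tmul_add,
            Algebra.TensorProduct.one_def, add_assoc])
      (by simp [comulHom]) (by simp [comulHom]))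
    (hom_ext (by simp [comulHom, counitHom]) (by simp [comulHom, counitHom])
      (by simp [comulHom, counitHom]))
    (hom_ext (by simp [comulHom, counitHom]) (by simp [comulHom, counitHom])
      (by simp [comulHom, counitHom]))

theorem comul_eq (a : QBorel K q) : comul (R := K) a = comulHom a := rfl
theorem counit_eq (a : QBorel K q) : counit (R := K) a = counitHom a := rfl

instance : HopfAlgebra K (QBorel K q) :=
  hopfOfGenerators antipodeHom {X, g, ginv} adjoin_eq_top
    (by
      rintro a (rfl | rfl | rfl) <;>
      simp [comul_eq, counit_eq, comulHom, counitHom, antiLin, antipodeHom, g_mul_ginv, ginv_mul_g])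
    (by
      rintro a (rfl | rfl | rfl) <;>
      simp [comul_eq, counit_eq, comulHom, counitHom, antiLin, antipodeHom, g_mul_ginv, ginv_mul_g,
        ← mul_assoc])

end QBorel

/-- The algebra of functions `C(B₊)`: the case `q = 1`, so `X g = g X`. -/
abbrev CB (k : Type u) [Field k] : Type u := QBorel k 1

/-- The parameter `q` as a unit of the field `k(q)` of rational functions. -/
def qParam (k : Type u) [Field k] : (RatFunc k)ˣ := Units.mk0 RatFunc.X RatFunc.X_ne_zero

/-- The self-dual quantum group `C_q(B₊) = U_q(b₊)` over `k(q)`. -/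
abbrev CqB (k : Type u) [Field k] : Type u := QBorel (RatFunc k) (qParam k)

/-! ### The enveloping algebra `U(b₊)` -/

/-- The Lie algebra `b₊` with basis `X, H` and bracket `[H, X] = X`; `x` and `h` are the coordinates
with respect to this basis. -/
@[ext] structure BPlus (k : Type u) : Type u where
  x : k
  h : k

namespace BPlus

variable {k : Type u} [Field k]

/-- Coordinates. -/
def equiv : BPlus k ≃ k × k where
  toFun a := (a.x, a.h)
  invFun a := ⟨a.1, a.2⟩
  left_inv _ := rfl
  right_inv _ := rfl

instance : AddCommGroup (BPlus k) := equiv.addCommGroup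
instance : Module k (BPlus k) := equiv.module k

@[simp] theorem add_x (a b : BPlus k) : (a + b).x = a.x + b.x := rfl
@[simp] theorem add_h (a b : BPlus k) : (a + b).h = a.h + b.h := rfl
@[simp] theorem zero_x : (0 : BPlus k).x = 0 := rfl
@[simp] theorem zero_h : (0 : BPlus k).h = 0 := rfl
@[simp] theorem smul_x (c : k) (a : BPlus k) : (c • a).x = c * a.x := rfl
@[simp] theorem smul_h (c : k) (a : BPlus k) : (c • a).h = c * a.h := rfl

/-- `[x X + h H, x' X + h' H] = (h x' - h' x) X`. -/
instance : Bracket (BPlus k) (BPlus k) := ⟨fun a b => ⟨a.h * b.x - b.h * a.x, 0⟩⟩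

@[simp] theorem lie_x (a b : BPlus k) : ⁅a, b⁆.x = a.h * b.x - b.h * a.x := rfl
@[simp] theorem lie_h (a b : BPlus k) : ⁅a, b⁆.h = 0 := rfl

instance : LieRing (BPlus k) where
  add_lie a b c := by ext <;> simp; ring
  lie_add a b c := by ext <;> simp; ring
  lie_self a := by ext <;> simp
  leibniz_lie a b c := by ext <;> simp; ring

instance : LieAlgebra k (BPlus k) where
  lie_smul c a b := by ext <;> simp; ring

end BPlus

/-- The universal enveloping algebra `U(b₊)`. -/
abbrev UB (k : Type u) [Field k] : Type u := UniversalEnvelopingAlgebra k (BPlus k)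

namespace UB

attribute [local instance 100] LieRing.ofAssociativeRing

variable {k : Type u} [Field k]

/-- The generator `X`. -/
def X : UB k := UniversalEnvelopingAlgebra.ι k (⟨1, 0⟩ : BPlus k)
/-- The generator `H`. -/
def H : UB k := UniversalEnvelopingAlgebra.ι k (⟨0, 1⟩ : BPlus k)

theorem H_mul_X : (H : UB k) * (X : UB k) = X * H + X := by
  have h : ⁅(H : UB k), (X : UB k)⁆ = X := by
    have e := LieHom.map_lie (UniversalEnvelopingAlgebra.ι k) (⟨0, 1⟩ : BPlus k) ⟨1, 0⟩
    have e' : ⁅(⟨0, 1⟩ : BPlus k), (⟨1, 0⟩ : BPlus k)⁆ = ⟨1, 0⟩ := by ext <;> simp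
    rw [e'] at e
    exact e.symm
  rw [LieRing.of_associative_ring_bracket] at h
  rw [← sub_eq_iff_eq_add', h]

section Lift

variable {B : Type*} [Ring B] [Algebra k B]

/-- Algebra maps out of `U(b₊)` are given by elements `x, h` with `h x = x h + x`. -/
def lift (x h : B) (hx : h * x = x * h + x) : UB k →ₐ[k] B :=
  UniversalEnvelopingAlgebra.lift k
    { toFun := fun a => a.x • x + a.h • h
      map_add' := fun a b => by simp [add_smul]; abel
      map_smul' := fun c a => by simp [mul_smul]
      map_lie' := fun {a b} => by
        simp only [BPlus.lie_x, BPlus.lie_h, LieRing.of_associative_ring_bracket, mul_add, add_mul,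
          smul_mul_smul_comm, hx, zero_smul, add_zero, sub_smul, smul_add]
        rw [mul_comm a.x b.x, mul_comm a.x b.h, mul_comm b.x a.h, mul_comm b.h a.h]
        abel }

variable (x h : B) (hx : h * x = x * h + x)

@[simp] theorem lift_X : lift (k := k) x h hx X = x := by
  rw [lift, X, UniversalEnvelopingAlgebra.lift_ι_apply]; simp

@[simp] theorem lift_H : lift (k := k) x h hx H = h := by
  rw [lift, H, UniversalEnvelopingAlgebra.lift_ι_apply]; simp

theorem hom_ext {f f' : UB k →ₐ[k] B} (hX : f X = f' X) (hH : f H = f' H) : f = f' := by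
  refine UniversalEnvelopingAlgebra.hom_ext k ?_
  refine LieHom.ext fun a => ?_
  have ha : a = a.x • (⟨1, 0⟩ : BPlus k) + a.h • (⟨0, 1⟩ : BPlus k) := by ext <;> simp
  have e1 : f (UniversalEnvelopingAlgebra.ι k a) = a.x • f X + a.h • f H := by
    conv_lhs => rw [ha]
    simp only [map_add, map_smul]; rfl
  have e2 : f' (UniversalEnvelopingAlgebra.ι k a) = a.x • f' X + a.h • f' H := by
    conv_lhs => rw [ha]
    simp only [map_add, map_smul]; rfl
  show f (UniversalEnvelopingAlgebra.ι k a) = f' (UniversalEnvelopingAlgebra.ι k a)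
  rw [e1, e2, hX, hH]

end Lift

theorem adjoin_eq_top : Algebra.adjoin k ({X, H} : Set (UB k)) = ⊤ := by
  set S := Algebra.adjoin k ({X, H} : Set (UB k)) with hS
  have hX : (X : UB k) ∈ S := Algebra.subset_adjoin (by simp)
  have hH : (H : UB k) ∈ S := Algebra.subset_adjoin (by simp)
  let f : UB k →ₐ[k] S := lift ⟨X, hX⟩ ⟨H, hH⟩ (Subtype.ext H_mul_X)
  have hf : S.val.comp f = AlgHom.id k _ := hom_ext (by simp [f]) (by simp [f])
  refine eq_top_iff.mpr fun a _ => ?_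
  have := congrArg (fun h => h a) hf
  simp only [AlgHom.comp_apply, AlgHom.id_apply] at this
  rw [← this]
  exact (f a).2

/-- The coproduct: `X` and `H` are primitive. -/
def comulHom : UB k →ₐ[k] UB k ⊗[k] UB k :=
  lift (X ⊗ₜ 1 + 1 ⊗ₜ X) (H ⊗ₜ 1 + 1 ⊗ₜ H) (by
    simp only [mul_add, add_mul, Algebra.TensorProduct.tmul_mul_tmul, mul_one, one_mul, H_mul_X,
      TensorProduct.add_tmul, TensorProduct.tmul_add]
    abel)

/-- The counit: `ε(X) = ε(H) = 0`. -/
def counitHom : UB k →ₐ[k] k := lift 0 0 (by simp)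

/-- The antipode as an anti-homomorphism: `S(X) = -X`, `S(H) = -H`. -/
def antipodeHom : UB k →ₐ[k] (UB k)ᵐᵒᵖ :=
  lift (op (-X)) (op (-H)) (by
    rw [← op_mul, ← op_mul, ← op_add]
    congr 1
    rw [neg_mul_neg, neg_mul_neg, H_mul_X]; abel)

instance : Bialgebra k (UB k) :=
  Bialgebra.ofAlgHom comulHom counitHom
    (hom_ext
      (by simp [comulHom, TensorProduct.add_tmul, TensorProduct.tmul_add,
            Algebra.TensorProduct.one_def, add_assoc])
      (by simp [comulHom, TensorProduct.add_tmul, TensorProduct.tmul_add,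
            Algebra.TensorProduct.one_def, add_assoc]))
    (hom_ext (by simp [comulHom, counitHom]) (by simp [comulHom, counitHom]))
    (hom_ext (by simp [comulHom, counitHom]) (by simp [comulHom, counitHom]))

theorem comul_eq (a : UB k) : comul (R := k) a = comulHom a := rfl
theorem counit_eq (a : UB k) : counit (R := k) a = counitHom a := rfl

instance : HopfAlgebra k (UB k) :=
  hopfOfGenerators antipodeHom {X, H} adjoin_eq_top
    (by rintro a (rfl | rfl) <;> simp [comul_eq, counit_eq, comulHom, counitHom, antiLin, antipodeHom])
    (by rintro a (rfl | rfl) <;> simp [comul_eq, counit_eq, comulHom, counitHom, antiLin, antipodeHom])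

end UB

/-! ### The dual pairings -/

section Pairing

open WithConv

variable {K D : Type*} [Field K] [Ring D] [Bialgebra K D]

/-- The upper right entry of a two-dimensional representation, as a functional. -/
def entryFun (ρ : D →ₐ[K] Matrix (Fin 2) (Fin 2) K) : D →ₗ[K] K :=
  Matrix.entryLinearMap K K 0 1 ∘ₗ ρ.toLinearMap

/-- A character tensored with the two-dimensional trivial representation. -/
def scalarRep (χ : D →ₐ[K] K) : D →ₐ[K] Matrix (Fin 2) (Fin 2) K :=
  (Algebra.ofId K (Matrix (Fin 2) (Fin 2) K)).comp χ

theorem scalarRep_commute (χ : D →ₐ[K] K) (d : D) (m : Matrix (Fin 2) (Fin 2) K) :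
    Commute (scalarRep χ d) m := Algebra.commutes (χ d) m

theorem char_conv_char (χ χ' : D →ₐ[K] K)
    (h : (Algebra.TensorProduct.lift χ χ' fun _ _ => Commute.all _ _).comp
      (Bialgebra.comulAlgHom K D) = Bialgebra.counitAlgHom K D) :
    toConv χ.toLinearMap * toConv χ'.toLinearMap = (1 : WithConv (D →ₗ[K] K)) := by
  refine WithConv.ext (LinearMap.ext fun d => ?_)
  have h1 := congrArg (fun f => f d) h
  have key : ∀ t : D ⊗[K] D, LinearMap.mul' K K (TensorProduct.map χ.toLinearMap χ'.toLinearMap t) =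
      Algebra.TensorProduct.lift χ χ' (fun _ _ => Commute.all _ _) t := fun t => by
    induction t using TensorProduct.induction_on with
    | zero => simp
    | tmul a b => simp
    | add a b ha hb => simp [ha, hb]
  exact (key (comul d)).trans h1

theorem entry_conv_char (ρ : D →ₐ[K] Matrix (Fin 2) (Fin 2) K) (χ : D →ₐ[K] K) (d : D) :
    (toConv (entryFun ρ) * toConv χ.toLinearMap : WithConv (D →ₗ[K] K)).ofConv d =
      (Algebra.TensorProduct.lift ρ (scalarRep χ)
        (fun a b => (scalarRep_commute χ b (ρ a)).symm) (comul (R := K) d)) 0 1 := by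
  rw [LinearMap.convMul_def]
  simp only [LinearMap.comp_apply]
  induction (comul d : D ⊗[K] D) using TensorProduct.induction_on with
  | zero => simp
  | tmul a b =>
    simp [entryFun, scalarRep, Algebra.ofId_apply, Matrix.algebraMap_eq_diagonal, Matrix.mul_diagonal]
  | add a b ha hb => simp only [map_add, ha, hb, Matrix.add_apply]

theorem char_conv_entry (ρ : D →ₐ[K] Matrix (Fin 2) (Fin 2) K) (χ : D →ₐ[K] K) (d : D) :
    (toConv χ.toLinearMap * toConv (entryFun ρ) : WithConv (D →ₗ[K] K)).ofConv d =
      (Algebra.TensorProduct.lift (scalarRep χ) ρ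
        (fun a b => scalarRep_commute χ a (ρ b)) (comul (R := K) d)) 0 1 := by
  rw [LinearMap.convMul_def]
  simp only [LinearMap.comp_apply]
  induction (comul d : D ⊗[K] D) using TensorProduct.induction_on with
  | zero => simp
  | tmul a b =>
    simp [entryFun, scalarRep, Algebra.ofId_apply, Matrix.algebraMap_eq_diagonal, Matrix.diagonal_mul]
  | add a b ha hb => simp only [map_add, ha, hb, Matrix.add_apply]

end Pairing

namespace UB

open WithConv

variable {k : Type u} [Field k]

/-- The defining representation `X ↦ E₀₁`, `H ↦ E₀₀` of `b₊` on `k²`. -/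
def rep : UB k →ₐ[k] Matrix (Fin 2) (Fin 2) k :=
  lift !![0, 1; 0, 0] !![1, 0; 0, 0] (by ext i j; fin_cases i <;> fin_cases j <;> simp)

/-- The character `X ↦ 0`, `H ↦ c`. -/
def char (c : k) : UB k →ₐ[k] k := lift 0 c (by simp)

/-- The algebra map from `C(B₊)` to the convolution algebra of functionals on `U(b₊)` which sends
`g` to the character `X ↦ 0`, `H ↦ 1` and `X` to the upper right matrix coefficient of `rep`. -/
def toDual : CB k →ₐ[k] WithConv (UB k →ₗ[k] k) :=
  QBorel.lift (toConv (entryFun rep)) (toConv (char 1).toLinearMap)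
    (toConv (char (-1)).toLinearMap)
    (char_conv_char _ _ (hom_ext
      (by simp [char, comul_eq, counit_eq, comulHom, counitHom])
      (by simp [char, comul_eq, counit_eq, comulHom, counitHom])))
    (char_conv_char _ _ (hom_ext
      (by simp [char, comul_eq, counit_eq, comulHom, counitHom])
      (by simp [char, comul_eq, counit_eq, comulHom, counitHom])))
    (by
      rw [Units.val_one, one_smul]
      refine WithConv.ext (LinearMap.ext fun d => ?_)
      rw [entry_conv_char, char_conv_entry]
      have h : (Algebra.TensorProduct.lift rep (scalarRep (char (1 : k)))
          (fun a b => (scalarRep_commute _ b (rep a)).symm)).comp (Bialgebra.comulAlgHom k (UB k)) =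
          (Algebra.TensorProduct.lift (scalarRep (char (1 : k))) rep
          (fun a b => scalarRep_commute _ a (rep b))).comp (Bialgebra.comulAlgHom k (UB k)) :=
        hom_ext
          (by simp [comul_eq, comulHom, add_comm])
          (by simp [comul_eq, comulHom, add_comm])
      exact congrFun (congrFun (congrArg (fun f => f d) h) 0) 1)

/-- The pairing `⟨x, a⟩` of `x ∈ U(b₊)` with `a ∈ C(B₊)`: the Hopf algebra pairing with
`⟨X, X⟩ = ⟨H, g⟩ = 1` and `⟨H, X⟩ = ⟨X, g⟩ = 0`. -/
def pairing : UB k →ₗ[k] CB k →ₗ[k] k :=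
  LinearMap.flip ((WithConv.linearEquiv k (UB k →ₗ[k] k)).toLinearMap ∘ₗ toDual.toLinearMap)

end UB

namespace QBorel

open WithConv

variable {K : Type u} [Field K] {q : Kˣ}

/-- The representation `X ↦ E₀₁`, `g ↦ diag(q⁻¹, 1)`. -/
def rep : QBorel K q →ₐ[K] Matrix (Fin 2) (Fin 2) K :=
  lift !![0, 1; 0, 0] !![(q : K)⁻¹, 0; 0, 1] !![(q : K), 0; 0, 1]
    (by simp [Matrix.one_fin_two]) (by simp [Matrix.one_fin_two])
    (by ext i j; fin_cases i <;> fin_cases j <;> simp)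

/-- The character `X ↦ 0`, `g ↦ c`. -/
def char (c : Kˣ) : QBorel K q →ₐ[K] K := lift 0 c (c⁻¹ : Kˣ) (by simp) (by simp) (by simp)

/-- The algebra map from `QBorel K q` to the convolution algebra of functionals on `QBorel K q`
which sends `g` to the character `X ↦ 0`, `g ↦ q⁻¹` and `X` to the upper right matrix coefficient of
`rep`. -/
def toDual : QBorel K q →ₐ[K] WithConv (QBorel K q →ₗ[K] K) :=
  lift (toConv (entryFun rep)) (toConv (char q⁻¹).toLinearMap) (toConv (char q).toLinearMap)
    (char_conv_char _ _ (hom_ext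
      (by simp [char, comul_eq, counit_eq, comulHom, counitHom])
      (by simp [char, comul_eq, counit_eq, comulHom, counitHom])
      (by simp [char, comul_eq, counit_eq, comulHom, counitHom])))
    (char_conv_char _ _ (hom_ext
      (by simp [char, comul_eq, counit_eq, comulHom, counitHom])
      (by simp [char, comul_eq, counit_eq, comulHom, counitHom])
      (by simp [char, comul_eq, counit_eq, comulHom, counitHom])))
    (by
      refine WithConv.ext (LinearMap.ext fun d => ?_)
      rw [ofConv_smul, LinearMap.smul_apply, entry_conv_char, char_conv_entry]
      have h : !![(q : K), 0; 0, 1] * (Algebra.TensorProduct.lift (scalarRep (char q⁻¹)) rep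
          (fun a b => scalarRep_commute _ a (rep b)) (comul (R := K) d)) =
          (Algebra.TensorProduct.lift rep (scalarRep (char q⁻¹))
          (fun a b => (scalarRep_commute _ b (rep a)).symm) (comul (R := K) d)) *
            !![(q : K), 0; 0, 1] := by
        have hd : d ∈ Algebra.adjoin K ({X, g, ginv} : Set (QBorel K q)) :=
          (adjoin_eq_top (K := K) (q := q)) ▸ Algebra.mem_top
        induction hd using Algebra.adjoin_induction with
        | mem x hx =>
          rcases hx with rfl | rfl | rfl <;>
          · simp only [comul_eq, comulHom, lift_X, lift_g, lift_ginv, map_add,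
              Algebra.TensorProduct.lift_tmul, scalarRep, AlgHom.comp_apply, rep, char, map_one,
              map_zero, mul_one, mul_zero, Algebra.ofId_apply,
              Matrix.algebraMap_eq_diagonal]
            ext i j; fin_cases i <;> fin_cases j <;> simp [Matrix.mul_apply, Matrix.diagonal, Matrix.vecHead, Matrix.vecTail, mul_assoc]
        | algebraMap r =>
          simp only [Bialgebra.comul_algebraMap, AlgHom.commutes]
          exact (Algebra.commutes r _).symm
        | add x y _ _ h1 h2 => simp only [map_add, mul_add, add_mul, h1, h2]
        | mul x y _ _ h1 h2 =>
          rw [Bialgebra.comul_mul, map_mul, map_mul, ← mul_assoc, h1, mul_assoc, h2, mul_assoc]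
      have h01 := congrFun (congrFun h 0) 1
      simp only [Matrix.mul_apply, Fin.sum_univ_two] at h01
      simp at h01
      exact h01.symm)

/-- The self-pairing `⟨x, a⟩` of `QBorel K q`: the Hopf algebra pairing with `⟨X, X⟩ = 1`,
`⟨g, g⟩ = q⁻¹` and `⟨g, X⟩ = ⟨X, g⟩ = 0`. -/
def pairing : QBorel K q →ₗ[K] QBorel K q →ₗ[K] K :=
  LinearMap.flip ((WithConv.linearEquiv K (QBorel K q →ₗ[K] K)).toLinearMap ∘ₗ toDual.toLinearMap)

end QBorel

/-! ### Bicovariant first order differential calculi -/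

/-- A (first order) bicovariant differential calculus over a Hopf algebra `A` in the sense of
Woronowicz: an `A`-bimodule `carrier` with a derivation `d` such that every element is a sum of
elements `a • d b`, and such that the assignments `a • d b ↦ Δ(a) (id ⊗ d) Δ(b)` and
`a • d b ↦ Δ(a) (d ⊗ id) Δ(b)` are well defined. Right multiplication by `a` is written `op a • γ`.
The maps `coactL`, `coactR` are determined by `d`. -/
structure BicovCalculus (k A : Type u) [Field k] [Ring A] [HopfAlgebra k A] : Type (u + 1) where
  carrier : Type u
  [addCommGroup : AddCommGroup carrier]
  [module : Module k carrier]
  [leftModule : Module A carrier]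
  [rightModule : Module Aᵐᵒᵖ carrier]
  [leftTower : IsScalarTower k A carrier]
  [rightTower : IsScalarTower k Aᵐᵒᵖ carrier]
  [bimodule : SMulCommClass A Aᵐᵒᵖ carrier]
  d : A →ₗ[k] carrier
  leibniz : ∀ a b : A, d (a * b) = a • d b + op b • d a
  span_d : Submodule.span A (Set.range d) = ⊤
  coactL : carrier →ₗ[k] A ⊗[k] carrier
  coactL_smul_d : ∀ a b : A, coactL (a • d b) =
    TensorProduct.map₂ (LinearMap.mul k A) (Algebra.lsmul k k carrier).toLinearMap (comul a)
      (TensorProduct.map LinearMap.id d (comul b))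
  coactR : carrier →ₗ[k] carrier ⊗[k] A
  coactR_smul_d : ∀ a b : A, coactR (a • d b) =
    TensorProduct.map₂ (Algebra.lsmul k k carrier).toLinearMap (LinearMap.mul k A) (comul a)
      (TensorProduct.map d LinearMap.id (comul b))

namespace BicovCalculus

attribute [instance] addCommGroup module leftModule rightModule leftTower rightTower bimodule

variable {k A : Type u} [Field k] [Ring A] [HopfAlgebra k A]

/-- Isomorphism of calculi: a bimodule isomorphism commuting with the differentials. -/
def Iso (Γ Γ' : BicovCalculus k A) : Prop :=
  ∃ e : Γ.carrier ≃ₗ[A] Γ'.carrier,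
    (∀ (a : A) (γ : Γ.carrier), e (op a • γ) = op a • e γ) ∧ ∀ a : A, e (Γ.d a) = Γ'.d a

theorem Iso.refl (Γ : BicovCalculus k A) : Iso Γ Γ :=
  ⟨LinearEquiv.refl A _, fun _ _ => rfl, fun _ => rfl⟩

theorem Iso.symm {Γ Γ' : BicovCalculus k A} (h : Iso Γ Γ') : Iso Γ' Γ := by
  obtain ⟨e, h1, h2⟩ := h
  refine ⟨e.symm, fun a γ => ?_, fun a => ?_⟩
  · rw [LinearEquiv.symm_apply_eq, h1, LinearEquiv.apply_symm_apply]
  · rw [LinearEquiv.symm_apply_eq, h2]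

theorem Iso.trans {Γ Γ' Γ'' : BicovCalculus k A} (h : Iso Γ Γ') (h' : Iso Γ' Γ'') :
    Iso Γ Γ'' := by
  obtain ⟨e, h1, h2⟩ := h
  obtain ⟨e', h1', h2'⟩ := h'
  exact ⟨e.trans e', fun a γ => by simp [h1, h1'], fun a => by simp [h2, h2']⟩

/-- `Γ'` is a quotient of `Γ`. A map as below is automatically surjective, because it commutes with
the differentials. -/
def IsQuotient (Γ Γ' : BicovCalculus k A) : Prop :=
  ∃ p : Γ.carrier →ₗ[A] Γ'.carrier,
    (∀ (a : A) (γ : Γ.carrier), p (op a • γ) = op a • p γ) ∧ ∀ a : A, p (Γ.d a) = Γ'.d a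

/-- `Γ` is coirreducible: it is nonzero and has no quotients except `0` and itself. -/
def Coirreducible (Γ : BicovCalculus k A) : Prop :=
  Nontrivial Γ.carrier ∧
    ∀ Γ' : BicovCalculus k A, IsQuotient Γ Γ' → Subsingleton Γ'.carrier ∨ Iso Γ Γ'

/-- The space of right invariant elements, `Δ_R(γ) = γ ⊗ 1`. -/
def rightInvariants (Γ : BicovCalculus k A) : Submodule k Γ.carrier :=
  LinearMap.eqLocus Γ.coactR ((TensorProduct.mk k Γ.carrier A).flip 1)

/-- `Γ` is finite dimensional. The dimension of a calculus is that of its space of right invariant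
elements (equivalently, its rank as a right `A`-module). -/
def FinDim (Γ : BicovCalculus k A) : Prop := FiniteDimensional k Γ.rightInvariants

/-- The dimension of a calculus. -/
def dim (Γ : BicovCalculus k A) : ℕ := Module.finrank k Γ.rightInvariants

/-- The bilinear map `(a, b) ↦ (d a) S(b)`. -/
def dMulAntipode (Γ : BicovCalculus k A) : A →ₗ[k] A →ₗ[k] Γ.carrier :=
  LinearMap.mk₂ k (fun a b => op (antipode k b) • Γ.d a)
    (fun a a' b => by simp) (fun c a b => by rw [map_smul, smul_comm])
    (fun a b b' => by simp [add_smul]) (fun c a b => by rw [map_smul, op_smul, smul_assoc])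

/-- The right invariant form `ω(v) = (d v₍₁₎) S(v₍₂₎)` of `v`. -/
def invForm (Γ : BicovCalculus k A) : A →ₗ[k] Γ.carrier :=
  TensorProduct.lift Γ.dMulAntipode ∘ₗ comul

/-- The subspace `M ⊆ ker ε` such that `Γ = (ker ε / M) ⊗ A`: it consists of the `v ∈ ker ε` whose
right invariant form vanishes (for `Γ = (ker ε / M) ⊗ A` with `d a = π(Δ a - 1 ⊗ a)` one has
`ω(v) = π(v) ⊗ 1` on `ker ε`). -/
def crossed (Γ : BicovCalculus k A) : Submodule k A :=
  LinearMap.ker (counit : A →ₗ[k] k) ⊓ LinearMap.ker Γ.invForm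

/-- `η i`, `i ∈ s`, are right invariant and form a basis of `Γ` as a right `A`-module. -/
structure IsRightInvBasis (Γ : BicovCalculus k A) (s : Finset ℕ) (η : ℕ → Γ.carrier) : Prop where
  inv : ∀ i ∈ s, η i ∈ Γ.rightInvariants
  linInd : LinearIndependent Aᵐᵒᵖ (fun i : s => η i)
  span : Submodule.span Aᵐᵒᵖ (η '' (s : Set ℕ)) = ⊤

end BicovCalculus

/-- Isomorphism of finite dimensional calculi. -/
instance finDimCalculusSetoid (k A : Type u) [Field k] [Ring A] [HopfAlgebra k A] :
    Setoid {Γ : BicovCalculus k A // Γ.FinDim} where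
  r Γ Γ' := BicovCalculus.Iso Γ.1 Γ'.1
  iseqv := ⟨fun Γ => .refl Γ.1, fun h => h.symm, fun h h' => h.trans h'⟩

/-- Isomorphism classes of finite dimensional bicovariant differential calculi over `A`. -/
def FinDimCalculi (k A : Type u) [Field k] [Ring A] [HopfAlgebra k A] : Type (u + 1) :=
  Quotient (finDimCalculusSetoid k A)

/-! ### Quantum tangent spaces -/

section TangentSpaces

variable {k U A : Type*} [Field k] [Ring U] [HopfAlgebra k U] [Ring A] [HopfAlgebra k A]

/-- The adjoint action `h ▷ x = h₍₁₎ x S(h₍₂₎)`. -/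
def adAct (h x : U) : U :=
  LinearMap.mul' k U (TensorProduct.map (LinearMap.mulRight k x) (antipode k) (comul (R := k) h))

/-- The coregular action `a ▷ x = ⟨x₍₁₎, a⟩ x₍₂₎`. -/
def coregAct (P : U →ₗ[k] A →ₗ[k] k) (a : A) (x : U) : U :=
  TensorProduct.lid k U (TensorProduct.map (P.flip a) LinearMap.id (comul (R := k) x))

/-- The projection `x ↦ x - ε(x) 1` onto `ker ε`. -/
def projKer (k : Type*) {U : Type*} [Field k] [Ring U] [HopfAlgebra k U] (x : U) : U :=
  x - algebraMap k U (counit x)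

/-- `L` is a quantum tangent space: a subspace of `ker ε ⊆ U` which is invariant under the adjoint
action of `U` and the coregular action of `A`, both followed by the projection to `ker ε`. -/
structure IsTangentSpace (P : U →ₗ[k] A →ₗ[k] k) (L : Submodule k U) : Prop where
  le_ker : L ≤ LinearMap.ker (counit : U →ₗ[k] k)
  ad_mem : ∀ (h : U), ∀ x ∈ L, projKer k (adAct (k := k) h x) ∈ L
  coreg_mem : ∀ (a : A), ∀ x ∈ L, projKer k (coregAct P a x) ∈ L

/-- Finite dimensional quantum tangent spaces. -/
abbrev FinDimTangentSpaces (P : U →ₗ[k] A →ₗ[k] k) :=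
  {L : Submodule k U // IsTangentSpace P L ∧ FiniteDimensional k L}

/-- The subspace of `ker ε ⊆ U` which annihilates `M`. -/
def annKer (P : U →ₗ[k] A →ₗ[k] k) (M : Submodule k A) : Submodule k U where
  carrier := {x | counit (R := k) x = 0 ∧ ∀ v ∈ M, P x v = 0}
  add_mem' hx hy := ⟨by simp [hx.1, hy.1], fun v hv => by simp [hx.2 v hv, hy.2 v hv]⟩
  zero_mem' := ⟨by simp, fun v _ => by simp⟩
  smul_mem' c x hx := ⟨by simp [hx.1], fun v hv => by simp [hx.2 v hv]⟩

/-- The braided derivation `∂_x(a) = ⟨x, a₍₁₎⟩ a₍₂₎`. -/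
def braidedDeriv (P : U →ₗ[k] A →ₗ[k] k) (x : U) : A →ₗ[k] A :=
  (TensorProduct.lid k A).toLinearMap ∘ₗ TensorProduct.map (P x) LinearMap.id ∘ₗ comul

end TangentSpaces

/-- `φ i`, `i ∈ s`, is a basis of the quantum tangent space of `Γ` (the annihilator of
`Γ.crossed`), and it is dual to the right invariant elements `η i`, `i ∈ s`, of `Γ` with respect to
the pairing `⟨x, ω(v)⟩ = ⟨x, v⟩` between the tangent space and the right invariant forms. -/
structure IsDualBasis {k A : Type u} {U : Type*} [Field k] [Ring A] [HopfAlgebra k A] [Ring U]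
    [HopfAlgebra k U] (P : U →ₗ[k] A →ₗ[k] k) (Γ : BicovCalculus k A) (s : Finset ℕ)
    (η : ℕ → Γ.carrier) (φ : ℕ → U) : Prop where
  linInd : LinearIndependent k (fun i : s => φ i)
  span : Submodule.span k (φ '' (s : Set ℕ)) = annKer P Γ.crossed
  dual : ∀ i ∈ s, ∀ j ∈ s, ∀ v : A, Γ.invForm v = η j → P (φ i) v = if i = j then 1 else 0

/-! ### Crossed submodules and the classical calculi -/

open Polynomial in
/-- For a finite set `I` of positive integers, the left ideal generated by the elements
`X^m ∏_{n ∈ I, n > m} (1 - q^{1-n} g)`, `m ≥ 0`. -/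
def crossedIdeal {K : Type u} [Field K] (q : Kˣ) (I : Finset ℕ+) : Submodule K (QBorel K q) :=
  (Ideal.span (Set.range fun m : ℕ => QBorel.X ^ m *
    aeval QBorel.g (∏ n ∈ I.filter (fun n : ℕ+ => m < (n : ℕ)),
      (1 - C ((q ^ (1 - ((n : ℕ) : ℤ)) : Kˣ) : K) * Polynomial.X))) :
    Ideal (QBorel K q)).restrictScalars K

namespace CB

open QBorel

variable {k : Type u} [Field k]

/-- The algebra map `f ↦ (f, ∂f/∂X; 0, f)`. -/
def jetX : CB k →ₐ[k] Matrix (Fin 2) (Fin 2) (CB k) :=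
  lift !![X, 1; 0, X] !![g, 0; 0, g] !![ginv, 0; 0, ginv]
    (by simp [g_mul_ginv, Matrix.one_fin_two]) (by simp [ginv_mul_g, Matrix.one_fin_two])
    (by simp [X_mul_g])

/-- The algebra map `f ↦ (f, ∂f/∂g; 0, f)`. -/
def jetG : CB k →ₐ[k] Matrix (Fin 2) (Fin 2) (CB k) :=
  lift !![X, 0; 0, X] !![g, 1; 0, g] !![ginv, -(ginv * ginv); 0, ginv]
    (by simp [g_mul_ginv, ← mul_assoc, Matrix.one_fin_two])
    (by simp [ginv_mul_g, mul_assoc, Matrix.one_fin_two])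
    (by simp [X_mul_g])

/-- The partial derivative `∂/∂X` on `C(B₊) = k[X, g, g⁻¹]`. -/
def dX : CB k →ₗ[k] CB k := Matrix.entryLinearMap k (CB k) 0 1 ∘ₗ jetX.toLinearMap

/-- The partial derivative `∂/∂g` on `C(B₊) = k[X, g, g⁻¹]`. -/
def dg : CB k →ₗ[k] CB k := Matrix.entryLinearMap k (CB k) 0 1 ∘ₗ jetG.toLinearMap

theorem dX_X : dX (X : CB k) = 1 := by simp [dX, jetX]
theorem dX_g : dX (g : CB k) = 0 := by simp [dX, jetX]
theorem dg_X : dg (X : CB k) = 0 := by simp [dg, jetG]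
theorem dg_g : dg (g : CB k) = 1 := by simp [dg, jetG]

theorem jet_diag (j : CB k →ₐ[k] Matrix (Fin 2) (Fin 2) (CB k))
    (h : ∀ a ∈ ({X, g, ginv} : Set (CB k)), j a 0 0 = a ∧ j a 1 0 = 0 ∧ j a 1 1 = a) (a : CB k) :
    j a 0 0 = a ∧ j a 1 0 = 0 ∧ j a 1 1 = a := by
  have ha : a ∈ Algebra.adjoin k ({X, g, ginv} : Set (CB k)) :=
    (adjoin_eq_top (K := k) (q := 1)) ▸ Algebra.mem_top
  induction ha using Algebra.adjoin_induction with
  | mem x hx => exact h x hx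
  | algebraMap r => simp [Matrix.algebraMap_eq_diagonal, Matrix.diagonal]
  | add x y _ _ h1 h2 => simp [h1, h2]
  | mul x y _ _ h1 h2 => simp [Matrix.mul_apply, h1, h2]

theorem dX_mul (a b : CB k) : dX (a * b) = a * dX b + dX a * b := by
  have h := jet_diag (k := k) jetX (by rintro a (rfl | rfl | rfl) <;> simp [jetX])
  simp [dX, Matrix.mul_apply, h]

theorem dg_mul (a b : CB k) : dg (a * b) = a * dg b + dg a * b := by
  have h := jet_diag (k := k) jetG (by rintro a (rfl | rfl | rfl) <;> simp [jetG])
  simp [dg, Matrix.mul_apply, h]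

/-- The relations `d X = η₁ + η₀ X`, `d g = η₀ g`, `[g, η_i] = 0` for all `i`, `[X, η_i] = 0` if
`i = 0` or `i = n - 1`, and `[X, η_i] = η_{i+1}` if `0 < i < n - 1`. -/
structure Relations (n : ℕ) (Γ : BicovCalculus k (CB k)) (η : ℕ → Γ.carrier) : Prop where
  d_X : Γ.d X = η 1 + op (X : CB k) • η 0
  d_g : Γ.d g = op (g : CB k) • η 0
  comm_g : ∀ i < n, (g : CB k) • η i - op (g : CB k) • η i = 0
  comm_X : ∀ i < n, (X : CB k) • η i - op (X : CB k) • η i =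
    if i = 0 ∨ i = n - 1 then 0 else η (i + 1)

/-- The derivations `∂₀ = X ∂/∂X + g ∂/∂g` and `∂_i = (1 / i!) (∂/∂X)^i` for `i ≥ 1`. -/
def derivation (i : ℕ) (f : CB k) : CB k :=
  if i = 0 then X * dX f + g * dg f else ((Nat.factorial i : k)⁻¹) • (dX^[i]) f

end CB

end

/-!
A bicovariant calculus is determined by its crossed submodule `M = {v ∈ ker ε : ω(v) = 0}`. The
identities `d a = ω(a₍₁₎) a₍₂₎` and `ω(a₍₁₎ v) a₍₂₎ = a ω(v) + ε(v) d a` show that `M` is a left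
ideal stable under the adjoint coaction `v ↦ v₍₁₎ S(v₍₃₎) ⊗ v₍₂₎`, that `Γ = ω(A) ⊗ A` with
`A / M = ω(A) ⊕ k`, and that isomorphisms and quotients of calculi are equalities and inclusions of
crossed submodules (`BicovCalculus.isCrossed_crossed`, `BicovCalculus.dim_add_one`,
`BicovCalculus.isQuotient_iff`). Conversely every left ideal of this kind comes from a calculus
(`IsCrossed.crossed_calculus`). For a nondegenerate pairing of Hopf algebras, annihilators of crossed
submodules are quantum tangent spaces, and the annihilator of a finite dimensional tangent space is a
crossed submodule of finite codimension whose annihilator is the tangent space again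
(`IsHopfPairing.annKer_annCounit`). So everything reduces to the classification of the crossed
submodules of finite codimension in `B_q`, and to the fact that they are closed for the pairings.

The algebra `B_q` has the basis `X^m g^l`, and the adjoint coaction separates the powers of `X`, so
that a crossed submodule of finite codimension is `⨁ X^m J_m` for ideals `J_m` of `K[g, g⁻¹]`. The
other components of the coaction show that `J_m` and `J_{m+1}` have generators `p_m`, `p_{m+1}` with
`p_m = p_{m+1}` or `p_m = (1 - q^{-m} g) p_{m+1}`, and finite codimension forces `p_m = 1` for
large `m`; hence `p_m = ∏_{n ∈ I, n > m} (1 - q^{1-n} g)` for a finite set `I`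
(`QBorel.exists_eq_crossedIdeal`). This needs only that the `q`-integers do not vanish. The
submodule `M_I` lies in `ker ε` if and only if `p_0(1) = 0`, that is `I ≠ ∅` for `q = 1` and `1 ∈ I`
for generic `q`. Its codimension is `∑_m deg p_m = ∑_{n ∈ I} n`.

On the side of the tangent space, the functional of `X^m h` on `B_q` is a nonzero multiple of that of
`h` on the coefficient of `X^m`, where `h` is a polynomial in `H`, respectively a Laurent polynomial
in `g`. On Laurent polynomials, `h(H)` is `g^l ↦ h(l)`, which vanishes on the multiples of
`(1 - g)^d` if `deg h < d`, and `g^s` is evaluation at a power of `q`, so that suitable `g^s` vanish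
on the multiples of `p_m`. This gives as many independent elements of the annihilator of `M_I` as the
codimension allows (`UB.crossedIdeal_closed`, `QBorel.crossedIdeal_closed_of_generic`).

For the explicit calculi on `C(B₊)`, the elements `g, X, …, X^{n-1}` of `C(B₊)` and
`H, X, …, X^{n-1} / (n-1)!` of `U(b₊)` are dual to each other, and a dual pair of this kind yields a
basis of the calculus over `A`, the dual basis of the tangent space and the formula for `d`
(`IsDualSystem`). The relations follow from the two identities for `ω` and from
`(1 - g)^2, X^i (1 - g), X^n ∈ M`.
-/

noncomputable section

/-! ### Sweedler sums and convolution with a right action -/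

section Sweedler

variable {k A : Type*} [Field k] [Ring A] [HopfAlgebra k A]
variable {N N' : Type*} [AddCommGroup N] [AddCommGroup N']

variable (k) in
/-- The Sweedler sum `∑ f(a₍₁₎, a₍₂₎)`, with respect to a fixed expression of `Δ a` as a sum of pure
tensors. It does not depend on this choice when `f` is bilinear. -/
def sw (a : A) (f : A → A → N) : N :=
  ∑ i ∈ (ℛ k a).index, f ((ℛ k a).left i) ((ℛ k a).right i)

theorem map_sw {F : Type*} [FunLike F N N'] [AddMonoidHomClass F N N'] (L : F) (a : A)
    (f : A → A → N) : L (sw k a f) = sw k a fun x y => L (f x y) := by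
  simp [sw]

theorem sw_add (a : A) (f g : A → A → N) :
    (sw k a fun x y => f x y + g x y) = sw k a f + sw k a g := by
  simp [sw, Finset.sum_add_distrib]

theorem smul_sw {R : Type*} [Monoid R] [DistribMulAction R N] (c : R) (a : A) (f : A → A → N) :
    c • sw k a f = sw k a fun x y => c • f x y := by
  simp [sw, Finset.smul_sum]

theorem sw_comm (a b : A) (f : A → A → A → A → N) :
    (sw k a fun x y => sw k b fun z w => f x y z w) =
      sw k b fun z w => sw k a fun x y => f x y z w :=
  Finset.sum_comm

variable [Module k N] [Module k N']

theorem lift_comul (β : A →ₗ[k] A →ₗ[k] N) (a : A) :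
    TensorProduct.lift β (comul a) = sw k a fun x y => β x y := by
  conv_lhs => rw [← (ℛ k a).eq]
  simp [sw]

theorem apply_comul (L : A ⊗[k] A →ₗ[k] N) (a : A) :
    L (comul a) = sw k a fun x y => L (x ⊗ₜ y) := by
  conv_lhs => rw [← (ℛ k a).eq]
  simp [sw]

theorem comul_eq_sw (a : A) : comul (R := k) a = sw k a fun x y => x ⊗ₜ[k] y :=
  (ℛ k a).eq.symm

variable (k) in
/-- A function of three arguments which is linear in each of them. -/
structure IsTrilinear (f : A → A → A → N) : Prop where
  add₁ : ∀ x x' y z, f (x + x') y z = f x y z + f x' y z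
  smul₁ : ∀ (c : k) x y z, f (c • x) y z = c • f x y z
  add₂ : ∀ x y y' z, f x (y + y') z = f x y z + f x y' z
  smul₂ : ∀ (c : k) x y z, f x (c • y) z = c • f x y z
  add₃ : ∀ x y z z', f x y (z + z') = f x y z + f x y z'
  smul₃ : ∀ (c : k) x y z, f x y (c • z) = c • f x y z

/-- Coassociativity in Sweedler notation. -/
theorem sw_assoc (f : A → A → A → N) (hf : IsTrilinear k f) (a : A) :
    (sw k a fun x z => sw k x fun p q => f p q z) =
      sw k a fun p w => sw k w fun q z => f p q z := by
  let τ : A →ₗ[k] A →ₗ[k] A →ₗ[k] N := LinearMap.mk₂ k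
    (fun x y => { toFun := f x y, map_add' := hf.add₃ x y, map_smul' := fun c => hf.smul₃ c x y })
    (fun x x' y => LinearMap.ext fun z => hf.add₁ x x' y z)
    (fun c x y => LinearMap.ext fun z => hf.smul₁ c x y z)
    (fun x y y' => LinearMap.ext fun z => hf.add₂ x y y' z)
    (fun c x y => LinearMap.ext fun z => hf.smul₂ c x y z)
  have h := sum_tmul_tmul_eq (ℛ k a) (fun i => ℛ k ((ℛ k a).left i))
    (fun i => ℛ k ((ℛ k a).right i))
  have h2 := congrArg (TensorProduct.lift
    ((TensorProduct.lift.equiv (RingHom.id k) A A N).toLinearMap ∘ₗ τ)) h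
  simpa [sw, τ] using h2

theorem sw_counit_left (f : A →ₗ[k] N) (a : A) :
    (sw k a fun x y => counit (R := k) x • f y) = f a := by
  have h := sum_counit_smul (R := k) (ℛ k a)
  conv_rhs => rw [← h]
  simp [sw]

theorem sw_counit_right (f : A →ₗ[k] N) (a : A) :
    (sw k a fun x y => counit (R := k) y • f x) = f a := by
  have h := congrArg (fun t => TensorProduct.rid k N (f.rTensor k t))
    (lTensor_counit_comul (R := k) a)
  have h2 := apply_comul ((TensorProduct.rid k N).toLinearMap ∘ₗ f.rTensor k ∘ₗ
    counit.lTensor A) a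
  simp only [LinearMap.comp_apply, LinearEquiv.coe_coe, LinearMap.lTensor_tmul,
    LinearMap.rTensor_tmul, TensorProduct.rid_tmul] at h2 h
  rw [← h2, h]; simp

theorem sw_mul (β : A →ₗ[k] A →ₗ[k] N) (a b : A) :
    (sw k (a * b) fun x y => β x y) =
      sw k a fun a₁ a₂ => sw k b fun b₁ b₂ => β (a₁ * b₁) (a₂ * b₂) := by
  rw [← lift_comul, Bialgebra.comul_mul, ← (ℛ k a).eq, ← (ℛ k b).eq, Finset.sum_mul_sum]
  simp [sw]

theorem sw_antipode_mul (f : A →ₗ[k] N) (a : A) :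
    (sw k a fun x y => f (antipode k x * y)) = counit (R := k) a • f 1 := by
  have h := congrArg f (sum_antipode_mul_eq_smul (R := k) (ℛ k a))
  simpa [sw] using h

theorem sw_mul_antipode (f : A →ₗ[k] N) (a : A) :
    (sw k a fun x y => f (x * antipode k y)) = counit (R := k) a • f 1 := by
  have h := congrArg f (sum_mul_antipode_eq_smul (R := k) (ℛ k a))
  simpa [sw] using h

/-- A linear family of operators on `N` which is a right action of the algebra `B`. -/
structure IsRightAct {B : Type*} [Ring B] [Algebra k B] (r : B →ₗ[k] Module.End k N) : Prop where
  one : r 1 = 1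
  mul : ∀ a b, r (a * b) = r b * r a

/-- The tensor product of right actions, as an action of the tensor product of the algebras. -/
def tensorAct {B B' : Type*} [Ring B] [Algebra k B] [Ring B'] [Algebra k B']
    (r : B →ₗ[k] Module.End k N) (r' : B' →ₗ[k] Module.End k N') :
    B ⊗[k] B' →ₗ[k] Module.End k (N ⊗[k] N') :=
  TensorProduct.homTensorHomMap (RingHom.id k) N N' N N' ∘ₗ TensorProduct.map r r'

section

variable {B B' : Type*} [Ring B] [Algebra k B] [Ring B'] [Algebra k B']
  {r : B →ₗ[k] Module.End k N} {r' : B' →ₗ[k] Module.End k N'}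

@[simp] theorem tensorAct_tmul (b : B) (b' : B') (n : N) (n' : N') :
    tensorAct r r' (b ⊗ₜ b') (n ⊗ₜ n') = r b n ⊗ₜ r' b' n' := rfl

theorem IsRightAct.tensor (h : IsRightAct r) (h' : IsRightAct r') :
    IsRightAct (tensorAct r r') where
  one := by
    ext n n'
    simp [Algebra.TensorProduct.one_def, h.one, h'.one]
  mul a b := by
    induction a using TensorProduct.induction_on with
    | zero => simp
    | add x y hx hy => simp only [add_mul, map_add, hx, hy, mul_add]
    | tmul x x' =>
      induction b using TensorProduct.induction_on with
      | zero => simp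
      | add x y hx hy => simp only [mul_add, map_add, hx, hy, add_mul]
      | tmul y y' =>
        ext n n'
        simp [h.mul, h'.mul]

theorem IsRightAct.comp (h : IsRightAct r) (f : B' →ₐ[k] B) :
    IsRightAct (r ∘ₗ f.toLinearMap) where
  one := by simp [h.one]
  mul a b := by simp [h.mul]

theorem isRightAct_mulRight : IsRightAct (LinearMap.mul k B).flip where
  one := by ext; simp
  mul a b := by ext; simp [mul_assoc]

end

/-- The convolution `a ↦ f(a₍₁₎) · a₍₂₎` of a linear map `f : A → N` with a right action on `N`. -/
def conv (f : A →ₗ[k] N) (r : A →ₗ[k] Module.End k N) : A →ₗ[k] N :=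
  TensorProduct.lift (r.flip ∘ₗ f) ∘ₗ comul

theorem conv_apply (f : A →ₗ[k] N) (r : A →ₗ[k] Module.End k N) (a : A) :
    conv f r a = sw k a fun x y => r y (f x) := by
  simp [conv, lift_comul]

theorem conv_conv_antipode {r : A →ₗ[k] Module.End k N} (h : IsRightAct r) (f : A →ₗ[k] N) :
    conv (conv f r) (r ∘ₗ antipode k) = f := by
  ext v
  simp only [conv_apply, map_sw, LinearMap.comp_apply]
  rw [sw_assoc (fun x y z => r (antipode k z) (r y (f x))) (by constructor <;> intros <;> simp)]
  have h1 : ∀ x y : A, (sw k y fun q z => r (antipode k z) (r q (f x))) =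
      counit (R := k) y • f x := fun x y => by
    have := sw_mul_antipode ((LinearMap.applyₗ (f x)).comp r) y
    simpa [h.mul, h.one] using this
  simp only [h1, sw_counit_right]

theorem conv_antipode_conv {r : A →ₗ[k] Module.End k N} (h : IsRightAct r) (f : A →ₗ[k] N) :
    conv (conv f (r ∘ₗ antipode k)) r = f := by
  ext v
  simp only [conv_apply, map_sw, LinearMap.comp_apply]
  rw [sw_assoc (fun x y z => r z (r (antipode k y) (f x))) (by constructor <;> intros <;> simp)]
  have h1 : ∀ x y : A, (sw k y fun q z => r z (r (antipode k q) (f x))) =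
      counit (R := k) y • f x := fun x y => by
    have := sw_antipode_mul ((LinearMap.applyₗ (f x)).comp r) y
    simpa [h.mul, h.one] using this
  simp only [h1, sw_counit_right]

/-- Convolution with a right action is injective, because the antipode inverts it. -/
theorem conv_injective {r : A →ₗ[k] Module.End k N} (h : IsRightAct r) {f f' : A →ₗ[k] N}
    (e : conv f r = conv f' r) : f = f' := by
  rw [← conv_conv_antipode h f, e, conv_conv_antipode h]

/-- The adjoint coaction `Ad(v) = v₍₁₎ S(v₍₃₎) ⊗ v₍₂₎`. -/
def adCoact : A →ₗ[k] A ⊗[k] A :=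
  TensorProduct.lift (LinearMap.mk₂ k
    (fun x w => LinearMap.rTensor A (LinearMap.mulLeft k x)
      (TensorProduct.comm k A A (LinearMap.lTensor A (antipode k) (comul w))))
    (fun x x' w => by
      rw [LinearMap.rTensor, LinearMap.rTensor, LinearMap.rTensor, ← LinearMap.add_apply,
        ← TensorProduct.map_add_left]
      congr 2; ext; simp [add_mul])
    (fun c x w => by
      rw [LinearMap.rTensor, LinearMap.rTensor, ← LinearMap.smul_apply,
        ← TensorProduct.map_smul_left]
      congr 2; ext; simp)
    (fun x w w' => by simp) (fun c x w => by simp)) ∘ₗ comul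

theorem adCoact_apply (v : A) :
    adCoact (k := k) v = sw k v fun x w => sw k w fun y z => (x * antipode k z) ⊗ₜ[k] y := by
  simp only [adCoact, LinearMap.comp_apply, lift_comul, LinearMap.mk₂_apply]
  simp only [comul_eq_sw, map_sw, LinearMap.lTensor_tmul, TensorProduct.comm_tmul,
    LinearMap.rTensor_tmul, LinearMap.mulLeft_apply]

end Sweedler

/-! ### The adjoint coaction -/

section AdCoaction

variable {k A : Type*} [Field k] [Ring A] [HopfAlgebra k A]
variable {N : Type*} [AddCommGroup N] [Module k N]

variable (k) in
/-- A function of two arguments which is linear in each of them. -/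
structure IsBilinear (f : A → A → N) : Prop where
  add₁ : ∀ x x' y, f (x + x') y = f x y + f x' y
  smul₁ : ∀ (c : k) x y, f (c • x) y = c • f x y
  add₂ : ∀ x y y', f x (y + y') = f x y + f x y'
  smul₂ : ∀ (c : k) x y, f x (c • y) = c • f x y

/-- The bilinear map with a given underlying function. -/
def IsBilinear.toMap {f : A → A → N} (hf : IsBilinear k f) : A →ₗ[k] A →ₗ[k] N :=
  LinearMap.mk₂ k f hf.add₁ hf.smul₁ hf.add₂ hf.smul₂

theorem IsBilinear.sw_eq {f : A → A → N} (hf : IsBilinear k f) (a : A) :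
    sw k a f = TensorProduct.lift hf.toMap (comul a) := by
  rw [lift_comul]; rfl

theorem sw_add_arg {f : A → A → N} (hf : IsBilinear k f) (a b : A) :
    sw k (a + b) f = sw k a f + sw k b f := by
  simp [hf.sw_eq]

theorem sw_smul_arg {f : A → A → N} (hf : IsBilinear k f) (c : k) (a : A) :
    sw k (c • a) f = c • sw k a f := by
  simp [hf.sw_eq]

theorem sw_mul_arg {f : A → A → N} (hf : IsBilinear k f) (a b : A) :
    sw k (a * b) f = sw k a fun a₁ a₂ => sw k b fun b₁ b₂ => f (a₁ * b₁) (a₂ * b₂) :=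
  sw_mul hf.toMap a b

/-- `Ad(v₍₁₎) (1 ⊗ f(·)) Δ(v₍₂₎)`: the adjoint coaction is, up to convolution with `Δ`, the
coproduct. -/
theorem conv_adCoact (f : A →ₗ[k] N) (r : A →ₗ[k] Module.End k N) :
    conv (LinearMap.lTensor A f ∘ₗ adCoact)
        (tensorAct (LinearMap.mul k A).flip r ∘ₗ (Bialgebra.comulAlgHom k A).toLinearMap) =
      LinearMap.lTensor A (conv f r) ∘ₗ comul := by
  ext v
  -- `K w = S(w₍₂₎) ⊗ f(w₍₁₎)` and `ℓ p` is left multiplication by `p` on the first factor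
  let K : A →ₗ[k] A ⊗[k] N := TensorProduct.map (antipode k) f ∘ₗ
    (TensorProduct.comm k A A).toLinearMap ∘ₗ comul
  let ℓ : A →ₗ[k] Module.End k (A ⊗[k] N) := LinearMap.rTensorHom N ∘ₗ LinearMap.mul k A
  let ρ : A →ₗ[k] Module.End k (A ⊗[k] N) :=
    tensorAct (LinearMap.mul k A).flip r ∘ₗ (Bialgebra.comulAlgHom k A).toLinearMap
  have hK : ∀ w, K w = sw k w fun y z => antipode k z ⊗ₜ[k] f y := fun w => by
    simp [K, comul_eq_sw, map_sw]
  have hAd : ∀ x, LinearMap.lTensor A f (adCoact x) = sw k x fun p w => ℓ p (K w) := fun x => by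
    simp [adCoact_apply, map_sw, hK, ℓ]
  have hcomm : ∀ p y t, ρ y (ℓ p t) = ℓ p (ρ y t) := fun p y t => by
    simp only [ρ, LinearMap.comp_apply, AlgHom.toLinearMap_apply, Bialgebra.comulAlgHom_apply,
      comul_eq_sw, map_sw]
    rw [← LinearMap.comp_apply, ← LinearMap.comp_apply (ℓ p)]
    congr 1
    ext a n
    simp [ℓ, sw, mul_assoc]
  have hρ : ∀ y a n, ρ y (a ⊗ₜ n) = sw k y fun y₁ y₂ => (a * y₁) ⊗ₜ r y₂ n := fun y a n => by
    simp [ρ, comul_eq_sw, sw]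
  have h1 : ∀ u n, (sw k u fun t y => ρ y (antipode k t ⊗ₜ[k] n)) = 1 ⊗ₜ r u n := fun u n => by
    simp only [hρ]
    rw [← sw_assoc (fun t y₁ y₂ => (antipode k t * y₁) ⊗ₜ r y₂ n)
      (by constructor <;> intros <;>
        simp [add_mul, mul_add, TensorProduct.add_tmul, TensorProduct.tmul_add,
          TensorProduct.smul_tmul'])]
    have h2 : ∀ z y₂, (sw k z fun t y₁ => (antipode k t * y₁) ⊗ₜ[k] r y₂ n) =
        counit (R := k) z • (1 : A) ⊗ₜ[k] r y₂ n := fun z y₂ =>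
      sw_antipode_mul ((TensorProduct.mk k A N).flip (r y₂ n)) z
    simp only [h2]
    exact sw_counit_left (TensorProduct.mk k A N 1 ∘ₗ r.flip n) u
  have h3 : ∀ w, (sw k w fun s y => ρ y (K s)) = 1 ⊗ₜ conv f r w := fun w => by
    simp only [hK, map_sw]
    rw [sw_assoc (fun s t y => ρ y (antipode k t ⊗ₜ[k] f s))
      (by constructor <;> intros <;>
        simp [TensorProduct.add_tmul, TensorProduct.tmul_add, ← TensorProduct.smul_tmul'])]
    simp only [h1, conv_apply]
    exact (map_sw (TensorProduct.mk k A N 1) w _).symm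
  have h4 : conv (LinearMap.lTensor A f ∘ₗ adCoact) ρ v =
      sw k v fun x y => sw k x fun p w => ℓ p (ρ y (K w)) := by
    simp only [conv_apply, LinearMap.comp_apply, hAd, map_sw, hcomm]
  refine h4.trans ?_
  rw [sw_assoc (fun p w y => ℓ p (ρ y (K w))) (by constructor <;> intros <;> simp)]
  simp only [← map_sw, h3]
  simp [comul_eq_sw, map_sw, ℓ]

theorem adCoact_mul (a v : A) :
    adCoact (k := k) (a * v) = sw k a fun x w => sw k w fun y z =>
      TensorProduct.map (LinearMap.mulLeft k x ∘ₗ LinearMap.mulRight k (antipode k z))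
        (LinearMap.mulLeft k y) (adCoact v) := by
  have hb : ∀ x : A, IsBilinear k fun y z : A => (x * antipode k z) ⊗ₜ[k] y := fun x => by
    constructor <;> intros <;>
      simp [mul_add, TensorProduct.add_tmul, TensorProduct.tmul_add, TensorProduct.smul_tmul']
  have hb' : IsBilinear k fun x w : A => sw k w fun y z => (x * antipode k z) ⊗ₜ[k] y := by
    constructor
    · intro x x' y; simp only [add_mul, TensorProduct.add_tmul]; exact sw_add _ _ _
    · intro c x y; simp [smul_sw, TensorProduct.smul_tmul']
    · intro x y y'; exact sw_add_arg (hb x) y y'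
    · intro c x y; exact sw_smul_arg (hb x) c y
  rw [adCoact_apply, sw_mul_arg hb']
  simp only [sw_mul_arg (hb _), adCoact_apply v, map_sw]
  unfold sw
  simp only [TensorProduct.map_tmul, LinearMap.comp_apply, LinearMap.mulLeft_apply,
    LinearMap.mulRight_apply, antipode_mul_antidistrib, mul_assoc]
  refine Finset.sum_congr rfl fun i _ => ?_
  rw [Finset.sum_comm]

theorem adCoact_one : adCoact (k := k) (1 : A) = 1 ⊗ₜ 1 := by
  simp [adCoact, Algebra.TensorProduct.one_def]

theorem isBilinear_adCoact_mul (t : A ⊗[k] A) :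
    (∀ x : A, IsBilinear k fun y z : A =>
      TensorProduct.map (LinearMap.mulLeft k x ∘ₗ LinearMap.mulRight k (antipode k z))
        (LinearMap.mulLeft k y) t) ∧
    IsBilinear k fun x w : A => sw k w fun y z : A =>
      TensorProduct.map (LinearMap.mulLeft k x ∘ₗ LinearMap.mulRight k (antipode k z))
        (LinearMap.mulLeft k y) t := by
  let Θ : A →ₗ[k] A →ₗ[k] A →ₗ[k] A ⊗[k] A :=
    LinearMap.mk₂ k (fun x y =>
      ((TensorProduct.mapBilinear (RingHom.id k) A A A A).flip (LinearMap.mulLeft k y) ∘ₗ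
        LinearMap.llcomp k A A A (LinearMap.mulLeft k x) ∘ₗ (LinearMap.mul k A).flip ∘ₗ
          antipode k).flip t)
      (fun x x' y => by
        ext z; induction t using TensorProduct.induction_on <;>
          simp_all [add_mul, TensorProduct.add_tmul]; abel)
      (fun c x y => by
        ext z; induction t using TensorProduct.induction_on <;>
          simp_all [TensorProduct.smul_tmul'])
      (fun x y y' => by
        ext z; induction t using TensorProduct.induction_on <;>
          simp_all [add_mul, TensorProduct.tmul_add]; abel)
      (fun c x y => by
        ext z; induction t using TensorProduct.induction_on <;>
          simp_all [TensorProduct.tmul_smul])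
  have hΘ : ∀ x y z, TensorProduct.map
      (LinearMap.mulLeft k x ∘ₗ LinearMap.mulRight k (antipode k z)) (LinearMap.mulLeft k y) t =
      Θ x y z := fun x y z => rfl
  simp only [hΘ]
  have h1 : ∀ x : A, IsBilinear k fun y z : A => Θ x y z := fun x => by
    constructor <;> intros <;> simp
  refine ⟨h1, ?_⟩
  constructor
  · intro x x' y; simp only [map_add, LinearMap.add_apply]; exact sw_add _ _ _
  · intro c x y; simp [smul_sw]
  · intro x y y'; exact sw_add_arg (h1 x) y y'
  · intro c x y; exact sw_smul_arg (h1 x) c y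

theorem sw_of_comul_eq {f : A → A → N} (hf : IsBilinear k f) {a x y : A}
    (h : comul (R := k) a = x ⊗ₜ y) : sw k a f = f x y := by
  rw [hf.sw_eq, h]; rfl

theorem sw_of_comul_eq_add {f : A → A → N} (hf : IsBilinear k f) {a x y z w : A}
    (h : comul (R := k) a = x ⊗ₜ y + z ⊗ₜ w) : sw k a f = f x y + f z w := by
  rw [hf.sw_eq, h, map_add]; rfl

/-- `Ad(g v) = (g ⊗ g) Ad(v) (g⁻¹ ⊗ 1)` for a group-like element `g`. -/
theorem adCoact_groupLike_mul {g : A} (hg : comul (R := k) g = g ⊗ₜ g) (v : A) :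
    adCoact (k := k) (g * v) =
      TensorProduct.map (LinearMap.mulLeft k g ∘ₗ LinearMap.mulRight k (antipode k g))
        (LinearMap.mulLeft k g) (adCoact v) := by
  obtain ⟨h1, h2⟩ := isBilinear_adCoact_mul (k := k) (adCoact (k := k) v)
  rw [adCoact_mul, sw_of_comul_eq h2 hg, sw_of_comul_eq (h1 g) hg]

/-- `Ad(x v)` for a skew-primitive element `x`. -/
theorem adCoact_skewPrimitive_mul {g x : A}
    (hx : comul (R := k) x = x ⊗ₜ 1 + g ⊗ₜ x) (v : A) :
    adCoact (k := k) (x * v) =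
      LinearMap.rTensor A (LinearMap.mulLeft k x) (adCoact v) +
      (TensorProduct.map (LinearMap.mulLeft k g) (LinearMap.mulLeft k x) (adCoact v) +
      TensorProduct.map (LinearMap.mulLeft k g ∘ₗ LinearMap.mulRight k (antipode k x))
        (LinearMap.mulLeft k g) (adCoact v)) := by
  obtain ⟨h1, h2⟩ := isBilinear_adCoact_mul (k := k) (adCoact (k := k) v)
  have h11 : comul (R := k) (1 : A) = 1 ⊗ₜ 1 := by
    rw [Bialgebra.comul_one, Algebra.TensorProduct.one_def]
  rw [adCoact_mul, sw_of_comul_eq_add h2 hx, sw_of_comul_eq (h1 x) h11,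
    sw_of_comul_eq_add (h1 g) hx]
  simp [antipode_one, LinearMap.rTensor, LinearMap.mulRight_one, LinearMap.mulLeft_one]

end AdCoaction

/-! ### Derivations of tensor products -/

section Bimodule

variable (k A : Type*) [Field k] [Ring A] [HopfAlgebra k A]
variable (E : Type*) [AddCommGroup E] [Module k E] [Module Aᵐᵒᵖ E] [IsScalarTower k Aᵐᵒᵖ E]

/-- Right multiplication on a bimodule. -/
def opAct : A →ₗ[k] Module.End k E :=
  LinearMap.mk₂ k (fun a γ => op a • γ) (fun a b γ => by simp [add_smul])
    (fun c a γ => by rw [op_smul, smul_assoc]) (fun a γ γ' => by simp)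
    (fun c a γ => by rw [smul_comm])

@[simp] theorem opAct_apply (a : A) (γ : E) : opAct k A E a γ = op a • γ := rfl

theorem isRightAct_opAct : IsRightAct (opAct k A E) where
  one := by ext; simp
  mul a b := by ext; simp [mul_smul]

variable {k A E} [Module A E] [IsScalarTower k A E] {d : A →ₗ[k] E}
  (hd : ∀ a b, d (a * b) = a • d b + op b • d a)

include hd

theorem lTensor_derivation_mul (s t : A ⊗[k] A) : LinearMap.lTensor A d (s * t) =
    TensorProduct.map₂ (LinearMap.mul k A) (Algebra.lsmul k k E).toLinearMap s
      (LinearMap.lTensor A d t) +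
    tensorAct (LinearMap.mul k A).flip (opAct k A E) t (LinearMap.lTensor A d s) := by
  induction s using TensorProduct.induction_on with
  | zero => simp
  | add x y hx hy => simp only [add_mul, map_add, hx, hy, LinearMap.add_apply]; abel
  | tmul x x' =>
    induction t using TensorProduct.induction_on with
    | zero => simp
    | add x y hx hy => simp only [mul_add, map_add, hx, hy, LinearMap.add_apply]; abel
    | tmul y y' => simp [hd, TensorProduct.tmul_add]

theorem rTensor_derivation_mul (s t : A ⊗[k] A) : LinearMap.rTensor A d (s * t) =
    TensorProduct.map₂ (Algebra.lsmul k k E).toLinearMap (LinearMap.mul k A) s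
      (LinearMap.rTensor A d t) +
    tensorAct (opAct k A E) (LinearMap.mul k A).flip t (LinearMap.rTensor A d s) := by
  induction s using TensorProduct.induction_on with
  | zero => simp
  | add x y hx hy => simp only [add_mul, map_add, hx, hy, LinearMap.add_apply]; abel
  | tmul x x' =>
    induction t using TensorProduct.induction_on with
    | zero => simp
    | add x y hx hy => simp only [mul_add, map_add, hx, hy, LinearMap.add_apply]; abel
    | tmul y y' => simp [hd, TensorProduct.add_tmul]

end Bimodule

/-! ### Right invariant forms of a bicovariant calculus -/

namespace BicovCalculus

variable {k A : Type u} [Field k] [Ring A] [HopfAlgebra k A] (Γ : BicovCalculus k A)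

/-- Right multiplication on a calculus. -/
abbrev rightAct : A →ₗ[k] Module.End k Γ.carrier := opAct k A Γ.carrier

theorem rightAct_apply (a : A) (γ : Γ.carrier) : Γ.rightAct a γ = op a • γ := rfl

theorem isRightAct_rightAct : IsRightAct Γ.rightAct := isRightAct_opAct k A Γ.carrier

theorem d_one : Γ.d 1 = 0 := by
  have h := Γ.leibniz 1 1
  simpa using h

theorem invForm_eq_conv : Γ.invForm = conv Γ.d (Γ.rightAct ∘ₗ antipode k) := by
  ext a
  simp [invForm, conv_apply, lift_comul, dMulAntipode]

/-- `d a = ω(a₍₁₎) a₍₂₎`. -/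
theorem conv_invForm : conv Γ.invForm Γ.rightAct = Γ.d := by
  rw [invForm_eq_conv, conv_antipode_conv Γ.isRightAct_rightAct]

theorem d_eq_sw (a : A) : Γ.d a = sw k a fun x y => op y • Γ.invForm x := by
  conv_lhs => rw [← Γ.conv_invForm]
  simp [conv_apply]

theorem invForm_one : Γ.invForm 1 = 0 := by
  simp [invForm, Algebra.TensorProduct.one_def, dMulAntipode, d_one]

theorem invForm_algebraMap (c : k) : Γ.invForm (algebraMap k A c) = 0 := by
  rw [Algebra.algebraMap_eq_smul_one, map_smul, invForm_one, smul_zero]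

/-- `Γ` is spanned over `k` by the elements `(d a) b`. -/
theorem span_right : Submodule.span k (Set.range fun p : A × A => op p.2 • Γ.d p.1) = ⊤ := by
  set S := Submodule.span k (Set.range fun p : A × A => op p.2 • Γ.d p.1) with hS
  have hmem : ∀ a b : A, op b • Γ.d a ∈ S := fun a b => Submodule.subset_span ⟨(a, b), rfl⟩
  have hsmul : ∀ (a : A) (γ : Γ.carrier), γ ∈ S → a • γ ∈ S := by
    intro a γ hγ
    induction hγ using Submodule.span_induction with
    | mem x hx =>
      obtain ⟨⟨b, c⟩, rfl⟩ := hx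
      have h : a • op c • Γ.d b = op c • Γ.d (a * b) - op (b * c) • Γ.d a := by
        rw [Γ.leibniz, smul_add, smul_comm, op_mul, mul_smul, add_sub_cancel_right]
      show a • op c • Γ.d b ∈ S
      rw [h]
      exact S.sub_mem (hmem _ _) (hmem _ _)
    | zero => simp
    | add x y _ _ hx hy => rw [smul_add]; exact S.add_mem hx hy
    | smul c x _ hx => rw [smul_comm]; exact S.smul_mem c hx
  refine eq_top_iff.mpr fun γ _ => ?_
  have hγ : γ ∈ Submodule.span A (Set.range Γ.d) := Γ.span_d ▸ Submodule.mem_top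
  induction hγ using Submodule.span_induction with
  | mem x hx =>
    obtain ⟨a, rfl⟩ := hx
    simpa using hmem a 1
  | zero => exact S.zero_mem
  | add x y _ _ hx hy => exact S.add_mem (hx trivial) (hy trivial)
  | smul a x _ hx => exact hsmul a x (hx trivial)

theorem induction_right {p : Γ.carrier → Prop} (h : ∀ a b : A, p (op b • Γ.d a)) (h0 : p 0)
    (hadd : ∀ x y, p x → p y → p (x + y)) (hsmul : ∀ (c : k) x, p x → p (c • x))
    (γ : Γ.carrier) : p γ := by
  have hγ : γ ∈ Submodule.span k (Set.range fun p : A × A => op p.2 • Γ.d p.1) :=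
    Γ.span_right ▸ Submodule.mem_top
  induction hγ using Submodule.span_induction with
  | mem x hx => obtain ⟨⟨a, b⟩, rfl⟩ := hx; exact h a b
  | zero => exact h0
  | add x y _ _ hx hy => exact hadd x y hx hy
  | smul c x _ hx => exact hsmul c x hx

section Coaction

variable {N : Type*} [AddCommGroup N] [Module k N] {Γ}

/-- A map `δ` with `δ(a • d b) = Δ(a) D(Δ(b))`, for a derivation `D` of `A ⊗ A` into a bimodule, is
right covariant. -/
theorem coaction_op_smul_d {δ : Γ.carrier →ₗ[k] N} {l r : A ⊗[k] A →ₗ[k] Module.End k N}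
    {D : A ⊗[k] A →ₗ[k] N} (hl : l 1 = 1) (hD : ∀ s t, D (s * t) = l s (D t) + r t (D s))
    (hδ : ∀ a b, δ (a • Γ.d b) = l (comul a) (D (comul b))) (a b : A) :
    δ (op b • Γ.d a) = r (comul b) (D (comul a)) := by
  have h1 : ∀ a, δ (Γ.d a) = D (comul a) := fun a => by
    have h := hδ 1 a
    rwa [one_smul, Bialgebra.comul_one, hl] at h
  have h : op b • Γ.d a = Γ.d (a * b) - a • Γ.d b := by rw [Γ.leibniz, add_sub_cancel_left]
  rw [h, map_sub, h1, hδ, Bialgebra.comul_mul, hD, add_sub_cancel_left]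

theorem coaction_op_smul {δ : Γ.carrier →ₗ[k] N} {r : A ⊗[k] A →ₗ[k] Module.End k N}
    {D : A ⊗[k] A →ₗ[k] N} (hr : IsRightAct r)
    (h : ∀ a b, δ (op b • Γ.d a) = r (comul b) (D (comul a))) (c : A) (γ : Γ.carrier) :
    δ (op c • γ) = r (comul c) (δ γ) := by
  induction γ using Γ.induction_right with
  | h a b => rw [← mul_smul, ← op_mul, h, h, Bialgebra.comul_mul, hr.mul]; rfl
  | h0 => simp
  | hadd x y hx hy => simp only [smul_add, map_add, hx, hy]
  | hsmul c' x hx => rw [smul_comm, map_smul, hx, map_smul, map_smul]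

/-- The values of a right covariant map on invariant forms. -/
theorem coaction_invForm {δ : Γ.carrier →ₗ[k] N} {r : A ⊗[k] A →ₗ[k] Module.End k N}
    {D : A ⊗[k] A →ₗ[k] N} (h : ∀ a b, δ (op b • Γ.d a) = r (comul b) (D (comul a))) :
    δ ∘ₗ Γ.invForm = conv (D ∘ₗ comul)
      ((r ∘ₗ (Bialgebra.comulAlgHom k A).toLinearMap) ∘ₗ antipode k) := by
  ext v
  rw [LinearMap.comp_apply, invForm_eq_conv, conv_apply, conv_apply, map_sw]
  simp [h]

end Coaction

theorem coactL_op_smul_d (a b : A) : Γ.coactL (op b • Γ.d a) =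
    tensorAct (LinearMap.mul k A).flip Γ.rightAct (comul b)
      (LinearMap.lTensor A Γ.d (comul a)) := by
  refine coaction_op_smul_d
    (l := TensorProduct.map₂ (LinearMap.mul k A) (Algebra.lsmul k k Γ.carrier).toLinearMap)
    (by ext; simp [Algebra.TensorProduct.one_def]) (lTensor_derivation_mul Γ.leibniz)
    Γ.coactL_smul_d a b

theorem coactR_op_smul_d (a b : A) : Γ.coactR (op b • Γ.d a) =
    tensorAct Γ.rightAct (LinearMap.mul k A).flip (comul b)
      (LinearMap.rTensor A Γ.d (comul a)) := by
  refine coaction_op_smul_d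
    (l := TensorProduct.map₂ (Algebra.lsmul k k Γ.carrier).toLinearMap (LinearMap.mul k A))
    (by ext; simp [Algebra.TensorProduct.one_def]) (rTensor_derivation_mul Γ.leibniz)
    Γ.coactR_smul_d a b

theorem coactR_op_smul (c : A) (γ : Γ.carrier) : Γ.coactR (op c • γ) =
    tensorAct Γ.rightAct (LinearMap.mul k A).flip (comul c) (Γ.coactR γ) :=
  coaction_op_smul (Γ.isRightAct_rightAct.tensor isRightAct_mulRight) Γ.coactR_op_smul_d c γ

/-- `Δ_L(ω(v)) = v₍₁₎ S(v₍₃₎) ⊗ ω(v₍₂₎)`. -/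
theorem coactL_invForm (v : A) :
    Γ.coactL (Γ.invForm v) = LinearMap.lTensor A Γ.invForm (adCoact v) := by
  have h := coaction_invForm Γ.coactL_op_smul_d
  rw [← conv_invForm, ← conv_adCoact, conv_conv_antipode
    ((isRightAct_mulRight.tensor Γ.isRightAct_rightAct).comp (Bialgebra.comulAlgHom k A))] at h
  exact LinearMap.congr_fun h v

/-- The form `ω(v)` is right invariant. -/
theorem coactR_invForm (v : A) : Γ.coactR (Γ.invForm v) = Γ.invForm v ⊗ₜ 1 := by
  have hr : IsRightAct (tensorAct Γ.rightAct (LinearMap.mul k A).flip) :=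
    Γ.isRightAct_rightAct.tensor isRightAct_mulRight
  have h := coaction_invForm Γ.coactR_op_smul_d
  have h2 : LinearMap.rTensor A Γ.d ∘ₗ comul =
      conv ((TensorProduct.mk k Γ.carrier A).flip 1 ∘ₗ Γ.invForm)
      (tensorAct Γ.rightAct (LinearMap.mul k A).flip ∘ₗ
        (Bialgebra.comulAlgHom k A).toLinearMap) := by
    ext v
    simp only [conv_apply, LinearMap.comp_apply, LinearMap.flip_apply, TensorProduct.mk_apply,
      AlgHom.toLinearMap_apply, Bialgebra.comulAlgHom_apply, comul_eq_sw, map_sw,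
      LinearMap.rTensor_tmul, d_eq_sw]
    have e1 : ∀ x y : A, (sw k x fun p q => op q • Γ.invForm p) ⊗ₜ[k] y =
        sw k x fun p q => Γ.rightAct q (Γ.invForm p) ⊗ₜ[k] y := fun x y =>
      map_sw ((TensorProduct.mk k Γ.carrier A).flip y) x _
    simp only [e1]
    rw [sw_assoc (fun p q y => Γ.rightAct q (Γ.invForm p) ⊗ₜ[k] y) (by
      constructor <;> intros <;> simp [-opAct_apply, TensorProduct.add_tmul,
        TensorProduct.tmul_add, TensorProduct.smul_tmul'])]
    simp [sw]
  rw [h2, conv_conv_antipode (hr.comp (Bialgebra.comulAlgHom k A))] at h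
  exact LinearMap.congr_fun h v

end BicovCalculus

/-! ### The crossed submodule of a calculus -/

/-- Over a field, a linear map factors through every linear map with a smaller kernel. -/
theorem exists_comp_eq_of_ker_le {k V W W' : Type*} [Field k] [AddCommGroup V] [Module k V]
    [AddCommGroup W] [Module k W] [AddCommGroup W'] [Module k W'] {f : V →ₗ[k] W}
    {g : V →ₗ[k] W'} (h : LinearMap.ker f ≤ LinearMap.ker g) : ∃ τ : W →ₗ[k] W', τ ∘ₗ f = g := by
  obtain ⟨τ, hτ⟩ := LinearMap.exists_extend
    ((LinearMap.ker f).liftQ g h ∘ₗ f.quotKerEquivRange.symm.toLinearMap)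
  refine ⟨τ, LinearMap.ext fun v => ?_⟩
  have h1 := LinearMap.congr_fun hτ ⟨f v, v, rfl⟩
  have h2 : f.quotKerEquivRange.symm ⟨f v, v, rfl⟩ = (LinearMap.ker f).mkQ v := by
    rw [LinearEquiv.symm_apply_eq]; rfl
  simp only [LinearMap.comp_apply, Submodule.subtype_apply, LinearEquiv.coe_coe, h2] at h1
  simpa using h1

/-- A crossed submodule of the augmentation ideal: a left ideal which is stable under the adjoint
coaction. -/
structure IsCrossed {k A : Type*} [Field k] [Ring A] [HopfAlgebra k A] (M : Submodule k A) :
    Prop where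
  counit_eq : ∀ v ∈ M, counit (R := k) v = 0
  mul_mem : ∀ (a : A), ∀ v ∈ M, a * v ∈ M
  coinv : ∀ v ∈ M, LinearMap.lTensor A M.mkQ (adCoact v) = 0

section AdCounit

variable {k A : Type*} [Field k] [Ring A] [HopfAlgebra k A]

theorem lTensor_counit_adCoact (v : A) :
    LinearMap.lTensor A (counit : A →ₗ[k] k) (adCoact v) = counit (R := k) v • 1 ⊗ₜ 1 := by
  simp only [adCoact_apply, map_sw, LinearMap.lTensor_tmul]
  have h1 : ∀ x w : A, (sw k w fun y z => (x * antipode k z) ⊗ₜ[k] counit (R := k) y) =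
      (x * antipode k w) ⊗ₜ[k] (1 : k) := fun x w => by
    have := sw_counit_left ((TensorProduct.mk k A k).flip 1 ∘ₗ LinearMap.mulLeft k x ∘ₗ
      antipode k) w
    simp only [LinearMap.comp_apply, LinearMap.flip_apply, TensorProduct.mk_apply,
      LinearMap.mulLeft_apply] at this
    rw [← this]
    congr 1
    ext y z
    rw [← TensorProduct.tmul_smul, smul_eq_mul, mul_one]
  simp only [h1]
  exact sw_mul_antipode ((TensorProduct.mk k A k).flip 1) v

/-- `Ad` maps the augmentation ideal into its tensor product with `A`. -/
theorem lTensor_projKer_adCoact {v : A} (hv : counit (R := k) v = 0) :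
    LinearMap.lTensor A (LinearMap.id - Algebra.linearMap k A ∘ₗ counit) (adCoact v) =
      adCoact (k := k) v := by
  rw [LinearMap.lTensor_sub, LinearMap.lTensor_comp, LinearMap.sub_apply, LinearMap.comp_apply,
    lTensor_counit_adCoact, hv]
  simp

end AdCounit

namespace BicovCalculus

variable {k A : Type u} [Field k] [Ring A] [HopfAlgebra k A] (Γ : BicovCalculus k A)

theorem mem_crossed {v : A} : v ∈ Γ.crossed ↔ counit (R := k) v = 0 ∧ Γ.invForm v = 0 := by
  simp [crossed]

/-- `ω(a₍₁₎ v) a₍₂₎ = a ω(v) + ε(v) d a`. -/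
theorem sw_invForm_mul (a v : A) : (sw k a fun x y => op y • Γ.invForm (x * v)) =
    a • Γ.invForm v + counit (R := k) v • Γ.d a := by
  let G : A →ₗ[k] Γ.carrier :=
    sw k a fun x y => Γ.rightAct y ∘ₗ Γ.invForm ∘ₗ LinearMap.mulLeft k x
  let F : A →ₗ[k] Γ.carrier := Algebra.lsmul k k Γ.carrier a ∘ₗ Γ.invForm +
    (counit : A →ₗ[k] k).smulRight (Γ.d a)
  have hG : ∀ w, G w = sw k a fun x y => op y • Γ.invForm (x * w) := fun w => by
    have := map_sw (k := k) (LinearMap.applyₗ (R := k) w) a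
      fun x y => Γ.rightAct y ∘ₗ Γ.invForm ∘ₗ LinearMap.mulLeft k x
    exact this
  have hF : ∀ w, F w = a • Γ.invForm w + counit (R := k) w • Γ.d a := fun w => rfl
  rw [← hG, ← hF]
  refine LinearMap.congr_fun (conv_injective Γ.isRightAct_rightAct (LinearMap.ext fun w => ?_)) v
  -- both sides convolve to `d(a w)`
  have h1 : conv G Γ.rightAct w = Γ.d (a * w) := by
    rw [d_eq_sw]
    have hb : IsBilinear k fun x y : A => Γ.rightAct y (Γ.invForm x) := by
      constructor <;> intros <;> simp [-opAct_apply]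
    refine Eq.trans ?_ (sw_mul_arg hb a w).symm
    simp only [conv_apply, hG, map_sw, rightAct_apply, op_mul, mul_smul]
    exact sw_comm _ _ _
  have h2 : conv F Γ.rightAct w = Γ.d (a * w) := by
    have h3 := sw_counit_left (Γ.rightAct.flip (Γ.d a)) w
    simp only [LinearMap.flip_apply, rightAct_apply] at h3
    rw [Γ.leibniz, d_eq_sw Γ w, ← h3, smul_sw, ← sw_add]
    simp only [conv_apply, hF, rightAct_apply, smul_add]
    congr 1; ext p q
    rw [smul_comm a, smul_comm (op q) (counit (R := k) p)]
  rw [h1, h2]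

/-- The crossed submodule of a calculus is a left ideal and stable under the adjoint coaction. -/
theorem isCrossed_crossed : IsCrossed Γ.crossed where
  counit_eq v hv := (Γ.mem_crossed.mp hv).1
  mul_mem a v hv := by
    rw [mem_crossed] at hv ⊢
    refine ⟨by simp [hv.1], ?_⟩
    have h : conv (Γ.invForm ∘ₗ LinearMap.mulRight k v) Γ.rightAct = conv 0 Γ.rightAct := by
      ext b
      have := Γ.sw_invForm_mul b v
      simpa [conv_apply, hv.1, hv.2, sw] using this
    simpa using LinearMap.congr_fun (conv_injective Γ.isRightAct_rightAct h) a
  coinv v hv := by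
    have hv' := Γ.mem_crossed.mp hv
    let π : A →ₗ[k] A := LinearMap.id - Algebra.linearMap k A ∘ₗ counit
    obtain ⟨τ, hτ⟩ := exists_comp_eq_of_ker_le (f := Γ.invForm) (g := Γ.crossed.mkQ ∘ₗ π) (by
      intro w hw
      rw [LinearMap.mem_ker] at hw
      simp only [LinearMap.mem_ker, LinearMap.comp_apply, Submodule.mkQ_apply,
        Submodule.Quotient.mk_eq_zero, mem_crossed]
      simp [π, hw, invForm_algebraMap])
    rw [← lTensor_projKer_adCoact hv'.1, ← LinearMap.comp_apply, ← LinearMap.lTensor_comp, ← hτ,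
      LinearMap.lTensor_comp, LinearMap.comp_apply, ← coactL_invForm, hv'.2]
    simp

/-! ### Right invariant forms are a basis of a calculus over `A` -/

/-- The map `γ ⊗ b ↦ γ b`. -/
def mulForm : Γ.carrier ⊗[k] A →ₗ[k] Γ.carrier := TensorProduct.lift Γ.rightAct.flip

@[simp] theorem mulForm_tmul (γ : Γ.carrier) (b : A) : Γ.mulForm (γ ⊗ₜ b) = op b • γ := rfl

/-- The map `γ ↦ γ₍₀₎ S(γ₍₁₎) ⊗ γ₍₂₎`, where `Δ_R(γ) = γ₍₀₎ ⊗ γ₍₁₎`. -/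
def splitForm : Γ.carrier →ₗ[k] Γ.carrier ⊗[k] A :=
  LinearMap.rTensor A (TensorProduct.lift (Γ.rightAct ∘ₗ antipode k).flip) ∘ₗ
    (TensorProduct.assoc k Γ.carrier A A).symm.toLinearMap ∘ₗ
      LinearMap.lTensor Γ.carrier comul ∘ₗ Γ.coactR

theorem splitForm_eq_of_coactR {γ : Γ.carrier} (h : Γ.coactR γ = γ ⊗ₜ 1) :
    Γ.splitForm γ = γ ⊗ₜ 1 := by
  simp [splitForm, h, Algebra.TensorProduct.one_def, antipode_one]

theorem splitForm_op_smul_invForm (v b : A) :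
    Γ.splitForm (op b • Γ.invForm v) = Γ.invForm v ⊗ₜ b := by
  have h : Γ.splitForm (op b • Γ.invForm v) = sw k b fun p w => sw k w fun x y =>
      Γ.rightAct (antipode k x) (Γ.rightAct p (Γ.invForm v)) ⊗ₜ[k] y := by
    simp only [splitForm, LinearMap.comp_apply, coactR_op_smul, coactR_invForm]
    simp [comul_eq_sw, sw, TensorProduct.tmul_sum]
  rw [h, ← sw_assoc (fun p x y => Γ.rightAct (antipode k x) (Γ.rightAct p (Γ.invForm v)) ⊗ₜ[k] y)
    (by constructor <;> intros <;> simp [-opAct_apply, TensorProduct.add_tmul,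
        TensorProduct.tmul_add, TensorProduct.smul_tmul'])]
  have h1 : ∀ z y : A, (sw k z fun p x =>
      Γ.rightAct (antipode k x) (Γ.rightAct p (Γ.invForm v)) ⊗ₜ[k] y) =
      counit (R := k) z • Γ.invForm v ⊗ₜ[k] y := fun z y => by
    have h2 := sw_mul_antipode ((TensorProduct.mk k Γ.carrier A).flip y ∘ₗ
      Γ.rightAct.flip (Γ.invForm v)) z
    simpa [mul_smul] using h2
  simp only [h1]
  exact sw_counit_left (TensorProduct.mk k Γ.carrier A (Γ.invForm v)) b

theorem splitForm_mulForm (z : A ⊗[k] A) :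
    Γ.splitForm (Γ.mulForm (LinearMap.rTensor A Γ.invForm z)) = LinearMap.rTensor A Γ.invForm z := by
  induction z using TensorProduct.induction_on with
  | zero => simp
  | tmul v b => simp [splitForm_op_smul_invForm]
  | add x y hx hy => simp only [map_add, hx, hy]

theorem op_smul_d_eq (a b : A) : op b • Γ.d a =
    Γ.mulForm (LinearMap.rTensor A Γ.invForm
      (LinearMap.lTensor A (LinearMap.mulRight k b) (comul a))) := by
  rw [d_eq_sw, smul_sw]
  simp [comul_eq_sw, map_sw, mul_smul]

theorem exists_mulForm_eq (γ : Γ.carrier) :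
    ∃ z : A ⊗[k] A, Γ.mulForm (LinearMap.rTensor A Γ.invForm z) = γ := by
  induction γ using Γ.induction_right with
  | h a b => exact ⟨_, (Γ.op_smul_d_eq a b).symm⟩
  | h0 => exact ⟨0, by simp⟩
  | hadd x y hx hy =>
    obtain ⟨z, rfl⟩ := hx
    obtain ⟨w, rfl⟩ := hy
    exact ⟨z + w, by simp⟩
  | hsmul c x hx =>
    obtain ⟨z, rfl⟩ := hx
    exact ⟨c • z, by simp⟩

theorem rightInvariants_eq : Γ.rightInvariants = LinearMap.range Γ.invForm := by
  refine le_antisymm (fun γ hγ => ?_) ?_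
  · have h1 : Γ.coactR γ = γ ⊗ₜ 1 := hγ
    obtain ⟨z, rfl⟩ := Γ.exists_mulForm_eq γ
    have h2 := Γ.splitForm_eq_of_coactR h1
    rw [splitForm_mulForm] at h2
    have h3 := congrArg (fun t => TensorProduct.rid k Γ.carrier (counit.lTensor Γ.carrier t)) h2
    simp only [LinearMap.lTensor_tmul, Bialgebra.counit_one, TensorProduct.rid_tmul,
      one_smul] at h3
    rw [← h3]
    generalize z = z
    induction z using TensorProduct.induction_on with
    | zero => simp
    | tmul v b => exact ⟨counit (R := k) b • v, by simp⟩
    | add x y hx hy => simp only [map_add]; exact Submodule.add_mem _ hx hy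
  · rintro _ ⟨v, rfl⟩
    exact Γ.coactR_invForm v

theorem invForm_mem (v : A) : Γ.invForm v ∈ Γ.rightInvariants := Γ.coactR_invForm v

/-- The map `v ↦ (ω(v), ε(v))`. -/
def invFormCounit : A →ₗ[k] Γ.rightInvariants × k :=
  (Γ.invForm.codRestrict Γ.rightInvariants Γ.invForm_mem).prod counit

theorem ker_invFormCounit : LinearMap.ker Γ.invFormCounit = Γ.crossed := by
  rw [invFormCounit, LinearMap.ker_prod, LinearMap.ker_codRestrict, crossed, inf_comm]

theorem invFormCounit_surjective : Function.Surjective Γ.invFormCounit := by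
  rintro ⟨⟨γ, hγ⟩, c⟩
  have hγ' := hγ
  rw [rightInvariants_eq] at hγ'
  obtain ⟨v, rfl⟩ := hγ'
  refine ⟨v + algebraMap k A (c - counit (R := k) v), Prod.ext (Subtype.ext ?_) ?_⟩
  · show Γ.invForm (v + algebraMap k A (c - counit (R := k) v)) = Γ.invForm v
    rw [map_add, invForm_algebraMap, add_zero]
  · show counit (R := k) (v + algebraMap k A (c - counit (R := k) v)) = c
    rw [map_add, Bialgebra.counit_algebraMap, add_sub_cancel]

/-- `A / M` is the sum of the right invariant forms and the ground field. -/
def quotCrossedEquiv : (A ⧸ Γ.crossed) ≃ₗ[k] Γ.rightInvariants × k :=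
  (Submodule.quotEquivOfEq _ _ Γ.ker_invFormCounit.symm).trans
    (LinearMap.quotKerEquivOfSurjective Γ.invFormCounit Γ.invFormCounit_surjective)

theorem finDim_iff : Γ.FinDim ↔ FiniteDimensional k (A ⧸ Γ.crossed) := by
  constructor
  · intro h
    have : FiniteDimensional k Γ.rightInvariants := h
    exact Module.Finite.equiv Γ.quotCrossedEquiv.symm
  · intro h
    have := Module.Finite.equiv Γ.quotCrossedEquiv
    exact Module.Finite.of_surjective (LinearMap.fst k Γ.rightInvariants k) Prod.fst_surjective

theorem dim_add_one (h : Γ.FinDim) : Γ.dim + 1 = Module.finrank k (A ⧸ Γ.crossed) := by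
  have : FiniteDimensional k Γ.rightInvariants := h
  rw [Γ.quotCrossedEquiv.finrank_eq, Module.finrank_prod, Module.finrank_self]; rfl

/-! ### Quotients of a calculus -/

variable {Γ} {Γ' : BicovCalculus k A}

theorem map_invForm {p : Γ.carrier →ₗ[A] Γ'.carrier}
    (h1 : ∀ (a : A) (γ : Γ.carrier), p (op a • γ) = op a • p γ)
    (h2 : ∀ a : A, p (Γ.d a) = Γ'.d a) (v : A) : p (Γ.invForm v) = Γ'.invForm v := by
  simp [invForm_eq_conv, conv_apply, map_sw, h1, h2]

/-- The quotients of a calculus correspond to the larger crossed submodules. -/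
theorem isQuotient_iff : IsQuotient Γ Γ' ↔ Γ.crossed ≤ Γ'.crossed := by
  constructor
  · rintro ⟨p, h1, h2⟩ v hv
    rw [mem_crossed] at hv ⊢
    exact ⟨hv.1, by rw [← map_invForm h1 h2, hv.2, map_zero]⟩
  · intro h
    obtain ⟨τ, hτ⟩ := exists_comp_eq_of_ker_le (f := Γ.invForm) (g := Γ'.invForm) (by
      intro v hv
      rw [LinearMap.mem_ker] at hv ⊢
      have h1 : v - algebraMap k A (counit v) ∈ Γ.crossed :=
        Γ.mem_crossed.mpr ⟨by simp, by simp [hv, invForm_algebraMap]⟩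
      have h2 := (Γ'.mem_crossed.mp (h h1)).2
      simpa [invForm_algebraMap] using h2)
    let p : Γ.carrier →ₗ[k] Γ'.carrier := Γ'.mulForm ∘ₗ LinearMap.rTensor A τ ∘ₗ Γ.splitForm
    have hp : ∀ a b : A, p (op b • Γ.d a) = op b • Γ'.d a := fun a b => by
      simp only [p, LinearMap.comp_apply]
      rw [op_smul_d_eq, splitForm_mulForm, ← LinearMap.comp_apply (LinearMap.rTensor A τ),
        ← LinearMap.rTensor_comp, hτ, ← op_smul_d_eq]
    have hpd : ∀ a : A, p (Γ.d a) = Γ'.d a := fun a => by simpa using hp a 1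
    refine ⟨{ toFun := p, map_add' := map_add p, map_smul' := fun a γ => ?_ }, fun a γ => ?_, hpd⟩
    · induction γ using Γ.induction_right with
      | h b c =>
        have e : ∀ Γ₀ : BicovCalculus k A,
            a • op c • Γ₀.d b = op c • Γ₀.d (a * b) - op (b * c) • Γ₀.d a := fun Γ₀ => by
          rw [Γ₀.leibniz, smul_add, smul_comm, op_mul, mul_smul, add_sub_cancel_right]
        rw [e, map_sub, hp, hp, hp, RingHom.id_apply, e]
      | h0 => simp
      | hadd x y hx hy => simp only [smul_add, map_add, hx, hy]
      | hsmul c x hx => rw [smul_comm, map_smul, hx, map_smul, RingHom.id_apply, smul_comm]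
    · show p (op a • γ) = op a • p γ
      induction γ using Γ.induction_right with
      | h b c => rw [← mul_smul, ← op_mul, hp, hp, op_mul, mul_smul]
      | h0 => simp
      | hadd x y hx hy => simp only [smul_add, map_add, hx, hy]
      | hsmul c x hx => rw [smul_comm, map_smul, hx, map_smul, smul_comm]

theorem comp_eq_id {p : Γ.carrier →ₗ[A] Γ.carrier} (h : ∀ a : A, p (Γ.d a) = Γ.d a) :
    p = LinearMap.id := by
  refine LinearMap.ext_on Γ.span_d ?_
  rintro _ ⟨a, rfl⟩
  exact h a

/-- Calculi are isomorphic if and only if they have the same crossed submodule. -/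
theorem iso_iff : Iso Γ Γ' ↔ Γ.crossed = Γ'.crossed := by
  constructor
  · rintro ⟨e, h1, h2⟩
    refine le_antisymm (isQuotient_iff.mp ⟨e.toLinearMap, h1, h2⟩) ?_
    obtain ⟨e', h1', h2'⟩ := Iso.symm ⟨e, h1, h2⟩
    exact isQuotient_iff.mp ⟨e'.toLinearMap, h1', h2'⟩
  · intro h
    obtain ⟨p, h1, h2⟩ := isQuotient_iff.mpr h.le
    obtain ⟨p', h1', h2'⟩ := isQuotient_iff.mpr h.ge
    refine ⟨LinearEquiv.ofLinearMap p p' (comp_eq_id fun a => ?_) (comp_eq_id fun a => ?_), h1, h2⟩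
    · simp [h2, h2']
    · simp [h2, h2']

theorem subsingleton_iff (hΓ : Γ.FinDim) : Subsingleton Γ.carrier ↔ Γ.dim = 0 := by
  have : FiniteDimensional k Γ.rightInvariants := hΓ
  rw [dim, Submodule.finrank_eq_zero]
  constructor
  · intro h
    exact (Submodule.eq_bot_iff _).mpr fun x _ => Subsingleton.elim _ _
  · intro h
    refine ⟨fun x y => ?_⟩
    have h0 : Γ.invForm = 0 := by
      rw [← LinearMap.range_eq_bot, ← rightInvariants_eq, h]
    obtain ⟨z, rfl⟩ := Γ.exists_mulForm_eq x
    obtain ⟨w, rfl⟩ := Γ.exists_mulForm_eq y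
    simp [h0]

end BicovCalculus

/-! ### The calculus of a crossed submodule -/

namespace IsCrossed

variable {k A : Type u} [Field k] [Ring A] [HopfAlgebra k A] {M : Submodule k A}

/-- The left action of `A` on `A / M`. -/
def quotAct (hM : IsCrossed M) : A →ₐ[k] Module.End k (A ⧸ M) :=
  AlgHom.ofLinearMap
    { toFun := fun a => M.mapQ M (LinearMap.mulLeft k a) fun v hv => hM.mul_mem a v hv
      map_add' := fun a b => M.linearMap_qext
        (LinearMap.ext fun v => congrArg Submodule.Quotient.mk (add_mul a b v))
      map_smul' := fun c a => M.linearMap_qext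
        (LinearMap.ext fun v => congrArg Submodule.Quotient.mk (smul_mul_assoc c a v)) }
    (M.linearMap_qext (LinearMap.ext fun v => congrArg Submodule.Quotient.mk (one_mul v)))
    (fun a b => M.linearMap_qext
      (LinearMap.ext fun v => congrArg Submodule.Quotient.mk (mul_assoc a b v)))

@[simp] theorem quotAct_mk (hM : IsCrossed M) (a v : A) :
    hM.quotAct a (Submodule.Quotient.mk v) = Submodule.Quotient.mk (a * v) := rfl

/-- The diagonal left action of `A` on `(A / M) ⊗ A`. -/
def diagAct (hM : IsCrossed M) : A →ₐ[k] Module.End k ((A ⧸ M) ⊗[k] A) :=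
  (Module.endTensorEndAlgHom (R := k) (A := k)).comp
    ((Algebra.TensorProduct.map hM.quotAct (Algebra.lmul k A)).comp (Bialgebra.comulAlgHom k A))

/-- Right multiplication on the second factor of `(A / M) ⊗ A`. -/
def rmulAct (_ : IsCrossed M) : A →ₗ[k] Module.End k ((A ⧸ M) ⊗[k] A) :=
  LinearMap.lTensorHom (A ⧸ M) ∘ₗ (LinearMap.mul k A).flip

theorem diagAct_tmul (hM : IsCrossed M) (a b : A) (n : A ⧸ M) :
    hM.diagAct a (n ⊗ₜ b) = sw k a fun x y => hM.quotAct x n ⊗ₜ (y * b) := by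
  simp only [diagAct, AlgHom.comp_apply, Bialgebra.comulAlgHom_apply, comul_eq_sw, map_sw]
  exact map_sw (LinearMap.applyₗ (R := k) (n ⊗ₜ[k] b)) a _

@[simp] theorem rmulAct_tmul (hM : IsCrossed M) (a b : A) (n : A ⧸ M) :
    hM.rmulAct a (n ⊗ₜ b) = n ⊗ₜ (b * a) := rfl

theorem isRightAct_rmulAct (hM : IsCrossed M) : IsRightAct hM.rmulAct where
  one := by ext; simp
  mul a b := by ext; simp [mul_assoc]

theorem diagAct_rmulAct (hM : IsCrossed M) (a b : A) (y : (A ⧸ M) ⊗[k] A) :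
    hM.diagAct a (hM.rmulAct b y) = hM.rmulAct b (hM.diagAct a y) := by
  induction y using TensorProduct.induction_on with
  | zero => simp
  | tmul n c => simp [diagAct_tmul, map_sw, mul_assoc]
  | add x y hx hy => simp only [map_add, hx, hy]

/-- The map `n ⊗ b ↦ ε(n) b` from `(A / M) ⊗ A` to `A`. -/
def counitTensor (hM : IsCrossed M) : (A ⧸ M) ⊗[k] A →ₗ[k] A :=
  (TensorProduct.lid k A).toLinearMap ∘ₗ LinearMap.rTensor A (M.liftQ counit hM.counit_eq)

@[simp] theorem counitTensor_tmul (hM : IsCrossed M) (v b : A) :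
    hM.counitTensor (Submodule.Quotient.mk v ⊗ₜ b) = counit (R := k) v • b := by
  rfl

theorem counitTensor_diagAct (hM : IsCrossed M) (a : A) (y : (A ⧸ M) ⊗[k] A) :
    hM.counitTensor (hM.diagAct a y) = a * hM.counitTensor y := by
  induction y using TensorProduct.induction_on with
  | zero => simp
  | tmul n c =>
    obtain ⟨v, rfl⟩ := Submodule.Quotient.mk_surjective _ n
    have h := sw_counit_left (counit (R := k) v • LinearMap.mulRight k c) a
    simp only [LinearMap.smul_apply, LinearMap.mulRight_apply] at h
    rw [diagAct_tmul, map_sw, counitTensor_tmul, mul_smul_comm, ← h]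
    simp [mul_smul]
  | add x y hx hy => simp only [map_add, hx, hy, mul_add]

theorem counitTensor_rmulAct (hM : IsCrossed M) (a : A) (y : (A ⧸ M) ⊗[k] A) :
    hM.counitTensor (hM.rmulAct a y) = hM.counitTensor y * a := by
  induction y using TensorProduct.induction_on with
  | zero => simp
  | tmul n c =>
    obtain ⟨v, rfl⟩ := Submodule.Quotient.mk_surjective _ n
    simp
  | add x y hx hy => simp only [map_add, hx, hy, add_mul]

/-- The bimodule of the calculus: the kernel of `(A / M) ⊗ A → A`, that is, `(ker ε / M) ⊗ A`. -/
def Form (hM : IsCrossed M) : Type u := LinearMap.ker hM.counitTensor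

instance (hM : IsCrossed M) : AddCommGroup hM.Form :=
  inferInstanceAs (AddCommGroup (LinearMap.ker hM.counitTensor))

instance (hM : IsCrossed M) : Module k hM.Form :=
  inferInstanceAs (Module k (LinearMap.ker hM.counitTensor))

/-- The inclusion of the bimodule of the calculus into `(A / M) ⊗ A`. -/
def val (hM : IsCrossed M) : hM.Form →ₗ[k] (A ⧸ M) ⊗[k] A :=
  (LinearMap.ker hM.counitTensor).subtype

theorem val_injective (hM : IsCrossed M) : Function.Injective hM.val := Subtype.val_injective

theorem counitTensor_val (hM : IsCrossed M) (y : hM.Form) : hM.counitTensor (hM.val y) = 0 := y.2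

instance (hM : IsCrossed M) : Module A hM.Form where
  smul a y := ⟨hM.diagAct a (hM.val y), by
    rw [LinearMap.mem_ker, counitTensor_diagAct, counitTensor_val, mul_zero]⟩
  one_smul y := Subtype.ext (by show hM.diagAct 1 (hM.val y) = hM.val y; simp)
  mul_smul a b y := Subtype.ext (by
    show hM.diagAct (a * b) (hM.val y) = hM.diagAct a (hM.diagAct b (hM.val y)); simp)
  smul_zero a := Subtype.ext (by show hM.diagAct a (hM.val 0) = hM.val 0; simp)
  smul_add a x y := Subtype.ext (by
    show hM.diagAct a (hM.val (x + y)) = hM.diagAct a (hM.val x) + hM.diagAct a (hM.val y); simp)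
  add_smul a b y := Subtype.ext (by
    show hM.diagAct (a + b) (hM.val y) = hM.diagAct a (hM.val y) + hM.diagAct b (hM.val y); simp)
  zero_smul y := Subtype.ext (by show hM.diagAct 0 (hM.val y) = hM.val 0; simp)

instance (hM : IsCrossed M) : Module Aᵐᵒᵖ hM.Form where
  smul a y := ⟨hM.rmulAct a.unop (hM.val y), by
    rw [LinearMap.mem_ker, counitTensor_rmulAct, counitTensor_val, zero_mul]⟩
  one_smul y := Subtype.ext (by
    show hM.rmulAct 1 (hM.val y) = hM.val y; simp [hM.isRightAct_rmulAct.one])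
  mul_smul a b y := Subtype.ext (by
    show hM.rmulAct (b.unop * a.unop) (hM.val y) = hM.rmulAct a.unop (hM.rmulAct b.unop (hM.val y))
    simp [hM.isRightAct_rmulAct.mul])
  smul_zero a := Subtype.ext (by show hM.rmulAct a.unop (hM.val 0) = hM.val 0; simp)
  smul_add a x y := Subtype.ext (by
    show hM.rmulAct a.unop (hM.val (x + y)) =
      hM.rmulAct a.unop (hM.val x) + hM.rmulAct a.unop (hM.val y); simp)
  add_smul a b y := Subtype.ext (by
    show hM.rmulAct (a.unop + b.unop) (hM.val y) =
      hM.rmulAct a.unop (hM.val y) + hM.rmulAct b.unop (hM.val y); simp)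
  zero_smul y := Subtype.ext (by show hM.rmulAct 0 (hM.val y) = hM.val 0; simp)

theorem val_smul (hM : IsCrossed M) (a : A) (y : hM.Form) :
    hM.val (a • y) = hM.diagAct a (hM.val y) := rfl

theorem val_op_smul (hM : IsCrossed M) (a : A) (y : hM.Form) :
    hM.val (op a • y) = hM.rmulAct a (hM.val y) := rfl

instance (hM : IsCrossed M) : IsScalarTower k A hM.Form where
  smul_assoc c a y := hM.val_injective (by simp [val_smul])

instance (hM : IsCrossed M) : IsScalarTower k Aᵐᵒᵖ hM.Form where
  smul_assoc c a y := hM.val_injective (by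
    obtain ⟨a, rfl⟩ := op_surjective a
    rw [← op_smul, val_op_smul, map_smul, map_smul, val_op_smul, LinearMap.smul_apply])

instance (hM : IsCrossed M) : SMulCommClass A Aᵐᵒᵖ hM.Form where
  smul_comm a b y := hM.val_injective (by
    obtain ⟨b, rfl⟩ := op_surjective b
    simp [val_smul, val_op_smul, diagAct_rmulAct])

/-- The element `θ = 1 ⊗ 1` of `(A / M) ⊗ A`; the differential is `a ↦ a θ - θ a`. -/
def theta (_ : IsCrossed M) : (A ⧸ M) ⊗[k] A := Submodule.Quotient.mk 1 ⊗ₜ 1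

/-- The projection `y ↦ y - θ ε(y)` of `(A / M) ⊗ A` onto the bimodule of the calculus. -/
def proj (hM : IsCrossed M) : (A ⧸ M) ⊗[k] A →ₗ[k] hM.Form :=
  LinearMap.codRestrict (LinearMap.ker hM.counitTensor)
    (LinearMap.id - TensorProduct.mk k (A ⧸ M) A (Submodule.Quotient.mk 1) ∘ₗ hM.counitTensor)
    (fun y => by simp)

theorem val_proj (hM : IsCrossed M) (y : (A ⧸ M) ⊗[k] A) :
    hM.val (hM.proj y) = y - Submodule.Quotient.mk 1 ⊗ₜ hM.counitTensor y := rfl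

theorem proj_val (hM : IsCrossed M) (y : hM.Form) : hM.proj (hM.val y) = y :=
  hM.val_injective (by rw [val_proj, counitTensor_val]; simp)

/-- The map `a ↦ a θ`. -/
def smulTheta (_ : IsCrossed M) : A →ₗ[k] (A ⧸ M) ⊗[k] A :=
  LinearMap.rTensor A M.mkQ ∘ₗ comul

theorem smulTheta_eq_diagAct (hM : IsCrossed M) (a : A) :
    hM.smulTheta a = hM.diagAct a hM.theta := by
  rw [smulTheta, theta, diagAct_tmul, LinearMap.comp_apply, comul_eq_sw, map_sw]
  simp

theorem smulTheta_mul (hM : IsCrossed M) (a b : A) :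
    hM.smulTheta (a * b) = hM.diagAct a (hM.smulTheta b) := by
  simp [smulTheta_eq_diagAct]

/-- The differential `d a = a θ - θ a`. -/
def diff (hM : IsCrossed M) : A →ₗ[k] hM.Form := hM.proj ∘ₗ hM.smulTheta

theorem counitTensor_smulTheta (hM : IsCrossed M) (a : A) :
    hM.counitTensor (hM.smulTheta a) = a := by
  rw [smulTheta_eq_diagAct, counitTensor_diagAct]; simp [theta]

theorem val_diff (hM : IsCrossed M) (a : A) :
    hM.val (hM.diff a) = hM.smulTheta a - Submodule.Quotient.mk 1 ⊗ₜ a := by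
  rw [diff, LinearMap.comp_apply, val_proj, counitTensor_smulTheta]

theorem diff_mul (hM : IsCrossed M) (a b : A) :
    hM.diff (a * b) = a • hM.diff b + op b • hM.diff a := by
  refine hM.val_injective ?_
  have h : (Submodule.Quotient.mk 1 : A ⧸ M) ⊗ₜ[k] b = hM.rmulAct b hM.theta := by simp [theta]
  rw [map_add, val_smul, val_op_smul, val_diff, val_diff, val_diff, smulTheta_mul, map_sub, map_sub,
    h, diagAct_rmulAct, ← smulTheta_eq_diagAct, rmulAct_tmul]
  abel

theorem proj_rmulAct_smulTheta (hM : IsCrossed M) (a b : A) :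
    hM.proj (hM.rmulAct b (hM.smulTheta a)) = op b • hM.diff a := by
  refine hM.val_injective ?_
  rw [val_op_smul, val_diff, val_proj, counitTensor_rmulAct, counitTensor_smulTheta, map_sub,
    rmulAct_tmul]

/-- Every element `v ⊗ b` is `v₍₁₎ θ S(v₍₂₎) b`. -/
theorem tmul_eq_sw (hM : IsCrossed M) (v b : A) : (Submodule.Quotient.mk v : A ⧸ M) ⊗ₜ[k] b =
    sw k v fun x y => hM.rmulAct (antipode k y * b) (hM.smulTheta x) := by
  have h : conv ((TensorProduct.mk k (A ⧸ M) A).flip 1 ∘ₗ M.mkQ) hM.rmulAct = hM.smulTheta := by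
    ext a; simp [conv_apply, smulTheta, comul_eq_sw, map_sw]
  have h2 := conv_conv_antipode hM.isRightAct_rmulAct
    ((TensorProduct.mk k (A ⧸ M) A).flip 1 ∘ₗ M.mkQ)
  have h3 := congrArg (hM.rmulAct b) (LinearMap.congr_fun h2 v)
  rw [h, conv_apply, map_sw] at h3
  simpa [hM.isRightAct_rmulAct.mul] using h3.symm

theorem span_diff (hM : IsCrossed M) : Submodule.span A (Set.range hM.diff) = ⊤ := by
  refine eq_top_iff.mpr fun y _ => ?_
  rw [← hM.proj_val y]
  generalize hM.val y = z
  induction z using TensorProduct.induction_on with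
  | zero => simp
  | add x y hx hy => rw [map_add]; exact Submodule.add_mem _ hx hy
  | tmul n b =>
    obtain ⟨v, rfl⟩ := Submodule.Quotient.mk_surjective _ n
    rw [hM.tmul_eq_sw, map_sw]
    simp only [proj_rmulAct_smulTheta]
    refine Submodule.sum_mem _ fun i _ => ?_
    have h : ∀ a c : A, op c • hM.diff a = hM.diff (a * c) - a • hM.diff c := fun a c => by
      rw [diff_mul, add_sub_cancel_left]
    simp only [h]
    exact Submodule.sub_mem _ (Submodule.subset_span ⟨_, rfl⟩)
      (Submodule.smul_mem _ _ (Submodule.subset_span ⟨_, rfl⟩))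

/-! ### The coactions on the calculus of a crossed submodule -/

/-- The adjoint coaction of `A / M`. -/
def quotCoact (hM : IsCrossed M) : (A ⧸ M) →ₗ[k] A ⊗[k] (A ⧸ M) :=
  M.liftQ (LinearMap.lTensor A M.mkQ ∘ₗ adCoact) hM.coinv

/-- The left coaction `n ⊗ b ↦ n₍₋₁₎ b₍₁₎ ⊗ n₍₀₎ ⊗ b₍₂₎` of `(A / M) ⊗ A`. -/
def tensorCoactL (hM : IsCrossed M) : (A ⧸ M) ⊗[k] A →ₗ[k] A ⊗[k] ((A ⧸ M) ⊗[k] A) :=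
  TensorProduct.lift ((tensorAct (LinearMap.mul k A).flip hM.rmulAct ∘ₗ comul).flip ∘ₗ
    LinearMap.lTensor A ((TensorProduct.mk k (A ⧸ M) A).flip 1) ∘ₗ hM.quotCoact)

theorem tensorCoactL_tmul (hM : IsCrossed M) (v b : A) :
    hM.tensorCoactL (Submodule.Quotient.mk v ⊗ₜ b) =
      tensorAct (LinearMap.mul k A).flip hM.rmulAct (comul b)
        (LinearMap.lTensor A ((TensorProduct.mk k (A ⧸ M) A).flip 1 ∘ₗ M.mkQ) (adCoact v)) := by
  rw [LinearMap.lTensor_comp]; rfl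

theorem tensorCoactL_rmulAct (hM : IsCrossed M) (b : A) (y : (A ⧸ M) ⊗[k] A) :
    hM.tensorCoactL (hM.rmulAct b y) =
      tensorAct (LinearMap.mul k A).flip hM.rmulAct (comul b) (hM.tensorCoactL y) := by
  induction y using TensorProduct.induction_on with
  | zero => simp
  | add x y hx hy => simp only [map_add, hx, hy]
  | tmul n c =>
    obtain ⟨v, rfl⟩ := Submodule.Quotient.mk_surjective _ n
    rw [rmulAct_tmul, tensorCoactL_tmul, tensorCoactL_tmul, Bialgebra.comul_mul,
      (isRightAct_mulRight.tensor hM.isRightAct_rmulAct).mul]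
    rfl

theorem tensorCoactL_smulTheta (hM : IsCrossed M) (a : A) :
    hM.tensorCoactL (hM.smulTheta a) = LinearMap.lTensor A hM.smulTheta (comul a) := by
  have h : conv ((TensorProduct.mk k (A ⧸ M) A).flip 1 ∘ₗ M.mkQ) hM.rmulAct = hM.smulTheta := by
    ext a; simp [conv_apply, smulTheta, comul_eq_sw, map_sw]
  have h2 := LinearMap.congr_fun
    (conv_adCoact ((TensorProduct.mk k (A ⧸ M) A).flip 1 ∘ₗ M.mkQ) hM.rmulAct) a
  rw [h, LinearMap.comp_apply] at h2
  rw [← h2, conv_apply, smulTheta, LinearMap.comp_apply, comul_eq_sw, map_sw, map_sw]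
  simp [tensorCoactL_tmul]

/-- The right coaction `n ⊗ b ↦ n ⊗ b₍₁₎ ⊗ b₍₂₎` of `(A / M) ⊗ A`. -/
def tensorCoactR (_ : IsCrossed M) : (A ⧸ M) ⊗[k] A →ₗ[k] ((A ⧸ M) ⊗[k] A) ⊗[k] A :=
  (TensorProduct.assoc k (A ⧸ M) A A).symm.toLinearMap ∘ₗ LinearMap.lTensor (A ⧸ M) comul

theorem tensorCoactR_rmulAct (hM : IsCrossed M) (b : A) (y : (A ⧸ M) ⊗[k] A) :
    hM.tensorCoactR (hM.rmulAct b y) =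
      tensorAct hM.rmulAct (LinearMap.mul k A).flip (comul b) (hM.tensorCoactR y) := by
  induction y using TensorProduct.induction_on with
  | zero => simp
  | add x y hx hy => simp only [map_add, hx, hy]
  | tmul n c =>
    simp only [tensorCoactR, rmulAct_tmul, LinearMap.comp_apply, LinearMap.lTensor_tmul,
      Bialgebra.comul_mul]
    generalize comul (R := k) c = s
    generalize comul (R := k) b = t
    induction s using TensorProduct.induction_on with
    | zero => simp
    | add x y hx hy => simp only [add_mul, TensorProduct.tmul_add, map_add, hx, hy]
    | tmul x x' =>
      induction t using TensorProduct.induction_on with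
      | zero => simp
      | add x y hx hy =>
        simp only [mul_add, TensorProduct.tmul_add, map_add, hx, hy, LinearMap.add_apply]
      | tmul y y' => simp

theorem tensorCoactR_smulTheta (hM : IsCrossed M) (a : A) :
    hM.tensorCoactR (hM.smulTheta a) = LinearMap.rTensor A hM.smulTheta (comul a) := by
  have h : hM.tensorCoactR ∘ₗ LinearMap.rTensor A M.mkQ =
      LinearMap.rTensor A (LinearMap.rTensor A M.mkQ) ∘ₗ
        (TensorProduct.assoc k A A A).symm.toLinearMap ∘ₗ LinearMap.lTensor A comul := by
    ext x y
    simp only [tensorCoactR, TensorProduct.AlgebraTensorModule.curry_apply,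
      LinearMap.restrictScalars_self, TensorProduct.curry_apply, LinearMap.comp_apply,
      LinearMap.rTensor_tmul, LinearMap.lTensor_tmul]
    generalize comul (R := k) y = s
    induction s using TensorProduct.induction_on with
    | zero => simp
    | add x y hx hy => simp only [TensorProduct.tmul_add, map_add, hx, hy]
    | tmul x x' => simp
  rw [smulTheta, LinearMap.comp_apply, ← LinearMap.comp_apply, h]
  simp only [LinearMap.comp_apply, LinearEquiv.coe_coe, coassoc_symm_apply, LinearMap.rTensor_comp]

theorem smul_diff (hM : IsCrossed M) (a b : A) :
    a • hM.diff b = hM.diff (a * b) - op b • hM.diff a := by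
  rw [diff_mul, add_sub_cancel_right]

theorem val_op_smul_diff (hM : IsCrossed M) (a b : A) : hM.val (op b • hM.diff a) =
    hM.rmulAct b (hM.smulTheta a) - hM.rmulAct (a * b) (hM.smulTheta 1) := by
  rw [val_op_smul, val_diff, map_sub, smulTheta_eq_diagAct hM 1]
  simp [theta]

theorem diff_one (hM : IsCrossed M) : hM.diff 1 = 0 := by
  have h := hM.diff_mul 1 1
  simpa using h

theorem lTensor_proj_tensorAct (hM : IsCrossed M) (s t : A ⊗[k] A) :
    LinearMap.lTensor A hM.proj (tensorAct (LinearMap.mul k A).flip hM.rmulAct s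
      (LinearMap.lTensor A hM.smulTheta t)) =
    tensorAct (LinearMap.mul k A).flip (opAct k A hM.Form) s (LinearMap.lTensor A hM.diff t) := by
  induction s using TensorProduct.induction_on with
  | zero => simp
  | add x y hx hy => simp only [map_add, hx, hy, LinearMap.add_apply]
  | tmul x x' =>
    induction t using TensorProduct.induction_on with
    | zero => simp
    | add x y hx hy => simp only [map_add, hx, hy]
    | tmul y y' => simp [proj_rmulAct_smulTheta]

theorem rTensor_proj_tensorAct (hM : IsCrossed M) (s t : A ⊗[k] A) :
    LinearMap.rTensor A hM.proj (tensorAct hM.rmulAct (LinearMap.mul k A).flip s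
      (LinearMap.rTensor A hM.smulTheta t)) =
    tensorAct (opAct k A hM.Form) (LinearMap.mul k A).flip s (LinearMap.rTensor A hM.diff t) := by
  induction s using TensorProduct.induction_on with
  | zero => simp
  | add x y hx hy => simp only [map_add, hx, hy, LinearMap.add_apply]
  | tmul x x' =>
    induction t using TensorProduct.induction_on with
    | zero => simp
    | add x y hx hy => simp only [map_add, hx, hy]
    | tmul y y' => simp [proj_rmulAct_smulTheta]

/-- The left coaction of the calculus. -/
def formCoactL (hM : IsCrossed M) : hM.Form →ₗ[k] A ⊗[k] hM.Form :=
  LinearMap.lTensor A hM.proj ∘ₗ hM.tensorCoactL ∘ₗ hM.val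

/-- The right coaction of the calculus. -/
def formCoactR (hM : IsCrossed M) : hM.Form →ₗ[k] hM.Form ⊗[k] A :=
  LinearMap.rTensor A hM.proj ∘ₗ hM.tensorCoactR ∘ₗ hM.val

theorem formCoactL_op_smul_diff (hM : IsCrossed M) (a b : A) : hM.formCoactL (op b • hM.diff a) =
    tensorAct (LinearMap.mul k A).flip (opAct k A hM.Form) (comul b)
      (LinearMap.lTensor A hM.diff (comul a)) := by
  simp only [formCoactL, LinearMap.comp_apply, val_op_smul_diff, map_sub, tensorCoactL_rmulAct,
    tensorCoactL_smulTheta, lTensor_proj_tensorAct]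
  simp [Algebra.TensorProduct.one_def, diff_one]

theorem formCoactR_op_smul_diff (hM : IsCrossed M) (a b : A) : hM.formCoactR (op b • hM.diff a) =
    tensorAct (opAct k A hM.Form) (LinearMap.mul k A).flip (comul b)
      (LinearMap.rTensor A hM.diff (comul a)) := by
  simp only [formCoactR, LinearMap.comp_apply, val_op_smul_diff, map_sub, tensorCoactR_rmulAct,
    tensorCoactR_smulTheta, rTensor_proj_tensorAct]
  simp [Algebra.TensorProduct.one_def, diff_one]

/-- The bicovariant calculus with a given crossed submodule. -/
def calculus (hM : IsCrossed M) : BicovCalculus k A where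
  carrier := hM.Form
  d := hM.diff
  leibniz := hM.diff_mul
  span_d := hM.span_diff
  coactL := hM.formCoactL
  coactL_smul_d a b := by
    have h1 := hM.formCoactL_op_smul_diff (a * b) 1
    have h2 := lTensor_derivation_mul hM.diff_mul (comul a) (comul b)
    rw [op_one, one_smul, Bialgebra.comul_one,
      (isRightAct_mulRight.tensor (isRightAct_opAct k A hM.Form)).one, Module.End.one_apply,
      Bialgebra.comul_mul, h2] at h1
    rw [smul_diff, map_sub, h1, formCoactL_op_smul_diff, add_sub_cancel_right]
    rfl
  coactR := hM.formCoactR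
  coactR_smul_d a b := by
    have h1 := hM.formCoactR_op_smul_diff (a * b) 1
    have h2 := rTensor_derivation_mul hM.diff_mul (comul a) (comul b)
    rw [op_one, one_smul, Bialgebra.comul_one,
      ((isRightAct_opAct k A hM.Form).tensor isRightAct_mulRight).one, Module.End.one_apply,
      Bialgebra.comul_mul, h2] at h1
    rw [smul_diff, map_sub, h1, formCoactR_op_smul_diff, add_sub_cancel_right]
    rfl

theorem crossed_calculus (hM : IsCrossed M) : hM.calculus.crossed = M := by
  have h : ∀ v, hM.val (hM.calculus.invForm v) =
      Submodule.Quotient.mk v ⊗ₜ 1 - Submodule.Quotient.mk 1 ⊗ₜ (counit (R := k) v • 1) := by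
    intro v
    have h1 : hM.calculus.invForm v = hM.proj (Submodule.Quotient.mk v ⊗ₜ 1) := by
      rw [BicovCalculus.invForm_eq_conv, conv_apply, hM.tmul_eq_sw, map_sw]
      simp only [mul_one, proj_rmulAct_smulTheta]
      rfl
    rw [h1, val_proj, counitTensor_tmul]
  ext v
  rw [BicovCalculus.mem_crossed]
  constructor
  · rintro ⟨h1, h2⟩
    have h3 := h v
    rw [h1, show hM.calculus.invForm v = (0 : hM.Form) from h2, map_zero, zero_smul,
      TensorProduct.tmul_zero, sub_zero] at h3
    have h4 := congrArg (fun t => TensorProduct.rid k (A ⧸ M) (counit.lTensor (A ⧸ M) t)) h3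
    rw [← Submodule.Quotient.mk_eq_zero M]
    simpa using h4.symm
  · intro hv
    refine ⟨hM.counit_eq v hv, hM.val_injective ?_⟩
    rw [h, hM.counit_eq v hv, (Submodule.Quotient.mk_eq_zero M).mpr hv, TensorProduct.zero_tmul, zero_smul,
      TensorProduct.tmul_zero, sub_zero]
    exact (map_zero hM.val).symm

end IsCrossed

/-! ### Pairings of Hopf algebras -/

section HopfPairing

variable {k U A : Type*} [Field k] [Ring U] [HopfAlgebra k U] [Ring A] [HopfAlgebra k A]

/-- A pairing of Hopf algebras: the product of each is dual to the coproduct of the other, and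
likewise for unit and counit. -/
structure IsHopfPairing (P : U →ₗ[k] A →ₗ[k] k) : Prop where
  mul_left : ∀ x y a, P (x * y) a = sw k a fun a₁ a₂ => P x a₁ * P y a₂
  mul_right : ∀ x a b, P x (a * b) = sw k x fun x₁ x₂ => P x₁ a * P x₂ b
  one_left : ∀ a, P 1 a = counit (R := k) a
  one_right : ∀ x, P x 1 = counit (R := k) x

/-- The right action `φ ↦ φ * ⟨y, ·⟩` of `U` on functionals on `A`, by convolution. -/
def dualAct (P : U →ₗ[k] A →ₗ[k] k) : U →ₗ[k] Module.End k (A →ₗ[k] k) :=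
  LinearMap.mk₂ k (fun y φ => LinearMap.mul' k k ∘ₗ TensorProduct.map φ (P y) ∘ₗ comul)
    (fun y y' φ => by simp [TensorProduct.map_add_right, LinearMap.comp_add, LinearMap.add_comp])
    (fun c y φ => by simp [TensorProduct.map_smul_right, LinearMap.comp_smul, LinearMap.smul_comp])
    (fun y φ φ' => by simp [TensorProduct.map_add_left, LinearMap.comp_add, LinearMap.add_comp])
    (fun c y φ => by simp [TensorProduct.map_smul_left, LinearMap.comp_smul, LinearMap.smul_comp])

theorem dualAct_apply (P : U →ₗ[k] A →ₗ[k] k) (y : U) (φ : A →ₗ[k] k) (a : A) :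
    dualAct P y φ a = sw k a fun a₁ a₂ => φ a₁ * P y a₂ := by
  simp [dualAct, comul_eq_sw, map_sw]

namespace IsHopfPairing

variable {P : U →ₗ[k] A →ₗ[k] k} (hP : IsHopfPairing P)

include hP

theorem isRightAct_dualAct : IsRightAct (dualAct P) where
  one := by
    ext φ a
    simp only [dualAct_apply, hP.one_left, Module.End.one_apply]
    have h := sw_counit_right φ a
    simp only [smul_eq_mul, mul_comm] at h
    exact h
  mul x y := by
    ext φ a
    have hL : dualAct P (x * y) φ a =
        sw k a fun p w => sw k w fun q z => φ p * P x q * P y z := by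
      simp only [dualAct_apply, hP.mul_left]
      simp only [sw, Finset.mul_sum, mul_assoc]
    have hR : dualAct P y (dualAct P x φ) a =
        sw k a fun x' z => sw k x' fun p q => φ p * P x q * P y z := by
      simp only [dualAct_apply]
      simp only [sw, Finset.sum_mul]
    rw [Module.End.mul_apply, hL, hR, sw_assoc (fun p q z => φ p * P x q * P y z)
      (by constructor <;> intros <;> simp <;> ring)]

/-- Both sides are convolution inverses of `⟨·, ·⟩`. -/
theorem antipode_left (x : U) (a : A) : P (antipode k x) a = P x (antipode k a) := by
  have h : P ∘ₗ antipode k = (LinearMap.llcomp k A A k).flip (antipode k) ∘ₗ P := by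
    refine conv_injective hP.isRightAct_dualAct (LinearMap.ext fun x => LinearMap.ext fun a => ?_)
    have h1 : conv (P ∘ₗ antipode k) (dualAct P) x a = counit (R := k) x * counit (R := k) a := by
      have e : conv (P ∘ₗ antipode k) (dualAct P) x =
          sw k x fun x₁ x₂ => P (antipode k x₁ * x₂) := by
        rw [conv_apply]
        congr 1
        ext x₁ x₂ a
        rw [dualAct_apply, hP.mul_left]; rfl
      rw [e, sw_antipode_mul P x]
      simp [hP.one_left]
    have h2 : conv ((LinearMap.llcomp k A A k).flip (antipode k) ∘ₗ P) (dualAct P) x a =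
        counit (R := k) x * counit (R := k) a := by
      have e : conv ((LinearMap.llcomp k A A k).flip (antipode k) ∘ₗ P) (dualAct P) x a =
          sw k a fun a₁ a₂ => P x (antipode k a₁ * a₂) := by
        have e' := map_sw (k := k) (LinearMap.applyₗ (R := k) a) x fun x₁ x₂ =>
          dualAct P x₂ (((LinearMap.llcomp k A A k).flip (antipode k) ∘ₗ P) x₁)
        rw [conv_apply]
        refine e'.trans ?_
        simp only [LinearMap.applyₗ_apply_apply, dualAct_apply, hP.mul_right]
        exact Finset.sum_comm
      rw [e, sw_antipode_mul (P x) a, hP.one_right, smul_eq_mul, mul_comm]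
    rw [h1, h2]
  exact LinearMap.congr_fun (LinearMap.congr_fun h x) a

/-- The adjoint action of `U` is dual to the adjoint coaction of `A`. -/
theorem pair_adAct (h x : U) (v : A) :
    P (adAct (k := k) h x) v = P h (TensorProduct.rid k A (LinearMap.lTensor A (P x) (adCoact v))) := by
  have h1 : adAct (k := k) h x = sw k h fun h₁ h₂ => h₁ * (x * antipode k h₂) := by
    simp [adAct, comul_eq_sw, map_sw, mul_assoc]
  have h2 : ∀ y : U, P y v = P.flip v y := fun y => rfl
  rw [h1, h2, map_sw]
  simp only [LinearMap.flip_apply, hP.mul_left, hP.antipode_left]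
  simp only [adCoact_apply, map_sw, LinearMap.lTensor_tmul, TensorProduct.rid_tmul, map_smul,
    hP.mul_right, smul_eq_mul]
  simp only [sw, Finset.mul_sum]
  rw [Finset.sum_comm]
  refine Finset.sum_congr rfl fun i _ => ?_
  rw [Finset.sum_comm]
  refine Finset.sum_congr rfl fun j _ => Finset.sum_congr rfl fun l _ => ?_
  ring

theorem pair_coregAct (a : A) (x : U) (v : A) : P (coregAct P a x) v = P x (a * v) := by
  have h : ∀ y : U, P y v = P.flip v y := fun y => rfl
  rw [hP.mul_right, coregAct, comul_eq_sw, map_sw, map_sw, h, map_sw]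
  simp

theorem pair_projKer (x : U) (v : A) :
    P (projKer k x) v = P x v - counit (R := k) x * counit (R := k) v := by
  rw [projKer, map_sub, Algebra.algebraMap_eq_smul_one, map_smul, LinearMap.sub_apply,
    LinearMap.smul_apply, hP.one_left, smul_eq_mul]

/-- The annihilator of a crossed submodule is a quantum tangent space. -/
theorem isTangentSpace_annKer {M : Submodule k A} (hM : IsCrossed M) :
    IsTangentSpace P (annKer P M) where
  le_ker x hx := hx.1
  ad_mem h x hx := by
    refine ⟨by simp [projKer], fun v hv => ?_⟩
    have h1 : LinearMap.lTensor A (P x) (adCoact v) = 0 := by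
      have h2 : P x = M.liftQ (P x) hx.2 ∘ₗ M.mkQ := (Submodule.liftQ_mkQ _ _ _).symm
      rw [h2, LinearMap.lTensor_comp, LinearMap.comp_apply, hM.coinv v hv, map_zero]
    rw [hP.pair_projKer, hP.pair_adAct, h1, hM.counit_eq v hv]
    simp
  coreg_mem a x hx := by
    refine ⟨by simp [projKer], fun v hv => ?_⟩
    rw [hP.pair_projKer, hP.pair_coregAct, hx.2 _ (hM.mul_mem a v hv), hM.counit_eq v hv]
    simp

end IsHopfPairing

/-- An element of a tensor product vanishes if it is annihilated by a separating family of
functionals on the second factor. -/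
theorem tensor_eq_zero_of_lTensor {V W : Type*} [AddCommGroup V] [Module k V] [AddCommGroup W]
    [Module k W] {G : Set (W →ₗ[k] k)} (hG : ∀ w : W, (∀ g ∈ G, g w = 0) → w = 0)
    {z : V ⊗[k] W} (hz : ∀ g ∈ G, LinearMap.lTensor V g z = 0) : z = 0 := by
  classical
  let b := Module.Basis.ofVectorSpace k V
  refine (TensorProduct.equivFinsuppOfBasisLeft (N := W) b).map_eq_zero_iff.mp ?_
  refine Finsupp.ext fun i => hG _ fun g hg => ?_
  have h : ∀ z : V ⊗[k] W, g (TensorProduct.equivFinsuppOfBasisLeft (N := W) b z i) =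
      TensorProduct.equivFinsuppOfBasisLeft (N := k) b (LinearMap.lTensor V g z) i := fun z => by
    induction z using TensorProduct.induction_on with
    | zero => simp
    | tmul v w => simp
    | add x y hx hy => simp only [map_add, Finsupp.add_apply, hx, hy]
  rw [h, hz g hg]
  simp

/-- The subspace of `ker ε ⊆ A` which annihilates `L`. -/
def annCounit (P : U →ₗ[k] A →ₗ[k] k) (L : Submodule k U) : Submodule k A where
  carrier := {v | counit (R := k) v = 0 ∧ ∀ x ∈ L, P x v = 0}
  add_mem' hx hy := ⟨by simp [hx.1, hy.1], fun v hv => by simp [hx.2 v hv, hy.2 v hv]⟩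
  zero_mem' := ⟨by simp, fun v _ => by simp⟩
  smul_mem' c x hx := ⟨by simp [hx.1], fun v hv => by simp [hx.2 v hv]⟩

namespace IsHopfPairing

variable {P : U →ₗ[k] A →ₗ[k] k} (hP : IsHopfPairing P)

include hP

/-- The annihilator of a quantum tangent space is a crossed submodule. -/
theorem isCrossed_annCounit (hA : ∀ a, (∀ x, P x a = 0) → a = 0) {L : Submodule k U}
    (hL : IsTangentSpace P L) : IsCrossed (annCounit P L) where
  counit_eq v hv := hv.1
  mul_mem a v hv := by
    refine ⟨by simp [hv.1], fun x hx => ?_⟩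
    have h := hv.2 _ (hL.coreg_mem a x hx)
    rw [hP.pair_projKer, hP.pair_coregAct, hv.1, mul_zero, sub_zero] at h
    exact h
  coinv v hv := by
    -- the functionals `ε` and `⟨x, ·⟩`, `x ∈ L`, separate the points of `A / M`
    let G : Set ((A ⧸ annCounit P L) →ₗ[k] k) := {g | g ∘ₗ (annCounit P L).mkQ = counit ∨
      ∃ x ∈ L, g ∘ₗ (annCounit P L).mkQ = P x}
    refine tensor_eq_zero_of_lTensor (G := G) (fun w hw => ?_) (fun g hg => ?_)
    · obtain ⟨v, rfl⟩ := Submodule.Quotient.mk_surjective _ w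
      rw [Submodule.Quotient.mk_eq_zero]
      refine ⟨hw ((annCounit P L).liftQ counit fun v hv => hv.1) (Or.inl ?_), fun x hx =>
        hw ((annCounit P L).liftQ (P x) fun v hv => hv.2 x hx) (Or.inr ⟨x, hx, ?_⟩)⟩
      · exact Submodule.liftQ_mkQ _ _ _
      · exact Submodule.liftQ_mkQ _ _ _
    · rw [← LinearMap.comp_apply, ← LinearMap.lTensor_comp]
      rcases hg with hg | ⟨x, hx, hg⟩
      · rw [hg, lTensor_counit_adCoact, hv.1, zero_smul]
      · rw [hg]
        refine (TensorProduct.rid k A).map_eq_zero_iff.mp (hA _ fun h => ?_)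
        have h1 := hv.2 _ (hL.ad_mem h x hx)
        rwa [hP.pair_projKer, hv.1, mul_zero, sub_zero, hP.pair_adAct] at h1

omit hP in
theorem mem_comap_dualAnnihilator {M : Submodule k A} {x : U} :
    x ∈ M.dualAnnihilator.comap P ↔ ∀ v ∈ M, P x v = 0 := by
  simp [Submodule.mem_dualAnnihilator]

/-- The annihilator of `M ⊆ ker ε` in `U` is `annKer P M ⊕ k 1`. -/
theorem comap_dualAnnihilator_eq {M : Submodule k A} (hM : ∀ v ∈ M, counit (R := k) v = 0) :
    M.dualAnnihilator.comap P = annKer P M ⊔ Submodule.span k {1} := by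
  ext x
  rw [mem_comap_dualAnnihilator]
  constructor
  · intro hx
    refine Submodule.mem_sup.mpr ⟨projKer k x, ⟨by simp [projKer], fun v hv => ?_⟩,
      algebraMap k U (counit x), ?_, by simp [projKer]⟩
    · rw [hP.pair_projKer, hx v hv, hM v hv, mul_zero, sub_zero]
    · rw [Algebra.algebraMap_eq_smul_one]
      exact Submodule.smul_mem _ _ (Submodule.mem_span_singleton_self 1)
  · intro hx v hv
    obtain ⟨y, hy, z, hz, rfl⟩ := Submodule.mem_sup.mp hx
    obtain ⟨c, rfl⟩ := Submodule.mem_span_singleton.mp hz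
    simp [hy.2 v hv, hP.one_left, hM v hv]

omit hP in
theorem disjoint_span_one {L : Submodule k U} (hL : L ≤ LinearMap.ker (counit : U →ₗ[k] k)) :
    L ⊓ Submodule.span k {1} = ⊥ := by
  refine (Submodule.eq_bot_iff _).mpr fun x hx => ?_
  obtain ⟨c, rfl⟩ := Submodule.mem_span_singleton.mp hx.2
  have h := LinearMap.mem_ker.mp (hL hx.1)
  have hc : c = 0 := by simpa using h
  rw [hc, zero_smul]

omit hP in
theorem finrank_sup_span_one {L : Submodule k U} [FiniteDimensional k L]
    (hL : L ≤ LinearMap.ker (counit : U →ₗ[k] k)) :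
    Module.finrank k ↥(L ⊔ Submodule.span k {1}) = Module.finrank k L + 1 := by
  have h := Submodule.finrank_sup_add_finrank_inf_eq L (Submodule.span k {(1 : U)})
  have h1 : (1 : U) ≠ 0 := fun h => by
    have := congrArg (counit (R := k)) h
    simp at this
  rw [disjoint_span_one hL, finrank_bot, finrank_span_singleton h1, add_zero] at h
  exact h

/-- A finite dimensional quantum tangent space is the annihilator of its annihilator, which has
finite codimension. -/
theorem annKer_annCounit (hU : ∀ x, (∀ a, P x a = 0) → x = 0) {L : Submodule k U}
    (hL : L ≤ LinearMap.ker (counit : U →ₗ[k] k)) [FiniteDimensional k L] :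
    annKer P (annCounit P L) = L ∧ FiniteDimensional k (A ⧸ annCounit P L) := by
  have hinj : Function.Injective P := (injective_iff_map_eq_zero P).mpr fun x hx =>
    hU x fun a => by rw [hx]; rfl
  let W := (L ⊔ Submodule.span k {1}).map P
  have hW : annCounit P L = W.dualCoannihilator := by
    ext v
    rw [Submodule.mem_dualCoannihilator]
    constructor
    · rintro ⟨h1, h2⟩ _ ⟨x, hx, rfl⟩
      obtain ⟨y, hy, z, hz, rfl⟩ := Submodule.mem_sup.mp hx
      obtain ⟨c, rfl⟩ := Submodule.mem_span_singleton.mp hz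
      simp [h2 y hy, hP.one_left, h1]
    · intro h
      refine ⟨?_, fun x hx => h _ ⟨x, Submodule.mem_sup_left hx, rfl⟩⟩
      rw [← hP.one_left]
      exact h _ ⟨1, Submodule.mem_sup_right (Submodule.mem_span_singleton_self 1), rfl⟩
  have hf : FiniteDimensional k (A ⧸ annCounit P L) := by
    rw [hW]
    exact Subspace.finiteDimensional_quot_dualCoannihilator_iff.mpr inferInstance
  refine ⟨?_, hf⟩
  have h1 := hP.comap_dualAnnihilator_eq (M := annCounit P L) fun v hv => hv.1
  rw [hW, Subspace.dualCoannihilator_dualAnnihilator_eq, Submodule.comap_map_eq_of_injective hinj,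
    ← hW] at h1
  refine le_antisymm (fun x hx => ?_) fun x hx => ⟨hL hx, fun v hv => hv.2 x hx⟩
  have h2 : x ∈ L ⊔ Submodule.span k {1} := h1 ▸ Submodule.mem_sup_left hx
  obtain ⟨y, hy, z, hz, rfl⟩ := Submodule.mem_sup.mp h2
  have h3 : z ∈ annKer P (annCounit P L) := by
    have h4 : y ∈ annKer P (annCounit P L) := ⟨hL hy, fun v hv => hv.2 y hy⟩
    simpa using Submodule.sub_mem _ hx h4
  have h5 : z ∈ annKer P (annCounit P L) ⊓ Submodule.span k {1} := ⟨h3, hz⟩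
  rw [disjoint_span_one (L := annKer P (annCounit P L)) fun x hx => hx.1,
    Submodule.mem_bot] at h5
  rw [h5, add_zero]
  exact hy

/-- If `A / M` is spanned by `D` elements and `D` linearly independent elements of `U` annihilate
`M`, then the annihilator of `M` in `U` is dual to `A / M`. -/
theorem closed_of_linearIndependent (hU : ∀ x, (∀ a, P x a = 0) → x = 0) {M : Submodule k A}
    (hM : ∀ v ∈ M, counit (R := k) v = 0) [FiniteDimensional k (A ⧸ M)] {ι : Type*} [Fintype ι]
    {x : ι → U} (hx : LinearIndependent k x) (hxM : ∀ i, ∀ v ∈ M, P (x i) v = 0)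
    (hle : Module.finrank k (A ⧸ M) ≤ Fintype.card ι) :
    Module.finrank k (A ⧸ M) = Fintype.card ι ∧ FiniteDimensional k (annKer P M) ∧
      Module.finrank k (annKer P M) + 1 = Fintype.card ι ∧ annCounit P (annKer P M) = M := by
  have hinj : Function.Injective P := (injective_iff_map_eq_zero P).mpr fun x hx =>
    hU x fun a => by rw [hx]; rfl
  let e := M.dualQuotEquivDualAnnihilator
  have hf : FiniteDimensional k M.dualAnnihilator := Module.Finite.equiv e
  have hd : Module.finrank k M.dualAnnihilator = Module.finrank k (A ⧸ M) := by
    rw [← e.finrank_eq, Subspace.dual_finrank_eq]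
  let Q := M.dualAnnihilator.comap P
  let j : Q →ₗ[k] M.dualAnnihilator := (P.domRestrict Q).codRestrict _ fun y => y.2
  have hj : Function.Injective j := fun a b h => Subtype.ext (hinj (congrArg Subtype.val h))
  have hQ : FiniteDimensional k Q :=
    Module.Finite.of_injective (e.symm.toLinearMap ∘ₗ j) (e.symm.injective.comp hj)
  have h1 : Fintype.card ι ≤ Module.finrank k Q := by
    let x' : ι → Q := fun i => ⟨x i, mem_comap_dualAnnihilator.mpr (hxM i)⟩
    have hx' : LinearIndependent k x' := LinearIndependent.of_comp Q.subtype hx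
    exact hx'.fintype_card_le_finrank
  have h2 : Module.finrank k Q ≤ Module.finrank k M.dualAnnihilator :=
    LinearMap.finrank_le_finrank_of_injective hj
  have hQe : Q = annKer P M ⊔ Submodule.span k {1} := hP.comap_dualAnnihilator_eq hM
  have hK : FiniteDimensional k (annKer P M) :=
    Submodule.finiteDimensional_of_le (S₂ := Q) (hQe ▸ le_sup_left)
  have h3 := finrank_sup_span_one (L := annKer P M) fun x hx => hx.1
  rw [← hQe] at h3
  have hs : Function.Surjective j := by
    have h4 : Module.finrank k Q = Module.finrank k (Module.Dual k (A ⧸ M)) := by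
      rw [Subspace.dual_finrank_eq]; omega
    have h5 : Function.Surjective (e.symm.toLinearMap ∘ₗ j) :=
      (LinearMap.injective_iff_surjective_of_finrank_eq_finrank h4).mp (e.symm.injective.comp hj)
    intro y
    obtain ⟨x, hx⟩ := h5 (e.symm y)
    exact ⟨x, e.symm.injective hx⟩
  refine ⟨by omega, hK, by omega, ?_⟩
  ext v
  refine ⟨fun hv => ?_, fun hv => ⟨hM v hv, fun x hx => hx.2 v hv⟩⟩
  rw [← Subspace.dualAnnihilator_dualCoannihilator_eq (W := M), Submodule.mem_dualCoannihilator]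
  intro φ hφ
  obtain ⟨⟨y, hy⟩, hyφ⟩ := hs ⟨φ, hφ⟩
  have h4 : P y = φ := congrArg Subtype.val hyφ
  rw [← h4]
  have hy' : y ∈ annKer P M ⊔ Submodule.span k {1} := hQe ▸ hy
  obtain ⟨z, hz, w, hw, rfl⟩ := Submodule.mem_sup.mp hy'
  obtain ⟨c, rfl⟩ := Submodule.mem_span_singleton.mp hw
  simp [hv.2 z hz, hP.one_left, hv.1]

end IsHopfPairing

end HopfPairing

/-! ### Classifications of calculi and of tangent spaces -/

/-- A classification of the crossed submodules of finite codimension classifies the finite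
dimensional calculi up to isomorphism. -/
theorem exists_equiv_finDimCalculi {k A : Type u} [Field k] [Ring A] [HopfAlgebra k A] {T : Type*}
    {M : T → Submodule k A} (hinj : Function.Injective M) (hM : ∀ I, IsCrossed (M I))
    (hfd : ∀ I, FiniteDimensional k (A ⧸ M I))
    (hsurj : ∀ N : Submodule k A, IsCrossed N → FiniteDimensional k (A ⧸ N) → ∃ I, N = M I) :
    ∃ Φ : T ≃ FinDimCalculi k A, ∀ I (Γ : BicovCalculus k A) (h : Γ.FinDim),
      Φ I = Quotient.mk _ ⟨Γ, h⟩ ↔ Γ.crossed = M I := by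
  have hfin : ∀ I, (hM I).calculus.FinDim := fun I => by
    have := hfd I
    rw [BicovCalculus.finDim_iff, (hM I).crossed_calculus]
    infer_instance
  let F : T → FinDimCalculi k A := fun I => Quotient.mk _ ⟨(hM I).calculus, hfin I⟩
  have hF : ∀ I (Γ : BicovCalculus k A) (h : Γ.FinDim),
      F I = Quotient.mk _ ⟨Γ, h⟩ ↔ Γ.crossed = M I := fun I Γ h => by
    have h1 : F I = Quotient.mk _ ⟨Γ, h⟩ ↔ BicovCalculus.Iso (hM I).calculus Γ := Quotient.eq
    rw [h1, BicovCalculus.iso_iff, (hM I).crossed_calculus, eq_comm]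
  refine ⟨Equiv.ofBijective F ⟨fun I J h => hinj ?_, fun x => ?_⟩, hF⟩
  · rw [← (hM J).crossed_calculus]
    exact ((hF I _ (hfin J)).mp h).symm
  · obtain ⟨⟨Γ, h⟩, rfl⟩ := Quotient.exists_rep x
    obtain ⟨I, hI⟩ := hsurj _ Γ.isCrossed_crossed (Γ.finDim_iff.mp h)
    exact ⟨I, (hF I Γ h).mpr hI⟩

/-- If moreover the crossed submodules of finite codimension are closed with respect to a
nondegenerate pairing, their annihilators are the finite dimensional quantum tangent spaces. -/
theorem exists_equiv_finDimTangentSpaces {k U A : Type*} [Field k] [Ring U] [HopfAlgebra k U]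
    [Ring A] [HopfAlgebra k A] {P : U →ₗ[k] A →ₗ[k] k} (hP : IsHopfPairing P)
    (hU : ∀ x, (∀ a, P x a = 0) → x = 0) (hA : ∀ a, (∀ x, P x a = 0) → a = 0) {T : Type*}
    {M : T → Submodule k A} (hinj : Function.Injective M) (hM : ∀ I, IsCrossed (M I))
    (hfd : ∀ I, FiniteDimensional k (annKer P (M I)))
    (hcl : ∀ I, annCounit P (annKer P (M I)) = M I)
    (hsurj : ∀ N : Submodule k A, IsCrossed N → FiniteDimensional k (A ⧸ N) → ∃ I, N = M I) :
    ∃ Ψ : T ≃ FinDimTangentSpaces P, ∀ I, (Ψ I).1 = annKer P (M I) := by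
  let F : T → FinDimTangentSpaces P := fun I =>
    ⟨annKer P (M I), hP.isTangentSpace_annKer (hM I), hfd I⟩
  refine ⟨Equiv.ofBijective F ⟨fun I J h => hinj ?_, fun L => ?_⟩, fun I => rfl⟩
  · rw [← hcl I, ← hcl J]
    exact congrArg (fun L : FinDimTangentSpaces P => annCounit P L.1) h
  · obtain ⟨L, hL, hfL⟩ := L
    obtain ⟨h1, h2⟩ := hP.annKer_annCounit hU hL.le_ker
    obtain ⟨I, hI⟩ := hsurj _ (hP.isCrossed_annCounit hA hL) h2
    refine ⟨I, Subtype.ext ?_⟩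
    change annKer P (M I) = L
    rw [← hI, h1]

/-! ### The basis `X^m g^l` -/

namespace QBorel

open scoped LaurentPolynomial
open LaurentPolynomial (T)

variable {K : Type u} [Field K] {q : Kˣ}

/-- The group-like element `g` as a unit. -/
def gU : (QBorel K q)ˣ := ⟨g, ginv, g_mul_ginv, ginv_mul_g⟩

theorem coe_gU : ((gU : (QBorel K q)ˣ) : QBorel K q) = g := rfl

theorem g_mul_X : (g * X : QBorel K q) = ((q⁻¹ : Kˣ) : K) • (X * g) := by
  rw [X_mul_g, smul_smul, Units.inv_mul, one_smul]

theorem g_mul_X_pow (m : ℕ) :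
    (g * X ^ m : QBorel K q) = ((q⁻¹ : Kˣ) : K) ^ m • (X ^ m * g) := by
  induction m with
  | zero => simp
  | succ m ih =>
    rw [pow_succ' X, ← mul_assoc, g_mul_X, smul_mul_assoc, mul_assoc, ih, mul_smul_comm, smul_smul,
      ← pow_succ', ← mul_assoc]

theorem ginv_mul_X_pow (m : ℕ) :
    (ginv * X ^ m : QBorel K q) = (q : K) ^ m • (X ^ m * ginv) := by
  have h := congrArg (fun t : QBorel K q => ginv * t * ginv) (g_mul_X_pow (K := K) (q := q) m)
  simp only [← mul_assoc, ginv_mul_g, one_mul, mul_smul_comm, smul_mul_assoc] at h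
  rw [mul_assoc _ g ginv, g_mul_ginv, mul_one] at h
  rw [h, smul_smul, ← mul_pow, Units.mul_inv, one_pow, one_smul]

/-- A subspace which is stable under left multiplication by the generators is a left ideal. -/
theorem mul_mem_of_generators {S : Submodule K (QBorel K q)} (hX : ∀ s ∈ S, X * s ∈ S)
    (hg : ∀ s ∈ S, g * s ∈ S) (hi : ∀ s ∈ S, ginv * s ∈ S) (a : QBorel K q) :
    ∀ s ∈ S, a * s ∈ S := by
  have ha : a ∈ Algebra.adjoin K ({X, g, ginv} : Set (QBorel K q)) :=
    (adjoin_eq_top (K := K) (q := q)) ▸ Algebra.mem_top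
  induction ha using Algebra.adjoin_induction with
  | mem x hx => rcases hx with rfl | rfl | rfl <;> assumption
  | algebraMap r =>
    intro s hs
    rw [← Algebra.smul_def]
    exact S.smul_mem r hs
  | add x y _ _ h1 h2 => intro s hs; rw [add_mul]; exact S.add_mem (h1 s hs) (h2 s hs)
  | mul x y _ _ h1 h2 => intro s hs; rw [mul_assoc]; exact h1 _ (h2 s hs)

/-- The substitution of `g` into Laurent polynomials. -/
def lau : K[T;T⁻¹] →ₐ[K] QBorel K q :=
  AddMonoidAlgebra.lift K (QBorel K q) ℤ ((Units.coeHom (QBorel K q)).comp (zpowersHom _ gU))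

theorem lau_T (n : ℤ) : (lau (T n) : QBorel K q) = ((gU ^ n : (QBorel K q)ˣ) : QBorel K q) := by
  rw [T, lau, AddMonoidAlgebra.lift_single, one_smul]
  simp [zpowersHom_apply]

theorem lau_T_one : (lau (T 1) : QBorel K q) = g := by rw [lau_T, zpow_one, coe_gU]

theorem lau_T_neg_one : (lau (T (-1)) : QBorel K q) = ginv := by rw [lau_T, zpow_neg_one]; rfl

theorem lau_toLaurent (p : Polynomial K) :
    (lau (Polynomial.toLaurent p) : QBorel K q) = Polynomial.aeval g p := by
  have h : (lau (q := q)).comp (Polynomial.toLaurentAlg (R := K)) = Polynomial.aeval g :=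
    Polynomial.algHom_ext (by simp [lau_T_one])
  rw [← h]
  simp

/-- Multiplication by `X` on sequences `p` of Laurent polynomials, where `p` represents
`∑ X^m p_m(g)`. -/
def shift (K : Type u) [Field K] : Module.End K (ℕ → K[T;T⁻¹]) where
  toFun f m := Nat.casesOn m 0 f
  map_add' f f' := by funext m; cases m <;> simp
  map_smul' c f := by funext m; cases m <;> simp

theorem shift_zero (f : ℕ → K[T;T⁻¹]) : shift K f 0 = 0 := rfl
theorem shift_succ (f : ℕ → K[T;T⁻¹]) (m : ℕ) : shift K f (m + 1) = f m := rfl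

/-- The operator `p ↦ (c^m T^n p_m)_m`. -/
def twist (c : K) (n : ℤ) : Module.End K (ℕ → K[T;T⁻¹]) where
  toFun f m := c ^ m • (T n * f m)
  map_add' f f' := by funext m; simp [mul_add]
  map_smul' c' f := by funext m; simp [smul_comm c']

theorem twist_apply (c : K) (n : ℤ) (f : ℕ → K[T;T⁻¹]) (m : ℕ) :
    twist c n f m = c ^ m • (T n * f m) := rfl

variable (K q) in
/-- The left regular representation in the coordinates `∑ X^m p_m(g)`. -/
def regRep : QBorel K q →ₐ[K] Module.End K (ℕ → K[T;T⁻¹]) :=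
  lift (shift K) (twist ((q⁻¹ : Kˣ) : K) 1) (twist (q : K) (-1))
    (by
      ext f m : 2
      simp only [Module.End.mul_apply, twist_apply, mul_smul_comm, smul_smul, ← mul_pow, ← mul_assoc,
        ← LaurentPolynomial.T_add]
      simp)
    (by
      ext f m : 2
      simp only [Module.End.mul_apply, twist_apply, mul_smul_comm, smul_smul, ← mul_pow, ← mul_assoc,
        ← LaurentPolynomial.T_add]
      simp)
    (by
      ext f m : 2
      cases m with
      | zero => simp [Module.End.mul_apply, twist_apply, shift_zero]
      | succ m =>
        simp only [Module.End.mul_apply, LinearMap.smul_apply, Pi.smul_apply, twist_apply,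
          shift_succ, smul_smul, pow_succ']
        rw [← mul_assoc, Units.mul_inv, one_mul])

/-- The components `p_m` of `a = ∑ X^m p_m(g)`. -/
def comp : QBorel K q →ₗ[K] (ℕ → K[T;T⁻¹]) :=
  LinearMap.applyₗ (Pi.single 0 1) ∘ₗ (regRep K q).toLinearMap

theorem comp_X_mul_zero (a : QBorel K q) : comp (X * a) 0 = 0 := by
  simp [comp, regRep, shift_zero]

theorem comp_X_mul_succ (a : QBorel K q) (m : ℕ) : comp (X * a) (m + 1) = comp a m := by
  simp [comp, regRep, shift_succ]

theorem comp_g_mul (a : QBorel K q) (m : ℕ) :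
    comp (g * a) m = ((q⁻¹ : Kˣ) : K) ^ m • (T 1 * comp a m) := by
  simp [comp, regRep, twist_apply]

theorem comp_ginv_mul (a : QBorel K q) (m : ℕ) :
    comp (ginv * a) m = (q : K) ^ m • (T (-1) * comp a m) := by
  simp [comp, regRep, twist_apply]

theorem comp_one : comp (1 : QBorel K q) = Pi.single 0 1 := by simp [comp]

theorem comp_lau (f : K[T;T⁻¹]) : comp (lau f : QBorel K q) = Pi.single 0 f := by
  induction f using LaurentPolynomial.induction_on with
  | h_C a =>
    rw [LaurentPolynomial.C_eq_algebraMap, AlgHom.commutes, Algebra.algebraMap_eq_smul_one, map_smul,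
      comp_one, Algebra.algebraMap_eq_smul_one, Pi.single_smul]
  | h_add h1 h2 => rw [map_add, map_add, h1, h2, Pi.single_add]
  | h_C_mul_T n a h =>
    funext m
    rw [LaurentPolynomial.T_add, ← mul_assoc, mul_comm, map_mul, lau_T_one, comp_g_mul, h]
    cases m <;> simp
  | h_C_mul_T_Z n a h =>
    funext m
    rw [sub_eq_add_neg, LaurentPolynomial.T_add, ← mul_assoc, mul_comm, map_mul, lau_T_neg_one,
      comp_ginv_mul, h]
    cases m <;> simp

theorem comp_X_pow_mul_lau (m : ℕ) (f : K[T;T⁻¹]) :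
    comp (X ^ m * lau f : QBorel K q) = Pi.single m f := by
  induction m with
  | zero => rw [pow_zero, one_mul, comp_lau]
  | succ m ih =>
    funext n
    rw [pow_succ', mul_assoc]
    cases n with
    | zero => rw [comp_X_mul_zero]; simp
    | succ n => rw [comp_X_mul_succ, ih]; simp [Pi.single_apply]

/-- The coefficient of `X^m g^l`. -/
def coeffFun (m : ℕ) (l : ℤ) : QBorel K q →ₗ[K] K := Finsupp.lapply l ∘ₗ
  (AddMonoidAlgebra.coeffLinearEquiv K).toLinearMap ∘ₗ LinearMap.proj m ∘ₗ comp

theorem coeffFun_apply (m : ℕ) (l : ℤ) (a : QBorel K q) :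
    coeffFun m l a = (comp a m).coeff l := rfl

/-- The element `∑ X^m p_m(g)` with components `p_m`. -/
def ofComp : (ℕ →₀ K[T;T⁻¹]) →ₗ[K] QBorel K q :=
  Finsupp.lsum K fun m => LinearMap.mulLeft K (X ^ m) ∘ₗ lau.toLinearMap

theorem ofComp_single (m : ℕ) (f : K[T;T⁻¹]) :
    (ofComp (Finsupp.single m f) : QBorel K q) = X ^ m * lau f := by
  simp [ofComp]

theorem ofComp_surjective : Function.Surjective (ofComp (K := K) (q := q)) := by
  intro a
  suffices h : ∀ s ∈ LinearMap.range (ofComp (K := K) (q := q)),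
      a * s ∈ LinearMap.range (ofComp (K := K) (q := q)) by
    have h1 := h 1 ⟨Finsupp.single 0 1, by simp [ofComp_single]⟩
    rwa [mul_one] at h1
  have key : ∀ b : QBorel K q, (∀ m f, b * (X ^ m * lau f) ∈ LinearMap.range
      (ofComp (K := K) (q := q))) → ∀ s ∈ LinearMap.range (ofComp (K := K) (q := q)),
      b * s ∈ LinearMap.range (ofComp (K := K) (q := q)) := by
    rintro b hb _ ⟨F, rfl⟩
    induction F using Finsupp.induction_linear with
    | zero => simp
    | add F G h1 h2 => rw [map_add, mul_add]; exact Submodule.add_mem _ h1 h2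
    | single m f => rw [ofComp_single]; exact hb m f
  refine mul_mem_of_generators (key _ fun m f => ?_) (key _ fun m f => ?_) (key _ fun m f => ?_) a
  · exact ⟨Finsupp.single (m + 1) f, by rw [ofComp_single, pow_succ', mul_assoc]⟩
  · refine ⟨((q⁻¹ : Kˣ) : K) ^ m • Finsupp.single m (T 1 * f), ?_⟩
    rw [map_smul, ofComp_single, map_mul, lau_T_one, ← mul_assoc, ← mul_assoc, g_mul_X_pow,
      smul_mul_assoc]
  · refine ⟨(q : K) ^ m • Finsupp.single m (T (-1) * f), ?_⟩
    rw [map_smul, ofComp_single, map_mul, lau_T_neg_one, ← mul_assoc, ← mul_assoc, ginv_mul_X_pow,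
      smul_mul_assoc]

theorem comp_ofComp (F : ℕ →₀ K[T;T⁻¹]) : comp (ofComp F : QBorel K q) = F := by
  induction F using Finsupp.induction_linear with
  | zero => simp
  | add F G h1 h2 => rw [map_add, map_add, h1, h2, Finsupp.coe_add]
  | single m f => rw [ofComp_single, comp_X_pow_mul_lau, Finsupp.single_eq_pi_single]

theorem comp_injective : Function.Injective (comp (K := K) (q := q)) := fun a b h => by
  obtain ⟨F, rfl⟩ := ofComp_surjective a
  obtain ⟨G, rfl⟩ := ofComp_surjective b
  rw [comp_ofComp, comp_ofComp] at h
  rw [DFunLike.coe_injective h]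

theorem coeffFun_X_pow_mul_lau_T (m m' : ℕ) (l l' : ℤ) :
    coeffFun m l (X ^ m' * lau (T l') : QBorel K q) = if m = m' ∧ l' = l then 1 else 0 := by
  rw [coeffFun_apply, comp_X_pow_mul_lau, Pi.single_apply]
  by_cases h : m = m' <;> simp [h]

/-- Additive properties can be checked on the elements `X^m f(g)`. -/
theorem monomial_induction {p : QBorel K q → Prop} (zero : p 0)
    (add : ∀ a b, p a → p b → p (a + b)) (mono : ∀ m f, p (X ^ m * lau f)) (a : QBorel K q) :
    p a := by
  obtain ⟨F, rfl⟩ := ofComp_surjective a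
  induction F using Finsupp.induction_linear with
  | zero => rwa [map_zero]
  | add F G h1 h2 => rw [map_add]; exact add _ _ h1 h2
  | single m f => rw [ofComp_single]; exact mono m f

/-- A subspace contains `a` if it contains the homogeneous components `X^m p_m(g)` of `a`. -/
theorem mem_of_comp_mem {S : Submodule K (QBorel K q)} {a : QBorel K q}
    (h : ∀ m, X ^ m * lau (comp a m) ∈ S) : a ∈ S := by
  obtain ⟨F, rfl⟩ := ofComp_surjective a
  rw [comp_ofComp] at h
  rw [ofComp, Finsupp.lsum_apply]
  exact Submodule.sum_mem _ fun m _ => h m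

/-- `X^m h(g) = b X^m` for some `b`. -/
theorem exists_X_pow_mul_lau_eq (m : ℕ) (h : K[T;T⁻¹]) :
    ∃ b : QBorel K q, X ^ m * lau h = b * X ^ m := by
  induction h using LaurentPolynomial.induction_on with
  | h_C a => exact ⟨algebraMap K _ a, by
      rw [LaurentPolynomial.C_eq_algebraMap, AlgHom.commutes, Algebra.commutes]⟩
  | h_add h1 h2 =>
    obtain ⟨b, hb⟩ := h1
    obtain ⟨c, hc⟩ := h2
    exact ⟨b + c, by rw [map_add, mul_add, hb, hc, add_mul]⟩
  | h_C_mul_T n a h =>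
    obtain ⟨b, hb⟩ := h
    refine ⟨(q : K) ^ m • (b * g), ?_⟩
    rw [LaurentPolynomial.T_add, ← mul_assoc, map_mul, ← mul_assoc, hb, lau_T_one, smul_mul_assoc,
      mul_assoc b g, g_mul_X_pow, mul_smul_comm, smul_smul, ← mul_pow, Units.mul_inv, one_pow,
      one_smul, mul_assoc]
  | h_C_mul_T_Z n a h =>
    obtain ⟨b, hb⟩ := h
    refine ⟨((q⁻¹ : Kˣ) : K) ^ m • (b * ginv), ?_⟩
    rw [sub_eq_add_neg, LaurentPolynomial.T_add, ← mul_assoc, map_mul, ← mul_assoc, hb,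
      lau_T_neg_one, smul_mul_assoc, mul_assoc b ginv, ginv_mul_X_pow, mul_smul_comm, smul_smul,
      ← mul_pow, Units.inv_mul, one_pow, one_smul, mul_assoc]

end QBorel

/-! ### The adjoint coaction on the basis -/

/-- Gaussian binomial coefficients: `gauss v i r` is the `v`-binomial of `i + r` over `r`. -/
def gauss {K : Type*} [Field K] (v : K) : ℕ → ℕ → K
  | 0, _ => 1
  | _ + 1, 0 => 1
  | i + 1, r + 1 => gauss v i (r + 1) + v ^ (i + 1) * gauss v (i + 1) r

section Gauss

variable {K : Type*} [Field K] (v : K)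

theorem gauss_zero_left (r : ℕ) : gauss v 0 r = 1 := by cases r <;> simp [gauss]

theorem gauss_zero_right (i : ℕ) : gauss v i 0 = 1 := by cases i <;> simp [gauss]

theorem gauss_succ_succ (i r : ℕ) :
    gauss v (i + 1) (r + 1) = gauss v i (r + 1) + v ^ (i + 1) * gauss v (i + 1) r := by
  rw [gauss]

theorem one_sub_mul_gauss : ∀ i r : ℕ,
    (1 - v ^ (r + 1)) * gauss v i (r + 1) = (1 - v ^ (i + 1)) * gauss v (i + 1) r
  | 0, 0 => by simp [gauss_zero_left, gauss_zero_right]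
  | 0, r + 1 => by
    have h := one_sub_mul_gauss 0 r
    simp only [gauss_succ_succ, gauss_zero_left, zero_add] at h ⊢
    linear_combination v * h
  | i + 1, 0 => by
    have h := one_sub_mul_gauss i 0
    simp only [gauss_succ_succ, gauss_zero_right, zero_add] at h ⊢
    linear_combination h
  | i + 1, r + 1 => by
    have h1 := one_sub_mul_gauss i (r + 1)
    have h2 := one_sub_mul_gauss (i + 1) r
    rw [gauss_succ_succ v i (r + 1), gauss_succ_succ v (i + 1) r]
    linear_combination h1 + v ^ (i + 2) * h2

theorem gauss_one_left (r : ℕ) : gauss v 1 r = ∑ j ∈ Finset.range (r + 1), v ^ j := by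
  induction r with
  | zero => simp [gauss_zero_right]
  | succ r ih =>
    rw [gauss_succ_succ, gauss_zero_left, ih, zero_add, pow_one, Finset.sum_range_succ' _ (r + 1),
      Finset.mul_sum, add_comm]
    simp [pow_succ']

open Polynomial in
/-- The product `∏_{r ≤ j < r + i} (1 - v^j T)`. -/
def qFac (r i : ℕ) : K[X] := ∏ j ∈ Finset.range i, (1 - C (v ^ (r + j)) * X)

open Polynomial in
theorem qFac_succ_left (r i : ℕ) : qFac v r (i + 1) = (1 - C (v ^ r) * X) * qFac v (r + 1) i := by
  rw [qFac, Finset.prod_range_succ', mul_comm, add_zero, qFac]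
  congr 1
  refine Finset.prod_congr rfl fun j _ => ?_
  rw [add_assoc, add_comm 1 j]

open Polynomial in
theorem qFac_succ_right (r i : ℕ) :
    qFac v r (i + 1) = qFac v r i * (1 - C (v ^ (r + i)) * X) := by
  rw [qFac, Finset.prod_range_succ, qFac]

theorem qFac_zero (r : ℕ) : qFac v r 0 = 1 := by simp [qFac]

open Polynomial in
theorem gauss_smul_qFac (i r : ℕ) :
    gauss v i (r + 1) • ((1 - C (v ^ (i + 2 * (r + 1))) * X) * qFac v (r + 1) i) +
      (gauss v (i + 1) r * v ^ (i + 1)) • qFac v r (i + 1) =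
    gauss v (i + 1) (r + 1) • qFac v (r + 1) (i + 1) := by
  have h := congrArg C (one_sub_mul_gauss v i r)
  rw [gauss_succ_succ, qFac_succ_left v r i, qFac_succ_right v (r + 1) i]
  simp only [smul_eq_C_mul, map_add, map_mul, map_sub, map_one, map_pow] at h ⊢
  linear_combination C v ^ (i + r + 1) * X * qFac v (r + 1) i * h

end Gauss

namespace QBorel

open scoped LaurentPolynomial
open LaurentPolynomial (T)

variable {K : Type u} [Field K] {q : Kˣ}

theorem comul_X : comul (R := K) (X : QBorel K q) = X ⊗ₜ 1 + g ⊗ₜ X := by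
  rw [comul_eq, comulHom, lift_X]
theorem comul_g : comul (R := K) (g : QBorel K q) = g ⊗ₜ g := by
  rw [comul_eq, comulHom, lift_g]
theorem comul_ginv : comul (R := K) (ginv : QBorel K q) = ginv ⊗ₜ ginv := by
  rw [comul_eq, comulHom, lift_ginv]
theorem counit_X : counit (R := K) (X : QBorel K q) = 0 := by
  rw [counit_eq, counitHom, lift_X]
theorem counit_g : counit (R := K) (g : QBorel K q) = 1 := by
  rw [counit_eq, counitHom, lift_g]
theorem counit_ginv : counit (R := K) (ginv : QBorel K q) = 1 := by
  rw [counit_eq, counitHom, lift_ginv]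
theorem antipode_X : antipode K (X : QBorel K q) = -(ginv * X) := by
  change antiLin antipodeHom X = _
  simp [antiLin, antipodeHom]
theorem antipode_g : antipode K (g : QBorel K q) = ginv := by
  change antiLin antipodeHom g = _
  simp [antiLin, antipodeHom]
theorem antipode_ginv : antipode K (ginv : QBorel K q) = g := by
  change antiLin antipodeHom ginv = _
  simp [antiLin, antipodeHom]

theorem adCoact_lau (f : K[T;T⁻¹]) :
    adCoact (k := K) (lau f : QBorel K q) = 1 ⊗ₜ lau f := by
  induction f using LaurentPolynomial.induction_on with
  | h_C a =>
    rw [LaurentPolynomial.C_eq_algebraMap, AlgHom.commutes, Algebra.algebraMap_eq_smul_one, map_smul,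
      adCoact_one, TensorProduct.tmul_smul]
  | h_add h1 h2 => rw [map_add, map_add, h1, h2, TensorProduct.tmul_add]
  | h_C_mul_T n a h =>
    rw [LaurentPolynomial.T_add, ← mul_assoc, mul_comm, map_mul, lau_T_one,
      adCoact_groupLike_mul comul_g, h]
    simp [antipode_g, g_mul_ginv]
  | h_C_mul_T_Z n a h =>
    rw [sub_eq_add_neg, LaurentPolynomial.T_add, ← mul_assoc, mul_comm, map_mul, lau_T_neg_one,
      adCoact_groupLike_mul comul_ginv, h]
    simp [antipode_ginv, ginv_mul_g]

theorem g_pow_mul_X (r : ℕ) :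
    (g ^ r * X : QBorel K q) = ((q⁻¹ : Kˣ) : K) ^ r • (X * g ^ r) := by
  induction r with
  | zero => simp
  | succ r ih =>
    rw [pow_succ' g, mul_assoc, ih, mul_smul_comm, ← mul_assoc, g_mul_X, smul_mul_assoc, smul_smul,
      ← pow_succ, mul_assoc]

/-- The linear map `p ↦ X^r p(g) f(g)`. -/
def monoMul (r : ℕ) (f : K[T;T⁻¹]) : Polynomial K →ₗ[K] QBorel K q :=
  LinearMap.mulLeft K (X ^ r) ∘ₗ lau.toLinearMap ∘ₗ LinearMap.mulRight K f ∘ₗ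
    (Polynomial.toLaurentAlg (R := K)).toLinearMap

theorem monoMul_apply (r : ℕ) (f : K[T;T⁻¹]) (p : Polynomial K) :
    (monoMul r f p : QBorel K q) = X ^ r * lau (Polynomial.toLaurent p * f) := by
  simp [monoMul]

theorem X_mul_monoMul (r : ℕ) (f : K[T;T⁻¹]) (p : Polynomial K) :
    (X * monoMul r f p : QBorel K q) = monoMul (r + 1) f p := by
  simp only [monoMul_apply, pow_succ', mul_assoc]

theorem g_mul_monoMul (r : ℕ) (f : K[T;T⁻¹]) (p : Polynomial K) :
    (g * monoMul r f p : QBorel K q) = ((q⁻¹ : Kˣ) : K) ^ r • monoMul r f (Polynomial.X * p) := by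
  rw [monoMul_apply, ← mul_assoc, g_mul_X_pow, smul_mul_assoc, monoMul_apply,
    map_mul Polynomial.toLaurent, Polynomial.toLaurent_X, mul_assoc (T 1), map_mul lau (T 1),
    lau_T_one, mul_assoc]

/-- The adjoint coaction of `X^m f(g)`. -/
theorem adCoact_X_pow_mul_lau (m : ℕ) (f : K[T;T⁻¹]) :
    adCoact (k := K) (X ^ m * lau f : QBorel K q) =
      ∑ p ∈ Finset.HasAntidiagonal.antidiagonal m, gauss ((q⁻¹ : Kˣ) : K) p.1 p.2 •
        ((X ^ p.1 * g ^ p.2) ⊗ₜ[K] monoMul p.2 f (qFac ((q⁻¹ : Kˣ) : K) p.2 p.1)) := by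
  set v := ((q⁻¹ : Kˣ) : K) with hv
  induction m with
  | zero => simp [adCoact_lau, gauss_zero_left, qFac_zero, monoMul_apply]
  | succ m ih =>
    -- the two kinds of terms which a term of `Ad(X^m f(g))` contributes to `Ad(X^(m+1) f(g))`
    let s : ℕ → ℕ → QBorel K q ⊗[K] QBorel K q := fun i r => (X ^ (i + 1) * g ^ r) ⊗ₜ[K]
      monoMul r f ((1 - Polynomial.C (v ^ (i + 2 * r)) * Polynomial.X) * qFac v r i)
    let t : ℕ → ℕ → QBorel K q ⊗[K] QBorel K q := fun i r => (X ^ i * g ^ (r + 1)) ⊗ₜ[K]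
      monoMul (r + 1) f (qFac v r i)
    have key : ∀ i r, LinearMap.rTensor (QBorel K q) (LinearMap.mulLeft K X)
          ((X ^ i * g ^ r) ⊗ₜ[K] monoMul r f (qFac v r i)) +
        (TensorProduct.map (LinearMap.mulLeft K g) (LinearMap.mulLeft K X)
          ((X ^ i * g ^ r) ⊗ₜ[K] monoMul r f (qFac v r i)) +
        TensorProduct.map (LinearMap.mulLeft K g ∘ₗ LinearMap.mulRight K (antipode K X))
          (LinearMap.mulLeft K g) ((X ^ i * g ^ r) ⊗ₜ[K] monoMul r f (qFac v r i))) =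
        s i r + v ^ i • t i r := by
      intro i r
      have e1 : (X * (X ^ i * g ^ r) : QBorel K q) = X ^ (i + 1) * g ^ r := by
        rw [pow_succ', mul_assoc]
      have e2 : (g * (X ^ i * g ^ r) : QBorel K q) = v ^ i • (X ^ i * g ^ (r + 1)) := by
        rw [← mul_assoc, g_mul_X_pow, smul_mul_assoc, mul_assoc, ← pow_succ']
      have e3 : (g * (X ^ i * g ^ r * antipode K X) : QBorel K q) =
          -(v ^ (i + r) • (X ^ (i + 1) * g ^ r)) := by
        have e4 : (X ^ i * g ^ (r + 1) * (ginv * X) : QBorel K q) = X ^ i * (g ^ r * X) := by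
          rw [pow_succ, mul_assoc, mul_assoc (g ^ r), ← mul_assoc g, g_mul_ginv, one_mul]
        rw [antipode_X, mul_neg, mul_neg, ← mul_assoc, e2, smul_mul_assoc, e4, g_pow_mul_X,
          mul_smul_comm, smul_smul, ← pow_add, ← mul_assoc, ← pow_succ]
      simp only [LinearMap.rTensor_tmul, TensorProduct.map_tmul, LinearMap.comp_apply,
        LinearMap.mulLeft_apply, LinearMap.mulRight_apply, e1, e2, e3, X_mul_monoMul, g_mul_monoMul]
      simp only [s, t, sub_mul, one_mul, map_sub, TensorProduct.tmul_sub, TensorProduct.neg_tmul,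
        TensorProduct.tmul_smul, TensorProduct.smul_tmul', ← Polynomial.smul_eq_C_mul,
        map_smul, ← hv, smul_mul_assoc, smul_neg, smul_smul, ← pow_add]
      rw [show i + 2 * r = r + (i + r) by ring]
      abel
    let u : ℕ × ℕ → QBorel K q ⊗[K] QBorel K q := fun p =>
      match p with
      | (0, _) => 0
      | (i + 1, r) => gauss v i r • s i r
    let w : ℕ × ℕ → QBorel K q ⊗[K] QBorel K q := fun p =>
      match p with
      | (_, 0) => 0
      | (i, r + 1) => (gauss v i r * v ^ i) • t i r
    have hu : ∑ p ∈ Finset.HasAntidiagonal.antidiagonal (m + 1), u p =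
        ∑ p ∈ Finset.HasAntidiagonal.antidiagonal m, gauss v p.1 p.2 • s p.1 p.2 := by
      rw [Finset.Nat.sum_antidiagonal_succ]
      exact zero_add _
    have hw : ∑ p ∈ Finset.HasAntidiagonal.antidiagonal (m + 1), w p =
        ∑ p ∈ Finset.HasAntidiagonal.antidiagonal m, (gauss v p.1 p.2 * v ^ p.1) • t p.1 p.2 := by
      rw [Finset.Nat.sum_antidiagonal_succ']
      exact zero_add _
    rw [pow_succ', mul_assoc, adCoact_skewPrimitive_mul comul_X, ih]
    simp only [map_sum, map_smul, ← Finset.sum_add_distrib, ← smul_add, key]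
    simp only [smul_add, smul_smul]
    rw [Finset.sum_add_distrib, ← hu, ← hw, ← Finset.sum_add_distrib]
    refine Finset.sum_congr rfl ?_
    rintro ⟨i, r⟩ hp
    rw [Finset.HasAntidiagonal.mem_antidiagonal] at hp
    match i, r, hp with
    | 0, 0, hp => simp at hp
    | 0, r + 1, _ => simp [u, w, t, gauss_zero_left, qFac_zero]
    | i + 1, 0, _ =>
      simp [u, w, s, gauss_zero_right, qFac_succ_right, mul_comm (qFac v 0 i)]
    | i + 1, r + 1, _ =>
      simp only [u, w, s, t]
      rw [← TensorProduct.tmul_smul, ← TensorProduct.tmul_smul, ← TensorProduct.tmul_smul,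
        ← map_smul, ← map_smul, ← map_smul, ← TensorProduct.tmul_add, ← map_add, gauss_smul_qFac]

end QBorel

/-! ### The left ideals `M_I` -/

section Laurent

open scoped LaurentPolynomial
open Polynomial (toLaurent)
open LaurentPolynomial (T)

variable {K : Type*} [Field K]

/-- The polynomials of degree less than `deg P` represent all residue classes modulo `P` of Laurent
polynomials. -/
theorem exists_toLaurent_dvd_sub {P : Polynomial K} (hP : P.coeff 0 ≠ 0) (f : K[T;T⁻¹]) :
    ∃ r : Polynomial K, r.degree < P.degree ∧ toLaurent P ∣ f - toLaurent r := by
  have hP0 : P ≠ 0 := fun h => hP (by simp [h])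
  obtain ⟨N, h, hf⟩ := f.exists_T_pow
  -- an inverse `u` of `X^N` modulo `P`
  have hc : IsCoprime (Polynomial.X ^ N) P := by
    refine IsCoprime.pow_left ((Polynomial.irreducible_X.coprime_iff_not_dvd).mpr ?_)
    rwa [Polynomial.X_dvd_iff]
  obtain ⟨u, w, huw⟩ := hc
  refine ⟨(h * u) % P, EuclideanDomain.mod_lt _ hP0, ?_⟩
  have h1 : toLaurent P ∣ toLaurent (h - Polynomial.X ^ N * ((h * u) % P)) := by
    refine map_dvd _ ⟨h * w + Polynomial.X ^ N * ((h * u) / P), ?_⟩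
    have h2 := EuclideanDomain.div_add_mod (h * u) P
    linear_combination -Polynomial.X ^ N * h2 - h * huw
  have h3 : f - toLaurent ((h * u) % P) =
      toLaurent (h - Polynomial.X ^ N * ((h * u) % P)) * T (-N) := by
    rw [map_sub, hf, map_mul, Polynomial.toLaurent_X_pow, sub_mul, mul_assoc f, mul_right_comm,
      ← LaurentPolynomial.T_add, add_neg_cancel, LaurentPolynomial.T_zero, mul_one, one_mul]
  rw [h3]
  exact h1.mul_right _

theorem dvd_of_toLaurent_dvd {P p : Polynomial K} (hP : P.coeff 0 ≠ 0)
    (h : toLaurent P ∣ toLaurent p) : P ∣ p := by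
  obtain ⟨f, hf⟩ := h
  obtain ⟨N, h, hh⟩ := f.exists_T_pow
  have h1 : Polynomial.X ^ N * p = P * h := by
    apply Polynomial.toLaurent_injective
    rw [map_mul, map_mul, hh, hf, Polynomial.toLaurent_X_pow]
    ring
  have hc : IsCoprime P (Polynomial.X ^ N) := by
    refine (IsCoprime.pow_left ((Polynomial.irreducible_X.coprime_iff_not_dvd).mpr ?_)).symm
    rwa [Polynomial.X_dvd_iff]
  exact hc.dvd_of_dvd_mul_left ⟨h, h1⟩

end Laurent

section CrossedIdeal

open Polynomial

variable {K : Type u} [Field K] (q : Kˣ) (I : Finset ℕ+)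

/-- The polynomial `∏_{n ∈ I, n > m} (1 - q^{1-n} T)`. -/
def idealPoly (m : ℕ) : K[X] := ∏ n ∈ I.filter (fun n : ℕ+ => m < (n : ℕ)),
  (1 - C ((q ^ (1 - ((n : ℕ) : ℤ)) : Kˣ) : K) * X)

theorem idealPoly_coeff_zero (m : ℕ) : (idealPoly q I m).coeff 0 = 1 := by
  rw [coeff_zero_eq_eval_zero, idealPoly, eval_prod]
  simp

theorem idealPoly_ne_zero (m : ℕ) : idealPoly q I m ≠ 0 := fun h => by
  have h1 := idealPoly_coeff_zero q I m
  rw [h] at h1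
  simp at h1

theorem natDegree_idealPoly (m : ℕ) :
    (idealPoly q I m).natDegree = (I.filter (fun n : ℕ+ => m < (n : ℕ))).card := by
  have h : ∀ c : Kˣ, (1 - C (c : K) * X).natDegree = 1 := fun c => by
    have e : (1 - C (c : K) * X) = C (-(c : K)) * X + C 1 := by simp; ring
    rw [e, natDegree_linear (neg_ne_zero.mpr c.ne_zero)]
  have h0 : ∀ c : Kˣ, (1 - C (c : K) * X) ≠ 0 := fun c h0 => by
    have := h c
    rw [h0] at this
    simp at this
  rw [idealPoly, natDegree_prod _ _ fun n _ => h0 _]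
  simp only [h, Finset.sum_const, smul_eq_mul, mul_one]

theorem idealPoly_congr {I J : Finset ℕ+} {m : ℕ} (h : ∀ n : ℕ+, m < n → (n ∈ I ↔ n ∈ J)) :
    idealPoly q I m = idealPoly q J m := by
  have e : I.filter (fun n : ℕ+ => m < (n : ℕ)) = J.filter (fun n : ℕ+ => m < (n : ℕ)) := by
    ext n
    simp only [Finset.mem_filter]
    exact ⟨fun hn => ⟨(h n hn.2).mp hn.1, hn.2⟩, fun hn => ⟨(h n hn.2).mpr hn.1, hn.2⟩⟩
  rw [idealPoly, e, idealPoly]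

theorem idealPoly_of_mem {m : ℕ} (h : m.succPNat ∈ I) :
    idealPoly q I m = (1 - C (((q⁻¹ : Kˣ) : K) ^ m) * X) * idealPoly q I (m + 1) := by
  have e : I.filter (fun n : ℕ+ => m < (n : ℕ)) =
      insert m.succPNat (I.filter (fun n : ℕ+ => m + 1 < (n : ℕ))) := by
    ext n
    simp only [Finset.mem_filter, Finset.mem_insert]
    constructor
    · rintro ⟨h1, h2⟩
      rcases Nat.lt_or_ge (m + 1) n with h3 | h3
      · exact Or.inr ⟨h1, h3⟩
      · exact Or.inl (PNat.coe_inj.mp (by rw [Nat.succPNat_coe]; omega))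
    · rintro (rfl | h1)
      · exact ⟨h, by simp⟩
      · exact ⟨h1.1, by omega⟩
  rw [idealPoly, e, Finset.prod_insert (by simp), idealPoly]
  congr 4
  rw [Nat.succPNat_coe, ← Units.val_pow_eq_pow_val, inv_pow, ← zpow_natCast, ← zpow_neg]
  congr 2
  push_cast
  ring

theorem idealPoly_of_notMem {m : ℕ} (h : m.succPNat ∉ I) :
    idealPoly q I m = idealPoly q I (m + 1) := by
  have e : I.filter (fun n : ℕ+ => m < (n : ℕ)) = I.filter (fun n : ℕ+ => m + 1 < (n : ℕ)) := by
    ext n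
    simp only [Finset.mem_filter]
    refine ⟨fun hn => ⟨hn.1, lt_of_le_of_ne hn.2 fun h1 => h ?_⟩, fun hn => ⟨hn.1, by omega⟩⟩
    have : m.succPNat = n := PNat.coe_inj.mp (by rw [Nat.succPNat_coe]; exact h1)
    rw [this]
    exact hn.1
  rw [idealPoly, e, idealPoly]

theorem idealPoly_succ_dvd (m : ℕ) : idealPoly q I (m + 1) ∣ idealPoly q I m := by
  by_cases h : m.succPNat ∈ I
  · rw [idealPoly_of_mem q I h]
    exact dvd_mul_left _ _
  · rw [idealPoly_of_notMem q I h]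

theorem idealPoly_dvd_succ (m : ℕ) :
    idealPoly q I m ∣ (1 - C (((q⁻¹ : Kˣ) : K) ^ m) * X) * idealPoly q I (m + 1) := by
  by_cases h : m.succPNat ∈ I
  · rw [idealPoly_of_mem q I h]
  · rw [idealPoly_of_notMem q I h]
    exact dvd_mul_left _ _

theorem idealPoly_dvd_qFac_mul (r i : ℕ) :
    idealPoly q I r ∣ qFac ((q⁻¹ : Kˣ) : K) r i * idealPoly q I (r + i) := by
  induction i generalizing r with
  | zero => simp [qFac_zero]
  | succ i ih =>
    rw [qFac_succ_left, mul_assoc, show r + (i + 1) = r + 1 + i by ring]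
    exact (idealPoly_dvd_succ q I r).trans (mul_dvd_mul_left _ (ih (r + 1)))

theorem idealPoly_eq_one {m : ℕ} (h : ∀ n ∈ I, (n : ℕ) ≤ m) : idealPoly q I m = 1 := by
  rw [idealPoly, Finset.filter_false_of_mem fun n hn => not_lt.mpr (h n hn), Finset.prod_empty]

namespace QBorel

variable {q}

/-- An element belongs to `M_I` if and only if its components `p_m` are divisible by
`∏_{n ∈ I, n > m} (1 - q^{1-n} T)`. -/
theorem mem_crossedIdeal {a : QBorel K q} :
    a ∈ crossedIdeal q I ↔ ∀ m, toLaurent (idealPoly q I m) ∣ comp a m := by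
  constructor
  · let S : Submodule K (QBorel K q) :=
      { carrier := {a | ∀ m, toLaurent (idealPoly q I m) ∣ comp a m}
        add_mem' := fun h1 h2 m => by rw [map_add]; exact dvd_add (h1 m) (h2 m)
        zero_mem' := fun m => by simp
        smul_mem' := fun c a h m => by
          rw [map_smul, Pi.smul_apply]
          exact (h m).trans (dvd_smul_of_dvd _ dvd_rfl) }
    have hS : ∀ a : QBorel K q, ∀ s ∈ S, a * s ∈ S := by
      refine fun a => mul_mem_of_generators (fun s hs m => ?_) (fun s hs m => ?_)
        (fun s hs m => ?_) a
      · cases m with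
        | zero => rw [comp_X_mul_zero]; exact dvd_zero _
        | succ m =>
          rw [comp_X_mul_succ]
          exact (_root_.map_dvd _ (idealPoly_succ_dvd q I m)).trans (hs m)
      · rw [comp_g_mul]
        exact dvd_smul_of_dvd _ ((hs m).mul_left _)
      · rw [comp_ginv_mul]
        exact dvd_smul_of_dvd _ ((hs m).mul_left _)
    intro ha
    change a ∈ S
    refine Submodule.span_induction (p := fun a _ => a ∈ S) ?_ S.zero_mem
      (fun a b _ _ h1 h2 => S.add_mem h1 h2) (fun a s _ h => hS a s h) ha
    rintro _ ⟨m, rfl⟩ n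
    change _ ∣ comp (X ^ m * aeval g (idealPoly q I m)) n
    rw [← lau_toLaurent, comp_X_pow_mul_lau, Pi.single_apply]
    split_ifs with h
    · rw [h]
    · exact dvd_zero _
  · intro h
    refine mem_of_comp_mem fun m => ?_
    obtain ⟨f, hf⟩ := h m
    obtain ⟨b, hb⟩ := exists_X_pow_mul_lau_eq (q := q) m f
    rw [hf, mul_comm, map_mul, ← mul_assoc, hb, mul_assoc, lau_toLaurent]
    exact Ideal.mul_mem_left _ b (Ideal.subset_span ⟨m, rfl⟩)

theorem X_pow_mul_lau_mem_crossedIdeal {m : ℕ} {f : LaurentPolynomial K} :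
    (X ^ m * lau f : QBorel K q) ∈ crossedIdeal q I ↔ toLaurent (idealPoly q I m) ∣ f := by
  rw [mem_crossedIdeal]
  constructor
  · intro h
    have h1 := h m
    rwa [comp_X_pow_mul_lau, Pi.single_eq_same] at h1
  · intro h n
    rw [comp_X_pow_mul_lau, Pi.single_apply]
    split_ifs with hn
    · rwa [hn]
    · exact dvd_zero _

theorem mul_mem_crossedIdeal (a : QBorel K q) {v : QBorel K q} (hv : v ∈ crossedIdeal q I) :
    a * v ∈ crossedIdeal q I :=
  Ideal.mul_mem_left _ a hv

theorem counit_lau_toLaurent (p : K[X]) :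
    counit (R := K) (lau (toLaurent p) : QBorel K q) = p.eval 1 := by
  rw [lau_toLaurent, counit_eq, ← Polynomial.aeval_algHom_apply]
  simp [counitHom, Polynomial.aeval_def, Polynomial.eval₂_eq_eval_map]

theorem counit_eq_zero_of_mem_crossedIdeal (hI : (idealPoly q I 0).eval 1 = 0) {v : QBorel K q}
    (hv : v ∈ crossedIdeal q I) : counit (R := K) v = 0 := by
  refine Submodule.span_induction (p := fun a _ => counit (R := K) a = 0) ?_ (map_zero _)
    (fun a b _ _ h1 h2 => by rw [map_add, h1, h2, add_zero])
    (fun a s _ h => by rw [smul_eq_mul, Bialgebra.counit_mul, h, mul_zero]) hv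
  rintro _ ⟨m, rfl⟩
  change counit (R := K) (X ^ m * aeval g (idealPoly q I m)) = 0
  cases m with
  | zero => rw [pow_zero, one_mul, ← lau_toLaurent, counit_lau_toLaurent, hI]
  | succ m => rw [pow_succ', mul_assoc, Bialgebra.counit_mul, counit_X, zero_mul]

theorem isCrossed_crossedIdeal (hI : (idealPoly q I 0).eval 1 = 0) :
    IsCrossed (crossedIdeal q I) where
  counit_eq v hv := counit_eq_zero_of_mem_crossedIdeal I hI hv
  mul_mem a v hv := mul_mem_crossedIdeal I a hv
  coinv v hv := by
    rw [mem_crossedIdeal] at hv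
    suffices h : v ∈ LinearMap.ker (LinearMap.lTensor (QBorel K q) (crossedIdeal q I).mkQ ∘ₗ
        adCoact) from h
    refine mem_of_comp_mem fun m => ?_
    rw [LinearMap.mem_ker, LinearMap.comp_apply, adCoact_X_pow_mul_lau, map_sum]
    refine Finset.sum_eq_zero fun p hp => ?_
    rw [Finset.HasAntidiagonal.mem_antidiagonal] at hp
    rw [map_smul, LinearMap.lTensor_tmul, Submodule.mkQ_apply,
      (Submodule.Quotient.mk_eq_zero _).mpr, TensorProduct.tmul_zero, smul_zero]
    rw [monoMul_apply, X_pow_mul_lau_mem_crossedIdeal]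
    refine (_root_.map_dvd toLaurent (idealPoly_dvd_qFac_mul q I p.2 p.1)).trans ?_
    rw [map_mul, add_comm, hp]
    exact mul_dvd_mul_left _ (hv m)

end QBorel

end CrossedIdeal

/-! ### Codimension of `M_I` and classification of crossed submodules -/

namespace QBorel

open scoped LaurentPolynomial
open Polynomial (toLaurent)
open LaurentPolynomial (T)

variable {K : Type u} [Field K] {q : Kˣ}

theorem sum_card_filter_lt (I : Finset ℕ+) {N : ℕ} (hN : ∀ n ∈ I, (n : ℕ) ≤ N) :
    ∑ m ∈ Finset.range N, (I.filter (fun n : ℕ+ => m < (n : ℕ))).card = ∑ n ∈ I, (n : ℕ) := by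
  simp only [Finset.card_filter]
  rw [Finset.sum_comm]
  refine Finset.sum_congr rfl fun n hn => ?_
  rw [← Finset.card_filter]
  have e : (Finset.range N).filter (fun m => m < (n : ℕ)) = Finset.range n := by
    ext m
    simp only [Finset.mem_filter, Finset.mem_range]
    have := hN n hn
    omega
  rw [e, Finset.card_range]

theorem exists_bound (I : Finset ℕ+) : ∃ N : ℕ, ∀ n ∈ I, (n : ℕ) ≤ N :=
  ⟨∑ n ∈ I, (n : ℕ), fun _ hn => Finset.single_le_sum (f := fun n : ℕ+ => (n : ℕ))
    (fun _ _ => Nat.zero_le _) hn⟩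

/-- The quotient by `M_I` is spanned by the classes of the elements `X^m g^j` with
`j < #{n ∈ I, n > m}`. -/
theorem finrank_quotient_crossedIdeal_le (I : Finset ℕ+) :
    FiniteDimensional K (QBorel K q ⧸ crossedIdeal q I) ∧
      Module.finrank K (QBorel K q ⧸ crossedIdeal q I) ≤ ∑ n ∈ I, (n : ℕ) := by
  obtain ⟨N, hN⟩ := exists_bound I
  let d : ℕ → ℕ := fun m => (I.filter (fun n : ℕ+ => m < (n : ℕ))).card
  let b : (Σ m : Fin N, Fin (d m)) → QBorel K q ⧸ crossedIdeal q I := fun p =>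
    (crossedIdeal q I).mkQ (X ^ (p.1 : ℕ) * g ^ (p.2 : ℕ))
  have hb : Submodule.span K (Set.range b) = ⊤ := by
    rw [eq_top_iff]
    intro x _
    obtain ⟨a, rfl⟩ := Submodule.mkQ_surjective _ x
    suffices h : a ∈ (Submodule.span K (Set.range b)).comap (crossedIdeal q I).mkQ from h
    refine mem_of_comp_mem fun m => ?_
    rw [Submodule.mem_comap]
    have hP : (idealPoly q I m).coeff 0 ≠ 0 := by
      rw [idealPoly_coeff_zero]
      exact one_ne_zero
    obtain ⟨r, hr, hdvd⟩ := exists_toLaurent_dvd_sub hP (comp a m)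
    have h1 : (crossedIdeal q I).mkQ (X ^ m * lau (comp a m)) =
        (crossedIdeal q I).mkQ (X ^ m * lau (toLaurent r)) := by
      rw [← sub_eq_zero, ← map_sub, ← mul_sub, ← map_sub, Submodule.mkQ_apply,
        Submodule.Quotient.mk_eq_zero, X_pow_mul_lau_mem_crossedIdeal]
      exact hdvd
    have hr' : ∀ j, d m ≤ j → r.coeff j = 0 := fun j hj =>
      Polynomial.coeff_eq_zero_of_degree_lt (hr.trans_le (by
        rw [Polynomial.degree_eq_natDegree (idealPoly_ne_zero q I m), natDegree_idealPoly]
        exact_mod_cast hj))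
    rw [h1, lau_toLaurent, Polynomial.aeval_eq_sum_range, Finset.mul_sum, map_sum]
    refine Submodule.sum_mem _ fun j _ => ?_
    rw [mul_smul_comm, map_smul]
    by_cases hj : j < d m
    · refine Submodule.smul_mem _ _ (Submodule.subset_span ?_)
      have hm : m < N := by
        by_contra hm
        have : d m = 0 := by
          rw [Finset.card_eq_zero, Finset.filter_false_of_mem]
          intro n hn
          have := hN n hn
          omega
        omega
      exact ⟨⟨⟨m, hm⟩, ⟨j, hj⟩⟩, rfl⟩
    · rw [hr' j (not_lt.mp hj), zero_smul]
      exact Submodule.zero_mem _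
  refine ⟨Module.Finite.of_surjective _ (LinearMap.range_eq_top.mp
    (hb ▸ Fintype.range_linearCombination K b)), (finrank_le_of_span_eq_top hb).trans ?_⟩
  rw [Fintype.card_sigma, ← sum_card_filter_lt I hN, Finset.sum_range]
  simp [d]

/-- The homogeneous parts of the adjoint coaction of an element of a crossed submodule belong to the
submodule. -/
theorem gauss_smul_mem {M : Submodule K (QBorel K q)} (hM : IsCrossed M) {a : QBorel K q}
    (ha : a ∈ M) (i r : ℕ) :
    gauss ((q⁻¹ : Kˣ) : K) i r •
      monoMul r (comp a (i + r)) (qFac ((q⁻¹ : Kˣ) : K) r i) ∈ M := by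
  have hφ : ∀ i' r' : ℕ, coeffFun i r (X ^ i' * g ^ r' : QBorel K q) =
      if i = i' ∧ r' = r then 1 else 0 := by
    intro i' r'
    have e : (g ^ r' : QBorel K q) = lau (T (r' : ℤ)) := by
      rw [lau_T, zpow_natCast, Units.val_pow_eq_pow_val, coe_gU]
    rw [e, coeffFun_X_pow_mul_lau_T]
    simp
  have key : ∀ a : QBorel K q, TensorProduct.lid K _ (LinearMap.rTensor _ (coeffFun i r) (adCoact a)) =
      gauss ((q⁻¹ : Kˣ) : K) i r •
        monoMul r (comp a (i + r)) (qFac ((q⁻¹ : Kˣ) : K) r i) := by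
    refine monomial_induction (by simp [monoMul_apply]) (fun a b ha hb => ?_) fun m f => ?_
    · rw [map_add, map_add, map_add, ha, hb, ← smul_add]
      simp only [monoMul_apply, map_add, Pi.add_apply, mul_add]
    · rw [adCoact_X_pow_mul_lau, comp_X_pow_mul_lau]
      simp only [map_sum, map_smul, LinearMap.rTensor_tmul, hφ, TensorProduct.lid_tmul]
      by_cases h : i + r = m
      · rw [Finset.sum_eq_single (i, r)]
        · simp [← h]
        · rintro ⟨i', r'⟩ _ hne
          rw [if_neg, zero_smul, smul_zero]
          rintro ⟨rfl, rfl⟩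
          exact hne rfl
        · intro hn
          exact absurd (Finset.HasAntidiagonal.mem_antidiagonal.mpr h) hn
      · rw [Finset.sum_eq_zero]
        · rw [Pi.single_apply, if_neg h]
          simp [monoMul_apply]
        · rintro ⟨i', r'⟩ hp
          rw [Finset.HasAntidiagonal.mem_antidiagonal] at hp
          rw [if_neg, zero_smul, smul_zero]
          rintro ⟨rfl, rfl⟩
          exact h hp
  rw [← key, ← Submodule.Quotient.mk_eq_zero, ← Submodule.mkQ_apply]
  have h1 : ∀ z : QBorel K q ⊗[K] QBorel K q,
      M.mkQ (TensorProduct.lid K _ (LinearMap.rTensor _ (coeffFun i r) z)) =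
      TensorProduct.lid K _ (LinearMap.rTensor _ (coeffFun i r) (LinearMap.lTensor _ M.mkQ z)) := fun z => by
    induction z using TensorProduct.induction_on with
    | zero => simp
    | tmul a b => simp
    | add a b h1 h2 => simp only [map_add, h1, h2]
  rw [h1, hM.coinv a ha, map_zero, map_zero]

theorem comp_mem {M : Submodule K (QBorel K q)} (hM : IsCrossed M) {a : QBorel K q}
    (ha : a ∈ M) (m : ℕ) : X ^ m * lau (comp a m) ∈ M := by
  have h := gauss_smul_mem hM ha 0 m
  rwa [gauss_zero_left, one_smul, qFac_zero, zero_add, monoMul_apply, map_one, one_mul] at h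

theorem X_pow_mul_lau_mul_mem {M : Submodule K (QBorel K q)} (hM : IsCrossed M) {m : ℕ}
    {f : K[T;T⁻¹]} (hf : X ^ m * lau f ∈ M) (h : K[T;T⁻¹]) : X ^ m * lau (f * h) ∈ M := by
  obtain ⟨b, hb⟩ := exists_X_pow_mul_lau_eq (q := q) m h
  rw [mul_comm, map_mul, ← mul_assoc, hb, mul_assoc]
  exact hM.mul_mem b _ hf

open Polynomial in
/-- If the `q`-integers are invertible, a crossed submodule which contains `X^(m+1) f(g)` contains
`X^m (1 - q^{-m} g) f(g)`. -/
theorem X_pow_mul_one_sub_mem (hq : ∀ m : ℕ, ∑ j ∈ Finset.range (m + 1), ((q⁻¹ : Kˣ) : K) ^ j ≠ 0)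
    {M : Submodule K (QBorel K q)} (hM : IsCrossed M) {m : ℕ} {f : K[T;T⁻¹]}
    (hf : X ^ (m + 1) * lau f ∈ M) :
    X ^ m * lau (toLaurent (1 - C (((q⁻¹ : Kˣ) : K) ^ m) * Polynomial.X) * f) ∈ M := by
  have h := gauss_smul_mem hM hf 1 m
  rw [gauss_one_left, M.smul_mem_iff (hq m), add_comm 1 m, comp_X_pow_mul_lau, Pi.single_eq_same,
    monoMul_apply, qFac_succ_right, qFac_zero, one_mul, add_zero] at h
  exact h

theorem exists_X_pow_mem {M : Submodule K (QBorel K q)} (hM : IsCrossed M)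
    [FiniteDimensional K (QBorel K q ⧸ M)] : ∃ N : ℕ, X ^ N ∈ M := by
  by_contra hX
  push Not at hX
  refine Module.Finite.not_linearIndependent_of_infinite (R := K) (fun i : ℕ => M.mkQ (X ^ i)) ?_
  rw [linearIndependent_iff]
  intro l hl
  have h1 : ∀ l : ℕ →₀ K, Finsupp.linearCombination K (fun i : ℕ => M.mkQ (X ^ i)) l =
      M.mkQ (Finsupp.linearCombination K (fun i : ℕ => X ^ i) l) := fun l => by
    rw [Finsupp.apply_linearCombination]
    rfl
  rw [h1, Submodule.mkQ_apply, Submodule.Quotient.mk_eq_zero] at hl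
  have h2 : ∀ (l : ℕ →₀ K) (m : ℕ),
      comp (Finsupp.linearCombination K (fun i : ℕ => (X ^ i : QBorel K q)) l) m =
      algebraMap K _ (l m) := fun l m => by
    induction l using Finsupp.induction_linear with
    | zero => simp
    | add l l' h h' => simp only [map_add, Pi.add_apply, h, h', Finsupp.add_apply]
    | single i c =>
      have h3 := comp_X_pow_mul_lau (q := q) i 1
      rw [map_one, mul_one] at h3
      rw [Finsupp.linearCombination_single, map_smul, h3, Pi.smul_apply, Pi.single_apply,
        Finsupp.single_apply]
      by_cases h : m = i
      · rw [if_pos h, if_pos h.symm, Algebra.algebraMap_eq_smul_one]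
      · rw [if_neg h, if_neg (Ne.symm h), smul_zero, map_zero]
  ext m
  have h3 := comp_mem hM hl m
  rw [h2, AlgHom.commutes, Algebra.algebraMap_eq_smul_one, mul_smul_comm, mul_one] at h3
  by_contra hm
  exact hX m ((M.smul_mem_iff hm).mp h3)

open Polynomial in
/-- There is no ideal strictly between those generated by `F` and by `(1 - c T) F`. -/
theorem dvd_of_notMem {L : Ideal K[T;T⁻¹]} {F : K[T;T⁻¹]} {c : K}
    (hge : toLaurent (1 - C c * Polynomial.X) * F ∈ L) (hF : F ∉ L) {h : K[T;T⁻¹]}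
    (hf : F * h ∈ L) : toLaurent (1 - C c * Polynomial.X) * F ∣ F * h := by
  -- the constant remainder of `h` modulo `1 - c T` vanishes
  obtain ⟨r, hr, h', hh⟩ := exists_toLaurent_dvd_sub (P := 1 - C c * Polynomial.X) (by simp) h
  have hr0 : r.degree ≤ 0 := by
    refine Order.le_of_lt_succ (lt_of_lt_of_le hr ?_)
    refine (degree_sub_le _ _).trans (max_le ?_ ?_)
    · rw [degree_one]
      exact zero_le_one
    · exact degree_C_mul_X_le _
  rw [eq_C_of_degree_le_zero hr0, Polynomial.toLaurent_C] at hh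
  have hc : r.coeff 0 = 0 := by
    by_contra hc
    have h1 := L.mul_mem_left (LaurentPolynomial.C (r.coeff 0)⁻¹)
      (L.sub_mem hf (L.mul_mem_right h' hge))
    have h2 : LaurentPolynomial.C (r.coeff 0)⁻¹ * LaurentPolynomial.C (r.coeff 0) = 1 := by
      rw [← map_mul, inv_mul_cancel₀ hc, map_one]
    refine hF ?_
    convert h1 using 1
    linear_combination -F * h2 - LaurentPolynomial.C (r.coeff 0)⁻¹ * F * hh
  rw [hc, map_zero, sub_zero] at hh
  rw [hh, ← mul_assoc, mul_comm F]
  exact dvd_mul_right _ _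

/-- The ideal of the Laurent polynomials `f` with `X^m f(g) ∈ M`. -/
def compIdeal {M : Submodule K (QBorel K q)} (hM : IsCrossed M) (m : ℕ) : Ideal K[T;T⁻¹] where
  carrier := {f | X ^ m * lau f ∈ M}
  add_mem' h1 h2 := by
    rw [Set.mem_ofPred_eq, map_add, mul_add]
    exact M.add_mem h1 h2
  zero_mem' := by
    rw [Set.mem_ofPred_eq, map_zero, mul_zero]
    exact M.zero_mem
  smul_mem' h f hf := by
    rw [Set.mem_ofPred_eq, smul_eq_mul, mul_comm]
    exact X_pow_mul_lau_mul_mem hM hf h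

theorem mem_compIdeal {M : Submodule K (QBorel K q)} {hM : IsCrossed M} {m : ℕ} {f : K[T;T⁻¹]} :
    f ∈ compIdeal hM m ↔ X ^ m * lau f ∈ M := Iff.rfl

/-- If the `q`-integers are invertible, the ideals of a crossed submodule of finite codimension are
those of some `M_I`, from any degree on. The set `I` is found from the top, one element at a
time. -/
theorem exists_compIdeal_eq
    (hq : ∀ m : ℕ, ∑ j ∈ Finset.range (m + 1), ((q⁻¹ : Kˣ) : K) ^ j ≠ 0)
    {M : Submodule K (QBorel K q)} (hM : IsCrossed M) {N : ℕ} (hN : X ^ N ∈ M) (d : ℕ) :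
    ∀ m, m + d = N → ∃ I : Finset ℕ+, ∀ m', m ≤ m' → ∀ f : K[T;T⁻¹],
      f ∈ compIdeal hM m' ↔ toLaurent (idealPoly q I m') ∣ f := by
  induction d with
  | zero =>
    rintro m rfl
    refine ⟨∅, fun m' hm f => ⟨fun _ => ?_, fun _ => ?_⟩⟩
    · rw [idealPoly_eq_one q ∅ (by simp), map_one]
      exact one_dvd f
    · have h : (1 : K[T;T⁻¹]) ∈ compIdeal hM m' := by
        rw [mem_compIdeal, map_one, mul_one, ← Nat.sub_add_cancel hm, pow_add]
        exact hM.mul_mem _ _ hN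
      exact ((Ideal.eq_top_iff_one _).mpr h) ▸ Submodule.mem_top
  | succ d ih =>
    intro m hm
    obtain ⟨I, hI⟩ := ih (m + 1) (by omega)
    have hle : ∀ f : K[T;T⁻¹], f ∈ compIdeal hM m → toLaurent (idealPoly q I (m + 1)) ∣ f := by
      intro f hf
      rw [← hI (m + 1) le_rfl, mem_compIdeal, pow_succ', mul_assoc]
      exact hM.mul_mem _ _ hf
    have hge := X_pow_mul_one_sub_mem hq hM ((hI (m + 1) le_rfl _).mpr dvd_rfl)
    rw [← mem_compIdeal (hM := hM)] at hge
    -- a set `J` which agrees with `I` above `m + 1` will do if it does so in degree `m`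
    have red : ∀ J : Finset ℕ+, (∀ n : ℕ+, m + 1 < n → (n ∈ I ↔ n ∈ J)) →
        (∀ f : K[T;T⁻¹], f ∈ compIdeal hM m ↔ toLaurent (idealPoly q J m) ∣ f) →
        ∀ m', m ≤ m' → ∀ f : K[T;T⁻¹],
          f ∈ compIdeal hM m' ↔ toLaurent (idealPoly q J m') ∣ f := by
      intro J hJ h m' hm' f
      rcases Nat.eq_or_lt_of_le hm' with rfl | hlt
      · exact h f
      · rw [hI m' hlt, idealPoly_congr q fun n hn => hJ n (by omega)]
    have hne : ∀ n : ℕ+, m + 1 < n → n ≠ m.succPNat := by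
      rintro n hn rfl
      simp at hn
    by_cases hP : toLaurent (idealPoly q I (m + 1)) ∈ compIdeal hM m
    · have hJ : ∀ n : ℕ+, m + 1 < n → (n ∈ I ↔ n ∈ I.erase m.succPNat) := fun n hn => by
        simp [hne n hn]
      refine ⟨I.erase m.succPNat, red _ hJ fun f => ?_⟩
      rw [idealPoly_of_notMem q _ (by simp), ← idealPoly_congr q hJ]
      exact ⟨hle f, fun h => Ideal.mem_of_dvd _ h hP⟩
    · have hJ : ∀ n : ℕ+, m + 1 < n → (n ∈ I ↔ n ∈ insert m.succPNat I) := fun n hn => by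
        simp [hne n hn]
      refine ⟨insert m.succPNat I, red _ hJ fun f => ?_⟩
      rw [idealPoly_of_mem q _ (by simp), ← idealPoly_congr q hJ, map_mul]
      refine ⟨fun hf => ?_, fun h => Ideal.mem_of_dvd _ h hge⟩
      obtain ⟨h, rfl⟩ := hle f hf
      exact dvd_of_notMem hge hP hf

/-- Every crossed submodule of finite codimension is one of the left ideals `M_I`. -/
theorem exists_eq_crossedIdeal
    (hq : ∀ m : ℕ, ∑ j ∈ Finset.range (m + 1), ((q⁻¹ : Kˣ) : K) ^ j ≠ 0)
    {M : Submodule K (QBorel K q)} (hM : IsCrossed M)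
    [FiniteDimensional K (QBorel K q ⧸ M)] : ∃ I, M = crossedIdeal q I := by
  obtain ⟨N, hN⟩ := exists_X_pow_mem hM
  obtain ⟨I, hI⟩ := exists_compIdeal_eq hq hM hN N 0 (zero_add N)
  refine ⟨I, le_antisymm (fun a ha => ?_) fun a ha => ?_⟩
  · rw [mem_crossedIdeal]
    exact fun m => (hI m (Nat.zero_le m) _).mp (comp_mem hM ha m)
  · rw [mem_crossedIdeal] at ha
    exact mem_of_comp_mem fun m => (hI m (Nat.zero_le m) _).mpr (ha m)

theorem idealPoly_dvd_of_crossedIdeal_le {I J : Finset ℕ+}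
    (h : crossedIdeal q I ≤ crossedIdeal q J) (m : ℕ) : idealPoly q J m ∣ idealPoly q I m := by
  refine dvd_of_toLaurent_dvd (by rw [idealPoly_coeff_zero]; exact one_ne_zero) ?_
  exact (X_pow_mul_lau_mem_crossedIdeal (q := q) J (m := m)).mp
    (h ((X_pow_mul_lau_mem_crossedIdeal (q := q) I).mpr dvd_rfl))

theorem crossedIdeal_le_of_subset {I J : Finset ℕ+} (h : J ⊆ I) :
    crossedIdeal q I ≤ crossedIdeal q J := fun a ha => by
  rw [mem_crossedIdeal] at ha ⊢
  exact fun m => (_root_.map_dvd toLaurent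
    (Finset.prod_dvd_prod_of_subset _ _ _ (Finset.filter_subset_filter _ h))).trans (ha m)

theorem crossedIdeal_injective : Function.Injective (crossedIdeal q) := by
  intro I J h
  have hcard : ∀ m : ℕ, (I.filter (fun n : ℕ+ => m < (n : ℕ))).card =
      (J.filter (fun n : ℕ+ => m < (n : ℕ))).card := fun m => by
    rw [← natDegree_idealPoly q, ← natDegree_idealPoly q]
    exact le_antisymm
      (Polynomial.natDegree_le_of_dvd (idealPoly_dvd_of_crossedIdeal_le h.ge m)
        (idealPoly_ne_zero q J m))
      (Polynomial.natDegree_le_of_dvd (idealPoly_dvd_of_crossedIdeal_le h.le m)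
        (idealPoly_ne_zero q I m))
  have hdiff : ∀ (I : Finset ℕ+) (n : ℕ+),
      (I.filter (fun n' : ℕ+ => (n : ℕ) - 1 < (n' : ℕ))).card =
        (I.filter (fun n' : ℕ+ => (n : ℕ) < (n' : ℕ))).card + if n ∈ I then 1 else 0 := by
    intro I n
    have e : I.filter (fun n' : ℕ+ => (n : ℕ) - 1 < (n' : ℕ)) =
        I.filter (fun n' : ℕ+ => (n : ℕ) < (n' : ℕ)) ∪ I.filter (fun n' => n' = n) := by
      ext n'
      simp only [Finset.mem_filter, Finset.mem_union, ← and_or_left, ← PNat.coe_inj]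
      have := n.pos
      exact and_congr_right fun _ => by omega
    rw [e, Finset.card_union_of_disjoint, Finset.filter_eq']
    · split_ifs <;> simp
    · refine Finset.disjoint_filter.mpr fun n' _ h1 h2 => ?_
      rw [h2] at h1
      exact lt_irrefl _ h1
  ext n
  have h1 := hdiff I n
  rw [hcard, hcard, hdiff J n] at h1
  by_cases hI : n ∈ I <;> by_cases hJ : n ∈ J <;> simp_all

end QBorel

/-! ### Hopf pairings on generators and braided derivations -/

section HopfPairing

variable {k U A : Type*} [Field k] [Ring U] [HopfAlgebra k U] [Ring A] [HopfAlgebra k A]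
  {P : U →ₗ[k] A →ₗ[k] k}

/-- If `⟨x, ab⟩ = ⟨x₍₁₎, a⟩ ⟨x₍₂₎, b⟩`, the other axioms of a Hopf pairing can be checked on algebra
generators of `A`. -/
theorem IsHopfPairing.of_generators
    (hmul : ∀ x a b, P x (a * b) = sw k x fun x₁ x₂ => P x₁ a * P x₂ b)
    (hone : ∀ x, P x 1 = counit (R := k) x) {s : Set A} (hs : Algebra.adjoin k s = ⊤)
    (h1 : ∀ a ∈ s, ∀ x y, P (x * y) a = sw k a fun a₁ a₂ => P x a₁ * P y a₂)
    (h2 : ∀ a ∈ s, P 1 a = counit (R := k) a) : IsHopfPairing P where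
  mul_right := hmul
  one_right := hone
  one_left a := by
    have ha : a ∈ Algebra.adjoin k s := hs ▸ Algebra.mem_top
    induction ha using Algebra.adjoin_induction with
    | mem x hx => exact h2 x hx
    | algebraMap r => simp [Algebra.algebraMap_eq_smul_one, hone]
    | add x y _ _ hx hy => rw [map_add, map_add, hx, hy]
    | mul x y _ _ hx hy =>
      rw [hmul, sw_of_comul_eq (x := 1) (y := 1) (by constructor <;> intros <;> simp <;> ring)
        (by rw [Bialgebra.comul_one, Algebra.TensorProduct.one_def]), hx, hy, Bialgebra.counit_mul]
  mul_left x y a := by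
    have ha : a ∈ Algebra.adjoin k s := hs ▸ Algebra.mem_top
    induction ha using Algebra.adjoin_induction generalizing x y with
    | mem a ha => exact h1 a ha x y
    | algebraMap r =>
      rw [sw_of_comul_eq (x := algebraMap k A r) (y := 1)
        (by constructor <;> intros <;> simp <;> ring) (by
          rw [Bialgebra.comul_algebraMap, Algebra.TensorProduct.algebraMap_apply])]
      simp [Algebra.algebraMap_eq_smul_one, hone, mul_assoc]
    | add a b _ _ ha hb =>
      rw [map_add, ha, hb, sw_add_arg (by constructor <;> intros <;> simp <;> ring)]
    | mul a b _ _ ha hb =>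
      rw [hmul, sw_mul_arg (by constructor <;> intros <;> simp <;> ring),
        sw_mul_arg (by constructor <;> intros <;> simp <;> ring)]
      simp only [ha, hb, hmul]
      simp only [sw, Finset.sum_mul_sum]
      -- both sides are sums over the four coproducts
      rw [Finset.sum_congr rfl fun i _ => Finset.sum_comm, Finset.sum_comm]
      refine Finset.sum_congr rfl fun i _ => ?_
      rw [Finset.sum_congr rfl fun j _ => Finset.sum_comm, Finset.sum_comm]
      exact Finset.sum_congr rfl fun _ _ => Finset.sum_congr rfl fun _ _ =>
        Finset.sum_congr rfl fun _ _ => by ring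

theorem braidedDeriv_apply (x : U) (a : A) :
    braidedDeriv P x a = sw k a fun a₁ a₂ => P x a₁ • a₂ := by
  simp [braidedDeriv, comul_eq_sw, map_sw]

theorem braidedDeriv_add (x y : U) : braidedDeriv P (x + y) = braidedDeriv P x + braidedDeriv P y := by
  ext a
  simp [braidedDeriv, TensorProduct.map_add_left]

theorem braidedDeriv_smul (c : k) (x : U) : braidedDeriv P (c • x) = c • braidedDeriv P x := by
  ext a
  simp [braidedDeriv, TensorProduct.map_smul_left]

namespace IsHopfPairing

variable (hP : IsHopfPairing P)

include hP

theorem pair_mul (x y : U) (a : A) : P (x * y) a = P y (braidedDeriv P x a) := by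
  rw [hP.mul_left, braidedDeriv_apply, map_sw]
  simp

theorem braidedDeriv_one : braidedDeriv P 1 = LinearMap.id := by
  ext a
  rw [braidedDeriv_apply]
  simp only [hP.one_left]
  exact sw_counit_left (LinearMap.id (R := k)) a

theorem braidedDeriv_mul (x y : U) (a : A) :
    braidedDeriv P (x * y) a = braidedDeriv P y (braidedDeriv P x a) := by
  have hL : braidedDeriv P (x * y) a =
      sw k a fun w r => sw k w fun p q => (P x p * P y q) • r := by
    simp only [braidedDeriv_apply, hP.mul_left]
    simp only [sw, Finset.sum_smul]
  have hR : braidedDeriv P y (braidedDeriv P x a) =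
      sw k a fun p z => sw k z fun q r => (P x p * P y q) • r := by
    rw [braidedDeriv_apply x a, map_sw]
    simp only [map_smul, braidedDeriv_apply, sw, Finset.smul_sum, smul_smul]
  rw [hL, hR, sw_assoc (fun p q r => (P x p * P y q) • r)
    (by constructor <;> intros <;> simp [add_smul, mul_add, smul_smul, mul_left_comm,
      mul_comm])]

theorem braidedDeriv_pow (x : U) (n : ℕ) (a : A) :
    braidedDeriv P (x ^ n) a = (braidedDeriv P x)^[n] a := by
  induction n generalizing a with
  | zero => rw [pow_zero, hP.braidedDeriv_one]; rfl
  | succ n ih => rw [pow_succ', hP.braidedDeriv_mul, ih, Function.iterate_succ_apply]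

theorem braidedDeriv_apply_mul (x : U) (a b : A) : braidedDeriv P x (a * b) =
    sw k x fun x₁ x₂ => braidedDeriv P x₁ a * braidedDeriv P x₂ b := by
  rw [braidedDeriv_apply, sw_mul_arg (by constructor <;> intros <;> simp [add_smul, smul_smul, mul_comm])]
  simp only [braidedDeriv_apply, hP.mul_right]
  simp only [sw, Finset.sum_mul_sum, Finset.sum_smul, smul_mul_smul_comm]
  exact (Finset.sum_congr rfl fun i _ => Finset.sum_comm).trans Finset.sum_comm

theorem braidedDeriv_apply_one (x : U) : braidedDeriv P x 1 = algebraMap k A (counit x) := by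
  rw [braidedDeriv_apply, sw_of_comul_eq (x := 1) (y := 1)
    (by constructor <;> intros <;> simp [add_smul, smul_smul, mul_comm])
    (by rw [Bialgebra.comul_one, Algebra.TensorProduct.one_def]), hP.one_right,
    Algebra.algebraMap_eq_smul_one]

end IsHopfPairing

end HopfPairing

/-! ### The self-pairing of `B_q` -/

namespace QBorel

open scoped LaurentPolynomial
open LaurentPolynomial (T)

section Torus

variable {K : Type u} [Field K] {q : Kˣ} {U : Type*} [Ring U] [Algebra K U]
  {P : U →ₗ[K] QBorel K q →ₗ[K] K} {D : QBorel K q →ₗ[K] QBorel K q}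

/-- A `v`-derivation with `D X = 1` and `D g = 0` is the `v`-derivative with respect to `X`. -/
theorem derivation_X_pow_mul_lau {v : K} (hX : ∀ b, D (X * b) = b + v • (X * D b))
    (h0 : ∀ f, D (lau f) = 0) (m : ℕ) (f : K[T;T⁻¹]) :
    D (X ^ (m + 1) * lau f) = (∑ j ∈ Finset.range (m + 1), v ^ j) • (X ^ m * lau f) := by
  induction m with
  | zero => simp [hX, h0]
  | succ m ih =>
    rw [pow_succ', mul_assoc, hX, ih, mul_smul_comm, ← mul_assoc, ← pow_succ', smul_smul,
      Finset.sum_range_succ' _ (m + 1), add_smul, Finset.mul_sum]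
    simp [pow_succ', add_comm]

/-- If `x` acts on functions by a `v`-derivation `D` as above and `w` annihilates the left ideal
generated by `X`, then `⟨x^i w, ·⟩` only sees the component of degree `i`. -/
theorem pair_pow_mul {x w : U} {c : ℕ → K} (hx : ∀ w a, P (x * w) a = P w (D a))
    (hD : ∀ m f, D (X ^ (m + 1) * lau f) = c m • (X ^ m * lau f)) (h0 : ∀ f, D (lau f) = 0)
    (hw : ∀ b, P w (X * b) = 0) (i : ℕ) (a : QBorel K q) :
    P (x ^ i * w) a = (∏ j ∈ Finset.range i, c j) * P w (lau (comp a i)) := by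
  refine monomial_induction (p := fun a => P (x ^ i * w) a = (∏ j ∈ Finset.range i, c j) *
    P w (lau (comp a i))) (by simp) (fun a b ha hb => ?_) (fun m f => ?_) a
  · rw [map_add, ha, hb]
    simp only [map_add, Pi.add_apply, mul_add]
  · rw [comp_X_pow_mul_lau]
    induction i generalizing m with
    | zero =>
      cases m with
      | zero => simp
      | succ m => rw [pow_zero, one_mul, pow_succ', mul_assoc, hw]; simp
    | succ i ih =>
      rw [pow_succ', mul_assoc, hx]
      cases m with
      | zero => rw [pow_zero, one_mul, h0]; simp
      | succ m =>
        rw [hD, map_smul, ih, smul_eq_mul, Finset.prod_range_succ]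
        by_cases h : i = m
        · subst h
          rw [Pi.single_eq_same, Pi.single_eq_same]
          ring
        · rw [Pi.single_eq_of_ne h, Pi.single_eq_of_ne (by omega)]
          simp

end Torus

open WithConv

variable {K : Type u} [Field K] {q : Kˣ}

theorem pairing_apply (x a : QBorel K q) :
    pairing x a = (toDual (K := K) (q := q) a).ofConv x := rfl

theorem pairing_X (x : QBorel K q) : pairing x X = rep x 0 1 := by
  rw [pairing_apply, toDual, lift_X]; rfl

theorem pairing_g (x : QBorel K q) : pairing x g = char q⁻¹ x := by
  rw [pairing_apply, toDual, lift_g]; rfl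

theorem pairing_ginv (x : QBorel K q) : pairing x ginv = char q x := by
  rw [pairing_apply, toDual, lift_ginv]; rfl

theorem rep_diag (x : QBorel K q) :
    rep x 0 0 = char q⁻¹ x ∧ rep x 1 0 = 0 ∧ rep x 1 1 = counit (R := K) x := by
  have hx : x ∈ Algebra.adjoin K ({X, g, ginv} : Set (QBorel K q)) :=
    (adjoin_eq_top (K := K) (q := q)) ▸ Algebra.mem_top
  induction hx using Algebra.adjoin_induction with
  | mem x hx =>
    rcases hx with rfl | rfl | rfl <;> simp [rep, char, counit_X, counit_g, counit_ginv]
  | algebraMap r => simp [Matrix.algebraMap_eq_diagonal, Matrix.diagonal]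
  | add x y _ _ h1 h2 => simp [h1, h2]
  | mul x y _ _ h1 h2 => simp [Matrix.mul_apply, h1, h2]

theorem isHopfPairing_pairing : IsHopfPairing (pairing (K := K) (q := q)) := by
  have hone : ∀ x : QBorel K q, pairing x 1 = counit (R := K) x := fun x => by
    rw [pairing_apply, map_one]; rfl
  refine IsHopfPairing.of_generators (fun x a b => ?_) hone adjoin_eq_top ?_ ?_
  · rw [pairing_apply, map_mul, LinearMap.convMul_def]
    simp [comul_eq_sw, map_sw, pairing_apply]
  · rintro a (rfl | rfl | rfl) x y
    · rw [sw_of_comul_eq_add (by constructor <;> intros <;> simp <;> ring) comul_X, hone, pairing_X,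
        pairing_X, pairing_X, pairing_g, map_mul, Matrix.mul_apply, Fin.sum_univ_two,
        (rep_diag x).1, (rep_diag y).2.2]
      ring
    · rw [sw_of_comul_eq (by constructor <;> intros <;> simp <;> ring) comul_g, pairing_g,
        pairing_g, pairing_g, map_mul]
    · rw [sw_of_comul_eq (by constructor <;> intros <;> simp <;> ring) comul_ginv, pairing_ginv,
        pairing_ginv, pairing_ginv, map_mul]
  · rintro a (rfl | rfl | rfl)
    · simp [pairing_X, counit_X]
    · simp [pairing_g, counit_g]
    · simp [pairing_ginv, counit_ginv]

/-- `∂_x(a) = ⟨x, b⟩ c` if `Δ a = b ⊗ c`. -/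
theorem _root_.braidedDeriv_of_comul_eq {k U A : Type*} [Field k] [Ring U] [HopfAlgebra k U] [Ring A]
    [HopfAlgebra k A] {P : U →ₗ[k] A →ₗ[k] k} (x : U) {a b c : A}
    (h : comul (R := k) a = b ⊗ₜ c) : braidedDeriv P x a = P x b • c := by
  rw [braidedDeriv_apply,
    sw_of_comul_eq (by constructor <;> intros <;> simp [add_smul, smul_smul, mul_comm]) h]

theorem braidedDeriv_apply_X {U : Type*} [Ring U] [HopfAlgebra K U]
    {P : U →ₗ[K] QBorel K q →ₗ[K] K} (x : U) :
    braidedDeriv P x X = algebraMap K _ (P x X) + P x g • X := by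
  rw [braidedDeriv_apply, sw_of_comul_eq_add
    (by constructor <;> intros <;> simp [add_smul, smul_smul, mul_comm]) comul_X,
    Algebra.algebraMap_eq_smul_one]

theorem braidedDeriv_X_mul_left (a b : QBorel K q) : braidedDeriv pairing X (a * b) =
    braidedDeriv pairing X a * b + braidedDeriv pairing g a * braidedDeriv pairing X b := by
  rw [isHopfPairing_pairing.braidedDeriv_apply_mul, sw_of_comul_eq_add (by
      constructor <;> intros <;>
      simp [braidedDeriv_add, braidedDeriv_smul, add_mul, mul_add]) comul_X,
    isHopfPairing_pairing.braidedDeriv_one, LinearMap.id_apply]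

theorem braidedDeriv_g_X : braidedDeriv pairing g (X : QBorel K q) = ((q⁻¹ : Kˣ) : K) • X := by
  rw [braidedDeriv_apply_X, pairing_X, pairing_g]
  simp [rep, char]

theorem braidedDeriv_X_X_mul (b : QBorel K q) : braidedDeriv pairing X (X * b) =
    b + ((q⁻¹ : Kˣ) : K) • (X * braidedDeriv pairing X b) := by
  rw [braidedDeriv_X_mul_left, braidedDeriv_g_X, braidedDeriv_apply_X,
    pairing_X, pairing_g]
  simp [rep, char]

theorem braidedDeriv_X_lau (f : K[T;T⁻¹]) : braidedDeriv pairing X (lau f : QBorel K q) = 0 := by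
  induction f using LaurentPolynomial.induction_on with
  | h_C a =>
    rw [LaurentPolynomial.C_eq_algebraMap, AlgHom.commutes, Algebra.algebraMap_eq_smul_one, map_smul,
      isHopfPairing_pairing.braidedDeriv_apply_one, counit_X, map_zero, smul_zero]
  | h_add h1 h2 => rw [map_add, map_add, h1, h2, add_zero]
  | h_C_mul_T n a h =>
    rw [LaurentPolynomial.T_add, ← mul_assoc, mul_comm, map_mul, lau_T_one,
      braidedDeriv_X_mul_left, h, braidedDeriv_of_comul_eq X comul_g, pairing_g]
    simp [char]
  | h_C_mul_T_Z n a h =>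
    rw [sub_eq_add_neg, LaurentPolynomial.T_add, ← mul_assoc, mul_comm, map_mul, lau_T_neg_one,
      braidedDeriv_X_mul_left, h, braidedDeriv_of_comul_eq X comul_ginv, pairing_ginv]
    simp [char]

theorem comul_lau_T (n : ℤ) :
    comul (R := K) (lau (T n) : QBorel K q) = lau (T n) ⊗ₜ lau (T n) := by
  induction n using Int.induction_on with
  | zero => simp [Algebra.TensorProduct.one_def]
  | succ n h =>
    rw [LaurentPolynomial.T_add, map_mul, Bialgebra.comul_mul, h, lau_T_one, comul_g,
      Algebra.TensorProduct.tmul_mul_tmul]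
  | pred n h =>
    rw [sub_eq_add_neg, LaurentPolynomial.T_add, map_mul, Bialgebra.comul_mul, h, lau_T_neg_one,
      comul_ginv, Algebra.TensorProduct.tmul_mul_tmul]

theorem counit_lau_T (n : ℤ) : counit (R := K) (lau (T n) : QBorel K q) = 1 := by
  induction n using Int.induction_on with
  | zero => simp
  | succ n h =>
    rw [LaurentPolynomial.T_add, map_mul, Bialgebra.counit_mul, h, lau_T_one, counit_g, one_mul]
  | pred n h =>
    rw [sub_eq_add_neg, LaurentPolynomial.T_add, map_mul, Bialgebra.counit_mul, h, lau_T_neg_one,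
      counit_ginv, one_mul]

theorem pairing_lau_T_mul (n : ℤ) (a b : QBorel K q) :
    pairing (lau (T n) : QBorel K q) (a * b) = pairing (lau (T n)) a * pairing (lau (T n)) b := by
  rw [isHopfPairing_pairing.mul_right,
    sw_of_comul_eq (by constructor <;> intros <;> simp <;> ring) (comul_lau_T n)]

theorem pairing_lau_T_X (n : ℤ) : pairing (lau (T n) : QBorel K q) X = 0 := by
  rw [pairing_X]
  induction n using Int.induction_on with
  | zero => simp
  | succ n h =>
    rw [LaurentPolynomial.T_add, map_mul, lau_T_one, map_mul, Matrix.mul_apply, Fin.sum_univ_two, h]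
    simp [rep]
  | pred n h =>
    rw [sub_eq_add_neg, LaurentPolynomial.T_add, map_mul, lau_T_neg_one, map_mul, Matrix.mul_apply,
      Fin.sum_univ_two, h]
    simp [rep]

/-- The functional `⟨g^s, ·⟩` evaluates Laurent polynomials in `g` at `q^{-s}`. -/
theorem pairing_lau_T_lau (s : ℤ) (f : K[T;T⁻¹]) : pairing (lau (T s) : QBorel K q) (lau f) =
    LaurentPolynomial.eval₂ (RingHom.id K) (q ^ (-s)) f := by
  have hg : pairing (lau (T s) : QBorel K q) g = ((q ^ (-s) : Kˣ) : K) := by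
    rw [pairing_g]
    have h : Units.map (char (q⁻¹) : QBorel K q →ₐ[K] K).toMonoidHom gU = q⁻¹ :=
      Units.ext (by simp [char, coe_gU])
    have h1 := congrArg (fun t : Kˣ => ((t ^ s : Kˣ) : K)) h
    rw [← map_zpow, Units.coe_map, inv_zpow', ← lau_T] at h1
    exact h1
  have hi : pairing (lau (T s) : QBorel K q) ginv = ((q ^ (-s) : Kˣ)⁻¹ : K) := by
    have h := pairing_lau_T_mul s (g : QBorel K q) ginv
    rw [g_mul_ginv, isHopfPairing_pairing.one_right, counit_lau_T, hg] at h
    exact eq_inv_of_mul_eq_one_right h.symm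
  induction f using LaurentPolynomial.induction_on with
  | h_C a =>
    rw [LaurentPolynomial.eval₂_C, LaurentPolynomial.C_eq_algebraMap, AlgHom.commutes,
      Algebra.algebraMap_eq_smul_one, map_smul, isHopfPairing_pairing.one_right, counit_lau_T]
    simp
  | h_add h1 h2 => rw [map_add, map_add, map_add, h1, h2]
  | h_C_mul_T n a h =>
    rw [LaurentPolynomial.T_add, ← mul_assoc, mul_comm, map_mul lau, pairing_lau_T_mul,
      lau_T_one, h, hg,
      map_mul (LaurentPolynomial.eval₂ (RingHom.id K) (q ^ (-s))) (T 1), LaurentPolynomial.eval₂_T,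
      zpow_one]
  | h_C_mul_T_Z n a h =>
    rw [sub_eq_add_neg, LaurentPolynomial.T_add, ← mul_assoc, mul_comm, map_mul lau,
      pairing_lau_T_mul, lau_T_neg_one, h, hi,
      map_mul (LaurentPolynomial.eval₂ (RingHom.id K) (q ^ (-s))) (T (-1)),
      LaurentPolynomial.eval₂_T, zpow_neg_one, Units.val_inv_eq_inv_val]

end QBorel

/-! ### The self-pairing for generic `q` -/

namespace QBorel

open scoped LaurentPolynomial
open LaurentPolynomial (T)
open Polynomial (toLaurent)

variable {K : Type u} [Field K] {q : Kˣ}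

theorem pairing_lau_X_mul (h : K[T;T⁻¹]) (b : QBorel K q) : pairing (lau h) (X * b) = 0 := by
  induction h using LaurentPolynomial.induction_on' with
  | add f g hf hg => rw [map_add, map_add, LinearMap.add_apply, hf, hg, add_zero]
  | C_mul_T n c =>
    rw [← LaurentPolynomial.smul_eq_C_mul, map_smul, map_smul, LinearMap.smul_apply,
      pairing_lau_T_mul, pairing_lau_T_X, zero_mul, smul_zero]

theorem pairing_lau_lau_T (h : K[T;T⁻¹]) (l : ℤ) :
    pairing (lau h : QBorel K q) (lau (T l)) =
      LaurentPolynomial.eval₂ (RingHom.id K) (q ^ (-l)) h := by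
  induction h using LaurentPolynomial.induction_on' with
  | add f g hf hg => rw [map_add, map_add, LinearMap.add_apply, hf, hg, map_add]
  | C_mul_T n c =>
    rw [LaurentPolynomial.eval₂_C_mul_T, ← LaurentPolynomial.smul_eq_C_mul, map_smul, map_smul,
      LinearMap.smul_apply, pairing_lau_T_lau, LaurentPolynomial.eval₂_T, smul_eq_mul,
      RingHom.id_apply, ← zpow_mul, ← zpow_mul, neg_mul_comm, mul_comm n]

theorem pairing_X_pow_mul_lau (i : ℕ) (h : K[T;T⁻¹]) (a : QBorel K q) :
    pairing (X ^ i * lau h) a =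
      (∏ m ∈ Finset.range i, ∑ j ∈ Finset.range (m + 1), ((q⁻¹ : Kˣ) : K) ^ j) *
        pairing (lau h : QBorel K q) (lau (comp a i)) :=
  pair_pow_mul (fun w a => isHopfPairing_pairing.pair_mul X w a)
    (derivation_X_pow_mul_lau braidedDeriv_X_X_mul braidedDeriv_X_lau) braidedDeriv_X_lau
    (pairing_lau_X_mul h) i a

theorem zpow_injective_of_generic (hq : ∀ n : ℕ, n ≠ 0 → (q : K) ^ n ≠ 1) :
    Function.Injective fun n : ℤ => q ^ n := by
  rw [injective_zpow_iff_not_isOfFinOrder, isOfFinOrder_iff_pow_eq_one]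
  rintro ⟨n, hn, h⟩
  exact hq n hn.ne' (by rw [← Units.val_pow_eq_pow_val, h, Units.val_one])

theorem qint_ne_zero_of_generic (hq : ∀ n : ℕ, n ≠ 0 → (q : K) ^ n ≠ 1) (m : ℕ) :
    ∑ j ∈ Finset.range (m + 1), ((q⁻¹ : Kˣ) : K) ^ j ≠ 0 := fun h => by
  have h1 := geom_sum_mul ((q⁻¹ : Kˣ) : K) (m + 1)
  rw [h, zero_mul, eq_comm, sub_eq_zero, ← Units.val_pow_eq_pow_val, Units.val_eq_one, inv_pow,
    inv_eq_one] at h1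
  exact hq (m + 1) (Nat.succ_ne_zero m) (by rw [← Units.val_pow_eq_pow_val, h1, Units.val_one])

theorem laurent_eq_zero_of_generic (hq : ∀ n : ℕ, n ≠ 0 → (q : K) ^ n ≠ 1) {f : K[T;T⁻¹]}
    (hf : ∀ n : ℤ, LaurentPolynomial.eval₂ (RingHom.id K) (q ^ (-n)) f = 0) : f = 0 := by
  obtain ⟨N, p, hp⟩ := f.exists_T_pow
  have hp0 : p = 0 := by
    refine Polynomial.eq_zero_of_infinite_isRoot p (Set.Infinite.mono ?_
      (Set.infinite_range_of_injective
        (Units.val_injective.comp (zpow_injective_of_generic hq))))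
    rintro _ ⟨n, rfl⟩
    have h1 := congrArg (LaurentPolynomial.eval₂ (RingHom.id K) (q ^ n)) hp
    have h2 := hf (-n)
    rw [neg_neg] at h2
    rw [map_mul, h2, zero_mul, LaurentPolynomial.eval₂_toLaurent] at h1
    rw [Polynomial.eval₂_id] at h1
    exact h1
  rw [hp0, map_zero, eq_comm] at hp
  exact (LaurentPolynomial.isUnit_T (N : ℤ)).mul_left_eq_zero.mp hp

theorem pairing_left_nondegenerate (hq : ∀ n : ℕ, n ≠ 0 → (q : K) ^ n ≠ 1) (a : QBorel K q)
    (ha : ∀ x : QBorel K q, pairing x a = 0) : a = 0 := by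
  refine comp_injective (funext fun i => ?_)
  rw [map_zero, Pi.zero_apply]
  refine laurent_eq_zero_of_generic hq fun n => ?_
  have h := ha (X ^ i * lau (T n))
  rw [pairing_X_pow_mul_lau, pairing_lau_T_lau] at h
  exact (mul_eq_zero.mp h).resolve_left
    (Finset.prod_ne_zero_iff.mpr fun m _ => qint_ne_zero_of_generic hq m)

theorem pairing_right_nondegenerate (hq : ∀ n : ℕ, n ≠ 0 → (q : K) ^ n ≠ 1) (x : QBorel K q)
    (hx : ∀ a : QBorel K q, pairing x a = 0) : x = 0 := by
  obtain ⟨F, rfl⟩ := ofComp_surjective x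
  suffices h : F = 0 by rw [h, map_zero]
  ext1 m
  rw [Finsupp.zero_apply]
  refine laurent_eq_zero_of_generic hq fun l => ?_
  have h := hx (X ^ m * lau (T l))
  rw [ofComp, Finsupp.lsum_apply, Finsupp.sum, map_sum, LinearMap.sum_apply] at h
  have h1 : ∀ i, pairing (X ^ i * lau (F i) : QBorel K q) (X ^ m * lau (T l)) = if i = m then
      (∏ m ∈ Finset.range i, ∑ j ∈ Finset.range (m + 1), ((q⁻¹ : Kˣ) : K) ^ j) *
        LaurentPolynomial.eval₂ (RingHom.id K) (q ^ (-l)) (F i) else 0 := fun i => by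
    rw [pairing_X_pow_mul_lau, comp_X_pow_mul_lau]
    split_ifs with hi
    · rw [hi, Pi.single_eq_same, pairing_lau_lau_T]
    · rw [Pi.single_eq_of_ne hi, map_zero, map_zero, mul_zero]
  have h2 := (Finset.sum_congr rfl fun i _ => (h1 i).symm).trans h
  rw [Finset.sum_ite_eq' F.support m] at h2
  split_ifs at h2 with hm
  · exact (mul_eq_zero.mp h2).resolve_left
      (Finset.prod_ne_zero_iff.mpr fun m _ => qint_ne_zero_of_generic hq m)
  · rw [Finsupp.notMem_support_iff.mp hm, map_zero]

theorem eval_idealPoly_of_mem {I : Finset ℕ+} {n : ℕ+} (hn : n ∈ I) {m : ℕ} (hm : m < n) :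
    (idealPoly q I m).eval ((q ^ ((n : ℤ) - 1) : Kˣ) : K) = 0 := by
  rw [idealPoly, Polynomial.eval_prod]
  refine Finset.prod_eq_zero (Finset.mem_filter.mpr ⟨hn, hm⟩) ?_
  rw [Polynomial.eval_sub, Polynomial.eval_one, Polynomial.eval_mul, Polynomial.eval_C,
    Polynomial.eval_X, ← Units.val_mul, ← zpow_add]
  simp

theorem eval_one_idealPoly {I : Finset ℕ+} (h1 : 1 ∈ I) : (idealPoly q I 0).eval 1 = 0 := by
  have h := eval_idealPoly_of_mem (q := q) h1 (m := 0) (by simp)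
  simpa using h

/-- The elements `X^m g^{1-n}`, `n ∈ I`, `m < n`, of the annihilator of `M_I` show that `M_I` is
closed for the self-pairing and compute its codimension. -/
theorem crossedIdeal_closed_of_generic (hq : ∀ n : ℕ, n ≠ 0 → (q : K) ^ n ≠ 1) {I : Finset ℕ+}
    (hI : 1 ∈ I) :
    Module.finrank K (QBorel K q ⧸ crossedIdeal q I) = ∑ n ∈ I, (n : ℕ) ∧
      FiniteDimensional K (annKer pairing (crossedIdeal q I)) ∧
      Module.finrank K (annKer pairing (crossedIdeal q I)) + 1 = ∑ n ∈ I, (n : ℕ) ∧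
      annCounit pairing (annKer pairing (crossedIdeal q I)) = crossedIdeal q I := by
  obtain ⟨hfd, hle⟩ := finrank_quotient_crossedIdeal_le (q := q) I
  let x : (Σ n : I, Fin (n : ℕ+)) → QBorel K q := fun p =>
    X ^ (p.2 : ℕ) * lau (T (1 - ((p.1 : ℕ+) : ℤ)))
  have hcard : Fintype.card (Σ n : I, Fin (n : ℕ+)) = ∑ n ∈ I, (n : ℕ) := by
    rw [Fintype.card_sigma, ← Finset.sum_coe_sort I (fun n : ℕ+ => (n : ℕ))]
    simp
  have hx : LinearIndependent K x := by
    rw [linearIndependent_iff']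
    rintro s c hc ⟨n, m⟩ hp
    have h1 := congrArg (coeffFun (m : ℕ) (1 - ((n : ℕ+) : ℤ))) hc
    have h2 : ∀ p : Σ n : I, Fin (n : ℕ+), coeffFun (m : ℕ) (1 - ((n : ℕ+) : ℤ)) (x p) =
        if p = ⟨n, m⟩ then 1 else 0 := by
      rintro ⟨n', m'⟩
      rw [coeffFun_X_pow_mul_lau_T]
      refine if_congr ⟨fun h => ?_, fun h => ?_⟩ rfl rfl
      · have h3 : 1 - ((n' : ℕ+) : ℤ) = 1 - ((n : ℕ+) : ℤ) := h.2
        have hn' : n' = n := Subtype.ext (PNat.coe_inj.mp (by omega))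
        subst hn'
        rw [Fin.ext h.1]
      · obtain ⟨rfl, h⟩ := Sigma.mk.inj_iff.mp h
        rw [eq_of_heq h]
        exact ⟨rfl, rfl⟩
    rw [map_sum, map_zero, Finset.sum_congr rfl fun p _ => by rw [map_smul, h2]] at h1
    simpa [hp] using h1
  have h := isHopfPairing_pairing.closed_of_linearIndependent (pairing_right_nondegenerate hq)
    (M := crossedIdeal q I)
    (fun v hv => counit_eq_zero_of_mem_crossedIdeal I (eval_one_idealPoly hI) hv) hx ?_
    (hle.trans hcard.ge)
  · rwa [hcard] at h
  · rintro ⟨n, m⟩ v hv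
    rw [mem_crossedIdeal] at hv
    obtain ⟨f, hf⟩ := hv m
    rw [pairing_X_pow_mul_lau, pairing_lau_T_lau, hf, map_mul, LaurentPolynomial.eval₂_toLaurent,
      Polynomial.eval₂_id, neg_sub, eval_idealPoly_of_mem n.2 m.2, zero_mul, mul_zero]

end QBorel

/-! ### The pairing of `U(b₊)` with `C(B₊)` -/

namespace UB

open WithConv
open scoped LaurentPolynomial
open LaurentPolynomial (T)
open QBorel (lau comp)

variable {k : Type u} [Field k]

theorem comul_X : comul (R := k) (X : UB k) = X ⊗ₜ 1 + 1 ⊗ₜ X := by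
  rw [comul_eq, comulHom, lift_X]
theorem comul_H : comul (R := k) (H : UB k) = H ⊗ₜ 1 + 1 ⊗ₜ H := by
  rw [comul_eq, comulHom, lift_H]
theorem counit_X : counit (R := k) (X : UB k) = 0 := by
  rw [counit_eq, counitHom, lift_X]
theorem counit_H : counit (R := k) (H : UB k) = 0 := by
  rw [counit_eq, counitHom, lift_H]

theorem pairing_apply (x : UB k) (a : CB k) :
    pairing x a = (toDual (k := k) a).ofConv x := rfl

theorem pairing_X (x : UB k) : pairing x QBorel.X = rep x 0 1 := by
  rw [pairing_apply, toDual, QBorel.lift_X]; rfl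

theorem pairing_g (x : UB k) : pairing x QBorel.g = char 1 x := by
  rw [pairing_apply, toDual, QBorel.lift_g]; rfl

theorem pairing_ginv (x : UB k) : pairing x QBorel.ginv = char (-1) x := by
  rw [pairing_apply, toDual, QBorel.lift_ginv]; rfl

theorem rep_diag (x : UB k) :
    rep x 0 0 = char 1 x ∧ rep x 1 0 = 0 ∧ rep x 1 1 = counit (R := k) x := by
  have hx : x ∈ Algebra.adjoin k ({X, H} : Set (UB k)) :=
    (adjoin_eq_top (k := k)) ▸ Algebra.mem_top
  induction hx using Algebra.adjoin_induction with
  | mem x hx =>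
    rcases hx with rfl | rfl <;> simp [rep, char, counit_X, counit_H]
  | algebraMap r => simp [Matrix.algebraMap_eq_diagonal, Matrix.diagonal]
  | add x y _ _ h1 h2 => simp [h1, h2]
  | mul x y _ _ h1 h2 => simp [Matrix.mul_apply, h1, h2]

theorem isHopfPairing_pairing : IsHopfPairing (pairing (k := k)) := by
  have hone : ∀ x : UB k, pairing x 1 = counit (R := k) x := fun x => by
    rw [pairing_apply, map_one]; rfl
  refine IsHopfPairing.of_generators (fun x a b => ?_) hone QBorel.adjoin_eq_top ?_ ?_
  · rw [pairing_apply, map_mul, LinearMap.convMul_def]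
    simp [comul_eq_sw, map_sw, pairing_apply]
  · rintro a (rfl | rfl | rfl) x y
    · rw [sw_of_comul_eq_add (by constructor <;> intros <;> simp <;> ring) QBorel.comul_X, hone,
        pairing_X, pairing_X, pairing_X, pairing_g, map_mul, Matrix.mul_apply, Fin.sum_univ_two,
        (rep_diag x).1, (rep_diag y).2.2]
      ring
    · rw [sw_of_comul_eq (by constructor <;> intros <;> simp <;> ring) QBorel.comul_g, pairing_g,
        pairing_g, pairing_g, map_mul]
    · rw [sw_of_comul_eq (by constructor <;> intros <;> simp <;> ring) QBorel.comul_ginv,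
        pairing_ginv, pairing_ginv, pairing_ginv, map_mul]
  · rintro a (rfl | rfl | rfl)
    · simp [pairing_X, QBorel.counit_X]
    · simp [pairing_g, QBorel.counit_g]
    · simp [pairing_ginv, QBorel.counit_ginv]

/-- Primitive elements act by derivations. -/
theorem braidedDeriv_mul_of_primitive {x : UB k} (hx : comul (R := k) x = x ⊗ₜ 1 + 1 ⊗ₜ x)
    (a b : CB k) : braidedDeriv pairing x (a * b) =
      braidedDeriv pairing x a * b + a * braidedDeriv pairing x b := by
  rw [isHopfPairing_pairing.braidedDeriv_apply_mul, sw_of_comul_eq_add (by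
      constructor <;> intros <;>
      simp [braidedDeriv_add, braidedDeriv_smul, add_mul, mul_add]) hx,
    isHopfPairing_pairing.braidedDeriv_one, LinearMap.id_apply, LinearMap.id_apply]

theorem braidedDeriv_X_X : braidedDeriv pairing X (QBorel.X : CB k) = 1 := by
  rw [QBorel.braidedDeriv_apply_X, pairing_X, pairing_g]
  simp [rep, char]

theorem braidedDeriv_X_g : braidedDeriv pairing X (QBorel.g : CB k) = 0 := by
  rw [braidedDeriv_of_comul_eq X QBorel.comul_g, pairing_g]
  simp [char]

theorem braidedDeriv_X_ginv : braidedDeriv pairing X (QBorel.ginv : CB k) = 0 := by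
  rw [braidedDeriv_of_comul_eq X QBorel.comul_ginv, pairing_ginv]
  simp [char]

theorem braidedDeriv_H_X : braidedDeriv pairing H (QBorel.X : CB k) = QBorel.X := by
  rw [QBorel.braidedDeriv_apply_X, pairing_X, pairing_g]
  simp [rep, char]

theorem braidedDeriv_H_g : braidedDeriv pairing H (QBorel.g : CB k) = QBorel.g := by
  rw [braidedDeriv_of_comul_eq H QBorel.comul_g, pairing_g]
  simp [char]

theorem braidedDeriv_H_ginv : braidedDeriv pairing H (QBorel.ginv : CB k) = -QBorel.ginv := by
  rw [braidedDeriv_of_comul_eq H QBorel.comul_ginv, pairing_ginv]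
  simp [char]

theorem braidedDeriv_X_lau (f : k[T;T⁻¹]) : braidedDeriv pairing X (lau f : CB k) = 0 := by
  induction f using LaurentPolynomial.induction_on with
  | h_C a =>
    rw [LaurentPolynomial.C_eq_algebraMap, AlgHom.commutes, Algebra.algebraMap_eq_smul_one, map_smul,
      isHopfPairing_pairing.braidedDeriv_apply_one, counit_X, map_zero, smul_zero]
  | h_add h1 h2 => rw [map_add, map_add, h1, h2, add_zero]
  | h_C_mul_T n a h =>
    rw [LaurentPolynomial.T_add, ← mul_assoc, mul_comm, map_mul, QBorel.lau_T_one,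
      braidedDeriv_mul_of_primitive comul_X, h, braidedDeriv_X_g, zero_mul, mul_zero, add_zero]
  | h_C_mul_T_Z n a h =>
    rw [sub_eq_add_neg, LaurentPolynomial.T_add, ← mul_assoc, mul_comm, map_mul,
      QBorel.lau_T_neg_one, braidedDeriv_mul_of_primitive comul_X, h, braidedDeriv_X_ginv, zero_mul,
      mul_zero, add_zero]

theorem braidedDeriv_H_lau_T (l : ℤ) :
    braidedDeriv pairing H (lau (T l) : CB k) = (l : k) • lau (T l) := by
  induction l using Int.induction_on with
  | zero =>
    rw [LaurentPolynomial.T_zero, map_one, isHopfPairing_pairing.braidedDeriv_apply_one, counit_H]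
    simp
  | succ n h =>
    rw [LaurentPolynomial.T_add, map_mul, braidedDeriv_mul_of_primitive comul_H, h, QBorel.lau_T_one,
      braidedDeriv_H_g, smul_mul_assoc]
    push_cast
    rw [add_smul, one_smul]
  | pred n h =>
    rw [sub_eq_add_neg, LaurentPolynomial.T_add, map_mul, braidedDeriv_mul_of_primitive comul_H, h,
      QBorel.lau_T_neg_one, braidedDeriv_H_ginv, smul_mul_assoc, mul_neg, Int.cast_add, add_smul,
      Int.cast_neg 1, Int.cast_one, neg_one_smul]

theorem pairing_H_pow_X_mul (j : ℕ) (b : CB k) : pairing (H ^ j) (QBorel.X * b) = 0 := by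
  induction j generalizing b with
  | zero =>
    rw [pow_zero, isHopfPairing_pairing.one_left, Bialgebra.counit_mul, QBorel.counit_X, zero_mul]
  | succ j ih =>
    rw [pow_succ', isHopfPairing_pairing.pair_mul, braidedDeriv_mul_of_primitive comul_H, map_add,
      braidedDeriv_H_X, ih, ih, add_zero]

theorem pairing_H_pow_lau_T (j : ℕ) (l : ℤ) : pairing (H ^ j) (lau (T l) : CB k) = (l : k) ^ j := by
  induction j with
  | zero =>
    rw [pow_zero, pow_zero, isHopfPairing_pairing.one_left, QBorel.counit_lau_T]
  | succ j ih =>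
    rw [pow_succ', isHopfPairing_pairing.pair_mul, braidedDeriv_H_lau_T, map_smul, ih, smul_eq_mul,
      pow_succ']

theorem pairing_aeval_H_X_mul (h : Polynomial k) (b : CB k) :
    pairing (Polynomial.aeval H h) (QBorel.X * b) = 0 := by
  rw [Polynomial.aeval_eq_sum_range, map_sum, LinearMap.sum_apply]
  exact Finset.sum_eq_zero fun j _ => by
    rw [map_smul, LinearMap.smul_apply, pairing_H_pow_X_mul, smul_zero]

/-- The functional `⟨h(H), ·⟩` sends `g^l` to `h(l)`. -/
theorem pairing_aeval_H_lau_T (h : Polynomial k) (l : ℤ) :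
    pairing (Polynomial.aeval H h) (lau (T l) : CB k) = h.eval (l : k) := by
  rw [Polynomial.aeval_eq_sum_range, map_sum, LinearMap.sum_apply, Polynomial.eval_eq_sum_range]
  exact Finset.sum_congr rfl fun j _ => by
    rw [map_smul, LinearMap.smul_apply, pairing_H_pow_lau_T, smul_eq_mul]

theorem pairing_X_pow_mul_aeval (i : ℕ) (h : Polynomial k) (a : CB k) :
    pairing (X ^ i * Polynomial.aeval H h) a =
      (i.factorial : k) * pairing (Polynomial.aeval H h) (lau (comp a i) : CB k) := by
  have h1 : ∀ b : CB k, braidedDeriv pairing X (QBorel.X * b) =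
      b + (1 : k) • (QBorel.X * braidedDeriv pairing X b) := fun b => by
    rw [braidedDeriv_mul_of_primitive comul_X, braidedDeriv_X_X, one_mul, one_smul]
  rw [QBorel.pair_pow_mul (fun w a => isHopfPairing_pairing.pair_mul X w a)
    (QBorel.derivation_X_pow_mul_lau h1 braidedDeriv_X_lau) braidedDeriv_X_lau
    (pairing_aeval_H_X_mul h) i a, ← Finset.prod_range_add_one_eq_factorial]
  congr 1
  push_cast
  exact Finset.prod_congr rfl fun m _ => by simp

/-- The linear map `∑ p_i ↦ ∑ X^i p_i(H)`. -/
def ofPoly : (ℕ →₀ Polynomial k) →ₗ[k] UB k :=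
  Finsupp.lsum k fun i => LinearMap.mulLeft k (X ^ i) ∘ₗ (Polynomial.aeval (R := k) H).toLinearMap

theorem ofPoly_single (i : ℕ) (h : Polynomial k) :
    (ofPoly (Finsupp.single i h) : UB k) = X ^ i * Polynomial.aeval H h := by
  simp [ofPoly]

theorem H_mul_X_pow (i : ℕ) : (H * X ^ i : UB k) = X ^ i * (H + (i : UB k)) := by
  induction i with
  | zero => simp
  | succ i ih =>
    rw [pow_succ, ← mul_assoc, ih, mul_assoc, add_mul, H_mul_X, (Nat.cast_commute i X).eq, mul_assoc]
    push_cast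
    noncomm_ring

theorem ofPoly_surjective : Function.Surjective (ofPoly (k := k)) := by
  intro x
  suffices h : ∀ s ∈ LinearMap.range (ofPoly (k := k)), x * s ∈ LinearMap.range (ofPoly (k := k)) by
    have h1 := h 1 ⟨Finsupp.single 0 1, by simp [ofPoly_single]⟩
    rwa [mul_one] at h1
  have key : ∀ b : UB k, (∀ m f, b * (X ^ m * Polynomial.aeval (R := k) H f) ∈
      LinearMap.range (ofPoly (k := k))) → ∀ s ∈ LinearMap.range (ofPoly (k := k)),
      b * s ∈ LinearMap.range (ofPoly (k := k)) := by
    rintro b hb _ ⟨F, rfl⟩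
    induction F using Finsupp.induction_linear with
    | zero => simp
    | add F G h1 h2 => rw [map_add, mul_add]; exact Submodule.add_mem _ h1 h2
    | single m f => rw [ofPoly_single]; exact hb m f
  have hx : x ∈ Algebra.adjoin k ({X, H} : Set (UB k)) :=
    (adjoin_eq_top (k := k)) ▸ Algebra.mem_top
  induction hx using Algebra.adjoin_induction with
  | mem x hx =>
    rcases hx with rfl | rfl
    · exact key _ fun m f => ⟨Finsupp.single (m + 1) f, by rw [ofPoly_single, pow_succ', mul_assoc]⟩
    · refine key _ fun m f => ⟨Finsupp.single m ((Polynomial.X + Polynomial.C (m : k)) * f), ?_⟩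
      rw [ofPoly_single, ← mul_assoc, H_mul_X_pow, map_mul, mul_assoc]
      simp
  | algebraMap r =>
    intro s hs
    rw [← Algebra.smul_def]
    exact Submodule.smul_mem _ r hs
  | add x y _ _ h1 h2 => intro s hs; rw [add_mul]; exact Submodule.add_mem _ (h1 s hs) (h2 s hs)
  | mul x y _ _ h1 h2 => intro s hs; rw [mul_assoc]; exact h1 _ (h2 s hs)

theorem pairing_ofPoly (F : ℕ →₀ Polynomial k) (m : ℕ) (l : ℤ) :
    pairing (ofPoly F) (QBorel.X ^ m * lau (T l) : CB k) =
      (m.factorial : k) * (F m).eval (l : k) := by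
  induction F using Finsupp.induction_linear with
  | zero => simp
  | add F G h1 h2 =>
    rw [map_add, map_add, LinearMap.add_apply, h1, h2, Finsupp.add_apply, Polynomial.eval_add, mul_add]
  | single i h =>
    rw [ofPoly_single, pairing_X_pow_mul_aeval, QBorel.comp_X_pow_mul_lau]
    by_cases hi : i = m
    · subst hi
      rw [Pi.single_eq_same, Finsupp.single_eq_same, pairing_aeval_H_lau_T]
    · rw [Pi.single_eq_of_ne hi, Finsupp.single_eq_of_ne (Ne.symm hi)]
      simp

section CharZero

variable [CharZero k]

theorem infinite_range_intCast : (Set.range fun l : ℤ => (l : k)).Infinite :=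
  Set.infinite_range_of_injective Int.cast_injective

theorem eq_zero_of_pairing_ofPoly {F : ℕ →₀ Polynomial k}
    (h : ∀ a : CB k, pairing (ofPoly F) a = 0) : F = 0 := by
  ext1 m
  refine Polynomial.eq_zero_of_infinite_isRoot _ (infinite_range_intCast.mono ?_)
  rintro _ ⟨l, rfl⟩
  have h1 := h (QBorel.X ^ m * lau (T l))
  rw [pairing_ofPoly] at h1
  exact (mul_eq_zero.mp h1).resolve_left (Nat.cast_ne_zero.mpr m.factorial_ne_zero)

theorem pairing_right_nondegenerate (x : UB k) (hx : ∀ a : CB k, pairing x a = 0) : x = 0 := by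
  obtain ⟨F, rfl⟩ := ofPoly_surjective x
  rw [eq_zero_of_pairing_ofPoly hx, map_zero]

theorem pairing_left_nondegenerate (a : CB k) (ha : ∀ x : UB k, pairing x a = 0) : a = 0 := by
  refine QBorel.comp_injective (funext fun i => ?_)
  rw [map_zero, Pi.zero_apply]
  have h1 : ∀ h : Polynomial k, pairing (Polynomial.aeval H h) (lau (comp a i) : CB k) = 0 := by
    intro h
    have h2 := ha (X ^ i * Polynomial.aeval H h)
    rw [pairing_X_pow_mul_aeval] at h2
    exact (mul_eq_zero.mp h2).resolve_left (Nat.cast_ne_zero.mpr i.factorial_ne_zero)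
  generalize comp a i = f at h1
  have h2 : ∀ (h : Polynomial k) (f : k[T;T⁻¹]), pairing (Polynomial.aeval H h) (lau f : CB k) =
      f.coeff.sum fun l c => c * h.eval (l : k) := fun h f => by
    induction f using LaurentPolynomial.induction_on' with
    | add f g hf hg =>
      rw [map_add, map_add, hf, hg, AddMonoidAlgebra.coeff_add, Finsupp.sum_add_index'] <;>
      simp [add_mul]
    | C_mul_T n c =>
      rw [← LaurentPolynomial.single_eq_C_mul_T, AddMonoidAlgebra.coeff_single,
        Finsupp.sum_single_index (by simp), LaurentPolynomial.single_eq_C_mul_T,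
        ← LaurentPolynomial.smul_eq_C_mul, map_smul, map_smul, pairing_aeval_H_lau_T, smul_eq_mul]
  refine LaurentPolynomial.ext fun l => ?_
  -- a polynomial which vanishes at all exponents of `f` except at `l`
  have h3 := h1 (∏ l' ∈ f.coeff.support.erase l, (Polynomial.X - Polynomial.C (l' : k)))
  rw [h2, Finsupp.sum, Finset.sum_eq_single l] at h3
  · refine (mul_eq_zero.mp h3).resolve_right ?_
    rw [Polynomial.eval_prod]
    refine Finset.prod_ne_zero_iff.mpr fun l' hl' => ?_
    rw [Polynomial.eval_sub, Polynomial.eval_X, Polynomial.eval_C, sub_ne_zero, Ne, Int.cast_inj]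
    exact fun h => (Finset.mem_erase.mp hl').1 h.symm
  · intro l' hl' hne
    rw [Polynomial.eval_prod, Finset.prod_eq_zero (Finset.mem_erase.mpr ⟨hne, hl'⟩), mul_zero]
    simp
  · intro hl
    rw [Finsupp.notMem_support_iff.mp hl, zero_mul]

end CharZero

theorem pairing_aeval_H_one_sub_T_mul (h : Polynomial k) (f : k[T;T⁻¹]) :
    pairing (Polynomial.aeval H h) (lau ((1 - T 1) * f) : CB k) =
      pairing (Polynomial.aeval H (h - Polynomial.taylor 1 h)) (lau f : CB k) := by
  induction f using LaurentPolynomial.induction_on' with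
  | add f g hf hg => rw [mul_add, map_add, map_add, hf, hg, map_add, map_add]
  | C_mul_T n c =>
    have e : (1 - T 1) * (LaurentPolynomial.C c * T n : k[T;T⁻¹]) = c • T n - c • T (n + 1) := by
      rw [LaurentPolynomial.smul_eq_C_mul, LaurentPolynomial.smul_eq_C_mul, LaurentPolynomial.T_add]
      ring
    rw [e, ← LaurentPolynomial.smul_eq_C_mul]
    simp only [map_sub, map_smul, LinearMap.sub_apply, pairing_aeval_H_lau_T,
      Polynomial.taylor_eval, smul_eq_mul]
    push_cast
    ring

/-- `⟨h(H), ·⟩` annihilates the multiples of `(1 - g)^d` if `deg h < d`. -/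
theorem pairing_aeval_H_eq_zero {d : ℕ} {h : Polynomial k} (hd : h.degree < d) (f : k[T;T⁻¹]) :
    pairing (Polynomial.aeval H h) (lau ((1 - T 1) ^ d * f) : CB k) = 0 := by
  induction d generalizing h with
  | zero =>
    have h0 : h = 0 := Polynomial.degree_eq_bot.mp (Nat.WithBot.lt_zero_iff.mp hd)
    rw [h0, map_zero, map_zero, LinearMap.zero_apply]
  | succ d ih =>
    rw [pow_succ', mul_assoc, pairing_aeval_H_one_sub_T_mul]
    by_cases h0 : h = 0
    · rw [h0, map_zero, sub_zero, map_zero, map_zero, LinearMap.zero_apply]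
    · refine ih ((Polynomial.degree_sub_lt_left (Polynomial.degree_taylor h 1).symm h0
        (Polynomial.leadingCoeff_taylor 1 h).symm).trans_le ?_)
      exact Order.le_of_lt_succ (by exact_mod_cast hd)

theorem idealPoly_one (I : Finset ℕ+) (m : ℕ) : idealPoly (1 : kˣ) I m =
    (1 - Polynomial.X) ^ (I.filter (fun n : ℕ+ => m < (n : ℕ))).card := by
  rw [idealPoly]
  simp

theorem eval_one_idealPoly {I : Finset ℕ+} (hI : I.Nonempty) :
    (idealPoly (1 : kˣ) I 0).eval 1 = 0 := by
  have h : I.filter (fun n : ℕ+ => 0 < (n : ℕ)) = I :=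
    Finset.filter_true_of_mem fun n _ => n.pos
  rw [idealPoly_one, h, Polynomial.eval_pow, Polynomial.eval_sub, Polynomial.eval_one,
    Polynomial.eval_X, sub_self, zero_pow hI.card_pos.ne']

/-- The functionals `⟨X^m h(H), ·⟩` with `deg h < #{n ∈ I, n > m}` annihilate `M_I`. -/
theorem pairing_crossedIdeal_eq_zero {I : Finset ℕ+} {m : ℕ} {h : Polynomial k}
    (hd : h.degree < (I.filter (fun n : ℕ+ => m < (n : ℕ))).card) {v : CB k}
    (hv : v ∈ crossedIdeal (1 : kˣ) I) : pairing (X ^ m * Polynomial.aeval H h) v = 0 := by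
  rw [QBorel.mem_crossedIdeal] at hv
  obtain ⟨f, hf⟩ := hv m
  rw [idealPoly_one, map_pow, map_sub, map_one, Polynomial.toLaurent_X] at hf
  rw [pairing_X_pow_mul_aeval, hf, pairing_aeval_H_eq_zero hd, mul_zero]

/-- The elements `X^m H^j`, `j < #{n ∈ I, n > m}`, of the annihilator of `M_I` show that `M_I` is
closed for the pairing with `U(b₊)` and compute its codimension. -/
theorem crossedIdeal_closed [CharZero k] {I : Finset ℕ+} (hI : I.Nonempty) :
    Module.finrank k (CB k ⧸ crossedIdeal (1 : kˣ) I) = ∑ n ∈ I, (n : ℕ) ∧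
      FiniteDimensional k (annKer pairing (crossedIdeal (1 : kˣ) I)) ∧
      Module.finrank k (annKer pairing (crossedIdeal (1 : kˣ) I)) + 1 = ∑ n ∈ I, (n : ℕ) ∧
      annCounit pairing (annKer pairing (crossedIdeal (1 : kˣ) I)) = crossedIdeal (1 : kˣ) I := by
  obtain ⟨hfd, hle⟩ := QBorel.finrank_quotient_crossedIdeal_le (q := (1 : kˣ)) I
  obtain ⟨N, hN⟩ := QBorel.exists_bound I
  let d : ℕ → ℕ := fun m => (I.filter (fun n : ℕ+ => m < (n : ℕ))).card
  let x : (Σ m : Fin N, Fin (d m)) → UB k := fun p =>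
    X ^ (p.1 : ℕ) * Polynomial.aeval H (Polynomial.X ^ (p.2 : ℕ) : Polynomial k)
  have hcard : Fintype.card (Σ m : Fin N, Fin (d m)) = ∑ n ∈ I, (n : ℕ) := by
    rw [Fintype.card_sigma, ← QBorel.sum_card_filter_lt I hN, Finset.sum_range]
    simp [d]
  have hx : LinearIndependent k x := by
    have h1 : LinearIndependent k fun p : Σ m : ℕ, Fin (d m) =>
        Finsupp.single p.1 (Polynomial.X ^ (p.2 : ℕ) : Polynomial k) := by
      refine Finsupp.linearIndependent_single (f := fun m (j : Fin (d m)) =>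
        (Polynomial.X ^ (j : ℕ) : Polynomial k)) fun m => ?_
      have h2 := (Polynomial.basisMonomials k).linearIndependent.comp _
        (Fin.val_injective (n := d m))
      simpa [Function.comp_def, Polynomial.coe_basisMonomials, ← Polynomial.X_pow_eq_monomial]
        using h2
    have h2 := (h1.map' ofPoly (LinearMap.ker_eq_bot'.mpr fun F hF =>
      eq_zero_of_pairing_ofPoly fun a => by rw [hF, map_zero, LinearMap.zero_apply])).comp
      (fun p : Σ m : Fin N, Fin (d m) => (⟨p.1, p.2⟩ : Σ m : ℕ, Fin (d m))) (by
        rintro ⟨m, j⟩ ⟨m', j'⟩ h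
        obtain ⟨h3, h4⟩ := Sigma.mk.inj_iff.mp h
        exact Sigma.ext (Fin.ext h3) h4)
    have e : x = fun p => ofPoly (Finsupp.single (p.1 : ℕ) (Polynomial.X ^ (p.2 : ℕ))) :=
      funext fun p => (ofPoly_single _ _).symm
    rw [e]
    exact h2
  have h := isHopfPairing_pairing.closed_of_linearIndependent pairing_right_nondegenerate
    (M := crossedIdeal (1 : kˣ) I)
    (fun v hv => QBorel.counit_eq_zero_of_mem_crossedIdeal I (eval_one_idealPoly hI) hv) hx ?_
    (hle.trans hcard.ge)
  · rwa [hcard] at h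
  · rintro ⟨m, j⟩ v hv
    refine pairing_crossedIdeal_eq_zero ?_ hv
    rw [Polynomial.degree_X_pow]
    exact_mod_cast j.2

end UB

/-! ### The classification for `q = 1` and for generic `q` -/

namespace QBorel

variable {K : Type u} [Field K] {q : Kˣ}

theorem eval_one_idealPoly_of_isCrossed {I : Finset ℕ+} (h : IsCrossed (crossedIdeal q I)) :
    (idealPoly q I 0).eval 1 = 0 := by
  rw [← counit_lau_toLaurent (q := q)]
  refine h.counit_eq _ ?_
  have h1 := (X_pow_mul_lau_mem_crossedIdeal (q := q) I (m := 0)).mpr dvd_rfl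
  rwa [pow_zero, one_mul] at h1

theorem exists_zpow_eq_of_eval_idealPoly {I : Finset ℕ+} {m : ℕ} {n : ℤ}
    (h : (idealPoly q I m).eval ((q ^ (n - 1) : Kˣ) : K) = 0) :
    ∃ n' ∈ I, q ^ (n : ℤ) = q ^ ((n' : ℕ) : ℤ) := by
  rw [idealPoly, Polynomial.eval_prod, Finset.prod_eq_zero_iff] at h
  obtain ⟨n', hn', h⟩ := h
  refine ⟨n', (Finset.mem_filter.mp hn').1, ?_⟩
  rw [Polynomial.eval_sub, Polynomial.eval_one, Polynomial.eval_mul, Polynomial.eval_C,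
    Polynomial.eval_X, ← Units.val_mul, ← zpow_add, sub_eq_zero, eq_comm, Units.val_eq_one] at h
  rw [← mul_inv_eq_one, ← zpow_neg, ← zpow_add, ← h]
  congr 1
  ring

section Generic

variable (hq : ∀ n : ℕ, n ≠ 0 → (q : K) ^ n ≠ 1)

include hq

/-- For generic `q`, the crossed submodules of finite codimension are the `M_I` with `1 ∈ I`. -/
theorem exists_eq_crossedIdeal_of_generic {M : Submodule K (QBorel K q)} (hM : IsCrossed M)
    (hfd : FiniteDimensional K (QBorel K q ⧸ M)) :
    ∃ I : {I : Finset ℕ+ // 1 ∈ I}, M = crossedIdeal q I.1 := by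
  obtain ⟨I, rfl⟩ := exists_eq_crossedIdeal (qint_ne_zero_of_generic hq) hM
  have h := eval_one_idealPoly_of_isCrossed hM
  obtain ⟨n, hn, h1⟩ := exists_zpow_eq_of_eval_idealPoly (q := q) (n := 1) (by simpa using h)
  have h2 := zpow_injective_of_generic hq h1
  have h3 : n = 1 := PNat.coe_inj.mp (by exact_mod_cast h2.symm)
  exact ⟨⟨I, h3 ▸ hn⟩, rfl⟩

theorem subset_of_crossedIdeal_le {I J : Finset ℕ+} (h : crossedIdeal q I ≤ crossedIdeal q J) :
    J ⊆ I := by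
  intro n hn
  have h1 := eval_idealPoly_of_mem (q := q) hn (m := 0) n.pos
  obtain ⟨p, hp⟩ := idealPoly_dvd_of_crossedIdeal_le h 0
  obtain ⟨n', hn', h2⟩ := exists_zpow_eq_of_eval_idealPoly (q := q) (I := I) (m := 0) (n := n)
    (by rw [hp, Polynomial.eval_mul, h1, zero_mul])
  have h3 : n = n' := PNat.coe_inj.mp (by exact_mod_cast zpow_injective_of_generic hq h2)
  exact h3 ▸ hn'

theorem dim_add_one_of_generic {I : Finset ℕ+} (hI : 1 ∈ I) {Γ : BicovCalculus K (QBorel K q)}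
    (h : Γ.FinDim) (hΓ : Γ.crossed = crossedIdeal q I) : Γ.dim + 1 = ∑ n ∈ I, (n : ℕ) := by
  rw [Γ.dim_add_one h, hΓ, (crossedIdeal_closed_of_generic hq hI).1]

/-- For generic `q`, the coirreducible calculus of dimension `n ≥ 2` is the one of `{1, n}`. -/
theorem coirreducible_iff {n : ℕ+} (hn : 2 ≤ n) {Γ : BicovCalculus K (QBorel K q)} (h : Γ.FinDim) :
    (Γ.Coirreducible ∧ Γ.dim = n) ↔ Γ.crossed = crossedIdeal q {1, n} := by
  have hsum : ∀ m : ℕ+, m ≠ 1 → ∑ i ∈ ({1, m} : Finset ℕ+), (i : ℕ) = m + 1 := fun m hm => by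
    rw [Finset.sum_pair (Ne.symm hm), PNat.one_coe, add_comm]
  have hn1 : n ≠ 1 := by
    rintro rfl
    exact absurd hn (by decide)
  constructor
  · rintro ⟨⟨-, hco⟩, hdim⟩
    obtain ⟨⟨I, hI⟩, hΓ⟩ := exists_eq_crossedIdeal_of_generic hq Γ.isCrossed_crossed
      (Γ.finDim_iff.mp h)
    change Γ.crossed = crossedIdeal q I at hΓ
    have hd := dim_add_one_of_generic hq hI h hΓ
    -- an element `m ≠ 1` of `I` gives the nonzero quotient of `{1, m}`
    obtain ⟨m, hm, hm1⟩ : ∃ m ∈ I, m ≠ 1 := by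
      by_contra! hall
      have : I = {1} := Finset.eq_singleton_iff_unique_mem.mpr ⟨hI, hall⟩
      rw [this, Finset.sum_singleton, hdim, PNat.one_coe] at hd
      have := n.pos
      omega
    have hJ : ({1, m} : Finset ℕ+) ⊆ I := by
      intro i hi
      rcases Finset.mem_insert.mp hi with rfl | hi
      · exact hI
      · rwa [Finset.mem_singleton.mp hi]
    have hcr := isCrossed_crossedIdeal (q := q) {1, m}
      (eval_one_idealPoly (Finset.mem_insert_self 1 {m}))
    have hfd : hcr.calculus.FinDim := by
      rw [BicovCalculus.finDim_iff, hcr.crossed_calculus]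
      exact (finrank_quotient_crossedIdeal_le (q := q) {1, m}).1
    have hd' := dim_add_one_of_generic hq (Finset.mem_insert_self 1 {m}) hfd hcr.crossed_calculus
    rw [hsum m hm1] at hd'
    have hquot : BicovCalculus.IsQuotient Γ hcr.calculus := by
      rw [BicovCalculus.isQuotient_iff, hcr.crossed_calculus, hΓ]
      exact crossedIdeal_le_of_subset hJ
    rcases hco _ hquot with hs | hiso
    · rw [BicovCalculus.subsingleton_iff hfd] at hs
      have := m.pos
      omega
    · rw [BicovCalculus.iso_iff, hcr.crossed_calculus] at hiso
      rw [hiso]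
      rw [crossedIdeal_injective (hΓ.symm.trans hiso), hsum m hm1, hdim] at hd
      have hmn : m = n := PNat.coe_inj.mp (by omega)
      rw [hmn]
  · intro hΓ
    have hd := dim_add_one_of_generic hq (Finset.mem_insert_self 1 {n}) h hΓ
    rw [hsum n hn1] at hd
    refine ⟨⟨?_, fun Γ' hquot => ?_⟩, by omega⟩
    · rw [← not_subsingleton_iff_nontrivial, BicovCalculus.subsingleton_iff h]
      have := n.pos
      omega
    · rw [BicovCalculus.isQuotient_iff] at hquot
      have hfd' : FiniteDimensional K (QBorel K q ⧸ Γ'.crossed) := by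
        have := Γ.finDim_iff.mp h
        exact Module.Finite.of_surjective (Submodule.factor hquot) (Submodule.factor_surjective hquot)
      obtain ⟨⟨J, hJ⟩, hΓ'⟩ := exists_eq_crossedIdeal_of_generic hq Γ'.isCrossed_crossed hfd'
      change Γ'.crossed = crossedIdeal q J at hΓ'
      have hsub : J ⊆ {1, n} := subset_of_crossedIdeal_le hq (by rwa [← hΓ, ← hΓ'])
      by_cases hnJ : n ∈ J
      · right
        have hJn : J = {1, n} := by
          refine Finset.Subset.antisymm hsub fun i hi => ?_
          rcases Finset.mem_insert.mp hi with rfl | hi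
          · exact hJ
          · rwa [Finset.mem_singleton.mp hi]
        rw [BicovCalculus.iso_iff, hΓ, hΓ', hJn]
      · left
        have hJ1 : J = {1} := by
          refine Finset.eq_singleton_iff_unique_mem.mpr ⟨hJ, fun i hi => ?_⟩
          rcases Finset.mem_insert.mp (hsub hi) with h1 | h1
          · exact h1
          · exact absurd (Finset.mem_singleton.mp h1 ▸ hi) hnJ
        have hF := Γ'.finDim_iff.mpr hfd'
        have hd' := dim_add_one_of_generic hq hJ hF hΓ'
        rw [hJ1, Finset.sum_singleton, PNat.one_coe] at hd'
        rw [BicovCalculus.subsingleton_iff hF]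
        omega

end Generic

theorem qParam_pow_ne_one (k : Type u) [Field k] (n : ℕ) (hn : n ≠ 0) :
    ((qParam k : (RatFunc k)ˣ) : RatFunc k) ^ n ≠ 1 := by
  intro h
  have h1 : algebraMap (Polynomial k) (RatFunc k) (Polynomial.X ^ n) =
      algebraMap (Polynomial k) (RatFunc k) 1 := by
    rw [map_pow, map_one, RatFunc.algebraMap_X]
    exact h
  have h2 := congrArg Polynomial.natDegree (RatFunc.algebraMap_injective k h1)
  rw [Polynomial.natDegree_X_pow, Polynomial.natDegree_one] at h2
  exact hn h2

/-- For `q = 1`, the crossed submodules of finite codimension are the `M_I` with `I ≠ ∅`. -/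
theorem exists_eq_crossedIdeal_one {k : Type u} [Field k] [CharZero k] {M : Submodule k (CB k)}
    (hM : IsCrossed M) (hfd : FiniteDimensional k (CB k ⧸ M)) :
    ∃ I : {I : Finset ℕ+ // I.Nonempty}, M = crossedIdeal (1 : kˣ) I.1 := by
  obtain ⟨I, rfl⟩ := exists_eq_crossedIdeal (q := (1 : kˣ)) (fun m => by
    simp only [inv_one, Units.val_one, one_pow, Finset.sum_const, Finset.card_range, nsmul_eq_mul,
      mul_one]
    exact Nat.cast_ne_zero.mpr (Nat.succ_ne_zero m)) hM
  refine ⟨⟨I, Finset.nonempty_iff_ne_empty.mpr ?_⟩, rfl⟩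
  rintro rfl
  have h := eval_one_idealPoly_of_isCrossed hM
  rw [idealPoly_eq_one (1 : kˣ) ∅ (by simp), Polynomial.eval_one] at h
  exact one_ne_zero h

end QBorel

/-! ### Dual bases of a calculus and its tangent space -/

/-- Elements `φ i` of the tangent space of `Γ` and `v i` of `A`, `i ∈ s`, which are dual to each
other, where `s` has as many elements as the tangent space has dimensions; the crossed submodule of
`Γ` is closed for the pairing. -/
structure IsDualSystem {k A : Type u} {U : Type*} [Field k] [Ring A] [HopfAlgebra k A] [Ring U]
    [HopfAlgebra k U] (P : U →ₗ[k] A →ₗ[k] k) (Γ : BicovCalculus k A) (s : Finset ℕ)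
    (v : ℕ → A) (φ : ℕ → U) : Prop where
  mem : ∀ i ∈ s, φ i ∈ annKer P Γ.crossed
  dual : ∀ i ∈ s, ∀ j ∈ s, P (φ i) (v j) = if i = j then 1 else 0
  closed : annCounit P (annKer P Γ.crossed) = Γ.crossed
  finDim : FiniteDimensional k (annKer P Γ.crossed)
  card : s.card = Module.finrank k (annKer P Γ.crossed)

namespace IsDualSystem

variable {k A : Type u} {U : Type*} [Field k] [Ring A] [HopfAlgebra k A] [Ring U]
  [HopfAlgebra k U] {P : U →ₗ[k] A →ₗ[k] k} {Γ : BicovCalculus k A} {s : Finset ℕ} {v : ℕ → A}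
  {φ : ℕ → U}

theorem linearIndependent (h : IsDualSystem P Γ s v φ) :
    LinearIndependent k (fun i : s => φ i) := by
  refine Fintype.linearIndependent_iff.mpr fun c hc j => ?_
  have h1 := congrArg (fun x => P x (v j)) hc
  simp only [map_sum, LinearMap.sum_apply, map_smul, LinearMap.smul_apply, map_zero,
    LinearMap.zero_apply, smul_eq_mul] at h1
  rw [Finset.sum_eq_single j] at h1
  · rwa [h.dual j j.2 j j.2, if_pos rfl, mul_one] at h1
  · intro i _ hij
    rw [h.dual i i.2 j j.2, if_neg fun e => hij (Subtype.ext e), mul_zero]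
  · simp

/-- The `φ i` span by a dimension count. -/
theorem span_eq (h : IsDualSystem P Γ s v φ) :
    Submodule.span k (φ '' (s : Set ℕ)) = annKer P Γ.crossed := by
  have := h.finDim
  have e : φ '' (s : Set ℕ) = Set.range fun i : s => φ i := by
    ext x
    simp
  refine Submodule.eq_of_le_of_finrank_le ?_ ?_
  · rw [Submodule.span_le]
    rintro _ ⟨i, hi, rfl⟩
    exact h.mem i hi
  · rw [e, finrank_span_eq_card h.linearIndependent, Fintype.card_coe, h.card]

variable (hP : IsHopfPairing P)

include hP

/-- The form `ω(a)` only depends on the pairings of `a` with the tangent space. -/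
theorem invForm_eq (h : IsDualSystem P Γ s v φ) (a : A) :
    Γ.invForm a = ∑ i ∈ s, P (φ i) a • Γ.invForm (v i) := by
  -- `u` pairs to zero with the tangent space, hence is a scalar modulo the crossed submodule
  let u : A := a - ∑ i ∈ s, P (φ i) a • v i
  have hφ1 : ∀ x ∈ annKer P Γ.crossed, ∀ c : k, P x (algebraMap k A c) = 0 := fun x hx c => by
    rw [Algebra.algebraMap_eq_smul_one, map_smul, hP.one_right, hx.1, smul_zero]
  have hu : u - algebraMap k A (counit u) ∈ Γ.crossed := by
    rw [← h.closed]
    refine ⟨by simp, fun x hx => ?_⟩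
    rw [map_sub, hφ1 x hx, sub_zero]
    rw [← h.span_eq] at hx
    induction hx using Submodule.span_induction with
    | mem x hx =>
      obtain ⟨j, hj, rfl⟩ := hx
      have hj : j ∈ s := hj
      simp only [u, map_sub, map_sum, map_smul, smul_eq_mul]
      rw [Finset.sum_eq_single j, h.dual j hj j hj, if_pos rfl, mul_one, sub_self]
      · intro i hi hij
        rw [h.dual j hj i hi, if_neg (Ne.symm hij), mul_zero]
      · exact fun h' => absurd hj h'
    | zero => simp
    | add x y _ _ hx hy => rw [map_add, LinearMap.add_apply, hx, hy, add_zero]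
    | smul c x _ hx => rw [map_smul, LinearMap.smul_apply, hx, smul_zero]
  have h1 := (Γ.mem_crossed.mp hu).2
  rw [map_sub, Γ.invForm_algebraMap, sub_zero, map_sub, map_sum, sub_eq_zero] at h1
  simpa using h1

/-- `d a = ∑ i, ω(v i) ∂_i(a)`, from `d a = ω(a₍₁₎) a₍₂₎`. -/
theorem d_eq (h : IsDualSystem P Γ s v φ) (a : A) :
    Γ.d a = ∑ i ∈ s, op (braidedDeriv P (φ i) a) • Γ.invForm (v i) := by
  rw [Γ.d_eq_sw]
  have e : ∀ i, op (braidedDeriv P (φ i) a) • Γ.invForm (v i) =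
      sw k a fun x y => op y • (P (φ i) x • Γ.invForm (v i)) := fun i => by
    rw [braidedDeriv_apply, sw, sw]
    simp only [Finset.op_sum, Finset.sum_smul, op_smul, smul_assoc]
    exact Finset.sum_congr rfl fun _ _ => smul_comm _ _ _
  simp only [e, sw]
  rw [Finset.sum_comm]
  refine Finset.sum_congr rfl fun _ _ => ?_
  rw [h.invForm_eq hP, Finset.smul_sum]

theorem isRightInvBasis (h : IsDualSystem P Γ s v φ) :
    Γ.IsRightInvBasis s fun i => Γ.invForm (v i) where
  inv i _ := Γ.invForm_mem _
  linInd := by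
    refine Fintype.linearIndependent_iff.mpr fun c hc j => ?_
    -- the functional `⟨φ j, ·⟩` factors through `ω`
    obtain ⟨τ, hτ⟩ := exists_comp_eq_of_ker_le (f := Γ.invForm) (g := P (φ j)) (by
      intro a ha
      have h1 : a - algebraMap k A (counit a) ∈ Γ.crossed := by
        rw [Γ.mem_crossed, map_sub Γ.invForm, Γ.invForm_algebraMap, LinearMap.mem_ker.mp ha]
        simp
      have h2 := (h.mem j j.2).2 _ h1
      rw [map_sub, Algebra.algebraMap_eq_smul_one, map_smul, hP.one_right, (h.mem j j.2).1,
        smul_zero, sub_zero] at h2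
      exact h2)
    have hτ' : ∀ a, τ (Γ.invForm a) = P (φ j) a := fun a => LinearMap.congr_fun hτ a
    have h1 : ∑ i : s, Γ.invForm (v i) ⊗ₜ[k] (unop (c i)) = 0 := by
      have h2 := congrArg Γ.splitForm hc
      rw [map_sum, map_zero] at h2
      rw [← h2]
      exact Finset.sum_congr rfl fun i _ => (Γ.splitForm_op_smul_invForm (v i) (unop (c i))).symm
    have h3 := congrArg (TensorProduct.lid k A ∘ LinearMap.rTensor A τ) h1
    simp only [Function.comp_apply, map_sum, LinearMap.rTensor_tmul, TensorProduct.lid_tmul, hτ',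
      map_zero] at h3
    rw [Finset.sum_eq_single j] at h3
    · rw [h.dual j j.2 j j.2, if_pos rfl, one_smul] at h3
      exact unop_injective h3
    · intro i _ hij
      rw [h.dual j j.2 i i.2, if_neg fun e => hij (Subtype.ext e.symm), zero_smul]
    · simp
  span := by
    refine eq_top_iff.mpr fun γ _ => ?_
    refine Γ.induction_right (fun a b => ?_) (Submodule.zero_mem _)
      (fun _ _ => Submodule.add_mem _)
      (fun c x hx => ?_) γ
    · rw [h.d_eq hP]
      exact Submodule.smul_mem _ _ (Submodule.sum_mem _ fun i hi =>
        Submodule.smul_mem _ _ (Submodule.subset_span ⟨i, hi, rfl⟩))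
    · rw [← one_smul Aᵐᵒᵖ x, ← smul_assoc]
      exact Submodule.smul_mem _ _ hx

theorem isDualBasis (h : IsDualSystem P Γ s v φ) :
    IsDualBasis P Γ s (fun i => Γ.invForm (v i)) φ where
  linInd := h.linearIndependent
  span := h.span_eq
  dual i hi j hj a ha := by
    have h1 : (a - v j) - algebraMap k A (counit (a - v j)) ∈ Γ.crossed := by
      rw [Γ.mem_crossed, map_sub Γ.invForm, Γ.invForm_algebraMap, map_sub Γ.invForm, ha]
      simp
    have h2 := (h.mem i hi).2 _ h1
    rw [map_sub, Algebra.algebraMap_eq_smul_one, map_smul, hP.one_right, (h.mem i hi).1,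
      smul_zero, sub_zero, map_sub, sub_eq_zero] at h2
    rw [h2, h.dual i hi j hj]

end IsDualSystem

/-! ### The derivations of `C(B₊)` -/

namespace CB

open QBorel (adjoin_eq_top X_mul_g g_mul_X_pow ginv_mul_X_pow)

variable {k : Type u} [Field k]

local notation "𝐗" => (QBorel.X : CB k)
local notation "𝐠" => (QBorel.g : CB k)
local notation "𝐠⁻" => (QBorel.ginv : CB k)

theorem mul_comm (a b : CB k) : a * b = b * a := by
  have hXg : 𝐗 * 𝐠 = 𝐠 * 𝐗 := by rw [X_mul_g, Units.val_one, one_smul]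
  have hXi : 𝐗 * 𝐠⁻ = 𝐠⁻ * 𝐗 := by
    have h := ginv_mul_X_pow (q := (1 : kˣ)) 1
    rw [pow_one, pow_one, Units.val_one, one_smul] at h
    exact h.symm
  have hgi : 𝐠 * 𝐠⁻ = 𝐠⁻ * 𝐠 := by rw [QBorel.g_mul_ginv, QBorel.ginv_mul_g]
  have hgen : ∀ x ∈ ({𝐗, 𝐠, 𝐠⁻} : Set (CB k)), ∀ y ∈ ({𝐗, 𝐠, 𝐠⁻} : Set (CB k)),
      x * y = y * x := by
    rintro x (rfl | rfl | rfl) y (rfl | rfl | rfl) <;> simp only [hXg, hXi, hgi]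
  have := Algebra.isMulCommutative_adjoin k hgen
  have h := mul_comm' (⟨a, adjoin_eq_top (K := k) ▸ Algebra.mem_top⟩ :
    Algebra.adjoin k ({𝐗, 𝐠, 𝐠⁻} : Set (CB k))) ⟨b, adjoin_eq_top (K := k) ▸ Algebra.mem_top⟩
  exact congrArg Subtype.val h

/-- Derivations of `C(B₊)` are determined by their values on the generators. -/
theorem derivation_ext {D E : CB k →ₗ[k] CB k} (hD : ∀ a b, D (a * b) = a * D b + D a * b)
    (hE : ∀ a b, E (a * b) = a * E b + E a * b) (hX : D 𝐗 = E 𝐗) (hg : D 𝐠 = E 𝐠)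
    (hi : D 𝐠⁻ = E 𝐠⁻) : D = E := by
  have h1 : ∀ F : CB k →ₗ[k] CB k, (∀ a b, F (a * b) = a * F b + F a * b) → F 1 = 0 :=
    fun F hF => by simpa using hF 1 1
  ext a
  have ha : a ∈ Algebra.adjoin k ({𝐗, 𝐠, 𝐠⁻} : Set (CB k)) :=
    (adjoin_eq_top (K := k) (q := 1)) ▸ Algebra.mem_top
  induction ha using Algebra.adjoin_induction with
  | mem x hx => rcases hx with rfl | rfl | rfl <;> assumption
  | algebraMap r => rw [Algebra.algebraMap_eq_smul_one, map_smul, map_smul, h1 D hD, h1 E hE]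
  | add x y _ _ hx hy => rw [map_add, map_add, hx, hy]
  | mul x y _ _ hx hy => rw [hD, hE, hx, hy]

theorem dX_ginv : dX 𝐠⁻ = 0 := by simp [dX, jetX]
theorem dg_ginv : dg 𝐠⁻ = -(𝐠⁻ * 𝐠⁻) := by simp [dg, jetG]

theorem braidedDeriv_X : braidedDeriv UB.pairing (UB.X : UB k) = dX :=
  derivation_ext
    (fun a b => by rw [UB.braidedDeriv_mul_of_primitive UB.comul_X, add_comm]) dX_mul
    (by rw [UB.braidedDeriv_X_X, dX_X]) (by rw [UB.braidedDeriv_X_g, dX_g])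
    (by rw [UB.braidedDeriv_X_ginv, dX_ginv])

theorem braidedDeriv_H (f : CB k) :
    braidedDeriv UB.pairing (UB.H : UB k) f = 𝐗 * dX f + 𝐠 * dg f := by
  have h : braidedDeriv UB.pairing (UB.H : UB k) =
      LinearMap.mulLeft k 𝐗 ∘ₗ dX + LinearMap.mulLeft k 𝐠 ∘ₗ dg := by
    refine derivation_ext
      (fun a b => by rw [UB.braidedDeriv_mul_of_primitive UB.comul_H, add_comm]) (fun a b => ?_)
      ?_ ?_ ?_
    · simp only [LinearMap.add_apply, LinearMap.comp_apply, LinearMap.mulLeft_apply, dX_mul, dg_mul,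
        mul_add, add_mul]
      rw [← mul_assoc a 𝐗, ← mul_assoc a 𝐠, mul_comm a 𝐗, mul_comm a 𝐠]
      simp only [mul_assoc]
      abel
    · simp [UB.braidedDeriv_H_X, dX_X, dg_X]
    · simp [UB.braidedDeriv_H_g, dX_g, dg_g]
    · simp [UB.braidedDeriv_H_ginv, dX_ginv, dg_ginv, ← mul_assoc, QBorel.g_mul_ginv]
  rw [h]
  rfl

/-! ### The calculi of `{1, n}` and `{n}` on `C(B₊)` -/

/-- The elements `g` and `X^i`, `i ≥ 1`, whose forms `ω(v)` are the basis `η_i`. -/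
def formElt (k : Type u) [Field k] (i : ℕ) : CB k := if i = 0 then QBorel.g else QBorel.X ^ i

/-- The tangent vectors `H` and `X^i / i!`, `i ≥ 1`. -/
def tangentElt (k : Type u) [Field k] (i : ℕ) : UB k :=
  if i = 0 then UB.H else (i.factorial : k)⁻¹ • UB.X ^ i

theorem braidedDeriv_tangentElt (i : ℕ) (f : CB k) :
    braidedDeriv UB.pairing (tangentElt k i) f = derivation i f := by
  rw [tangentElt, derivation]
  split_ifs
  · exact braidedDeriv_H f
  · rw [braidedDeriv_smul, LinearMap.smul_apply, UB.isHopfPairing_pairing.braidedDeriv_pow,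
      braidedDeriv_X]

theorem pairing_tangentElt [CharZero k] (i j : ℕ) :
    UB.pairing (tangentElt k i) (formElt k j) = if i = j then 1 else 0 := by
  have h1 : ∀ i, UB.pairing (UB.X ^ i : UB k) 𝐠 = if i = 0 then 1 else 0 := fun i => by
    rcases i with _ | i
    · rw [pow_zero, UB.isHopfPairing_pairing.one_left, QBorel.counit_g, if_pos rfl]
    · rw [pow_succ', UB.isHopfPairing_pairing.pair_mul, UB.braidedDeriv_X_g, map_zero,
        if_neg i.succ_ne_zero]
  have h2 : ∀ j, UB.pairing (UB.H : UB k) (𝐗 ^ (j + 1)) = 0 := fun j => by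
    rw [pow_succ', ← pow_one UB.H, UB.pairing_H_pow_X_mul]
  have h3 : ∀ i j, UB.pairing (UB.X ^ i : UB k) (𝐗 ^ j) = if i = j then (i.factorial : k) else 0 :=
    fun i j => by
      have h := UB.pairing_X_pow_mul_aeval i 1 (𝐗 ^ j)
      have h' := QBorel.comp_X_pow_mul_lau (q := (1 : kˣ)) j 1
      rw [map_one, mul_one] at h'
      rw [map_one, mul_one, UB.isHopfPairing_pairing.one_left, h'] at h
      rw [h]
      by_cases hij : i = j
      · subst hij
        rw [Pi.single_eq_same, map_one, Bialgebra.counit_one, if_pos rfl, mul_one]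
      · rw [Pi.single_eq_of_ne hij, map_zero, map_zero, if_neg hij, mul_zero]
  have h4 : UB.pairing (UB.H : UB k) 𝐠 = 1 := by
    rw [UB.pairing_g]
    simp [UB.char]
  rw [tangentElt, formElt]
  rcases i with _ | i <;> rcases j with _ | j
  · simp [h4]
  · simp [h2]
  · simp [h1]
  · have hf : ((i + 1).factorial : k) ≠ 0 := Nat.cast_ne_zero.mpr (Nat.factorial_ne_zero _)
    rw [if_neg i.succ_ne_zero, if_neg j.succ_ne_zero, map_smul, LinearMap.smul_apply, h3, smul_eq_mul]
    split_ifs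
    · exact inv_mul_cancel₀ hf
    · exact mul_zero _

theorem X_pow_mul_one_sub_g_pow_mem {I : Finset ℕ+} {m c : ℕ}
    (h : (I.filter (fun n : ℕ+ => m < (n : ℕ))).card ≤ c) :
    𝐗 ^ m * (1 - 𝐠) ^ c ∈ crossedIdeal (1 : kˣ) I := by
  have e : (1 - 𝐠) ^ c = QBorel.lau (Polynomial.toLaurent ((1 - Polynomial.X) ^ c)) := by
    rw [QBorel.lau_toLaurent]
    simp
  rw [e, QBorel.X_pow_mul_lau_mem_crossedIdeal, UB.idealPoly_one]
  exact map_dvd _ (pow_dvd_pow _ h)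

theorem isBilinear_invForm_mul (Γ : BicovCalculus k (CB k)) (v : CB k) :
    IsBilinear k fun x y => op y • Γ.invForm (x * v) := by
  change IsBilinear k fun x y => Γ.rightAct y (Γ.invForm (x * v))
  constructor <;> intros <;> simp [-opAct_apply, add_mul]

theorem isBilinear_invForm (Γ : BicovCalculus k (CB k)) :
    IsBilinear k fun x y => op y • Γ.invForm x := by
  simpa using isBilinear_invForm_mul Γ 1

/-- The relations hold as soon as `(1 - g)^2`, `X^i (1 - g)` for `i ≥ 1` and `X^n` belong to the crossed
submodule; this is what the three bounds say. -/
theorem relations {n : ℕ} (hn : 2 ≤ n) {I : Finset ℕ+} {Γ : BicovCalculus k (CB k)}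
    (hΓ : Γ.crossed = crossedIdeal (1 : kˣ) I)
    (h0 : (I.filter (fun i : ℕ+ => 0 < (i : ℕ))).card ≤ 2)
    (h1 : ∀ m, 0 < m → (I.filter (fun i : ℕ+ => m < (i : ℕ))).card ≤ 1)
    (h2 : (I.filter (fun i : ℕ+ => n < (i : ℕ))).card ≤ 0) :
    Relations n Γ fun i => Γ.invForm (formElt k i) := by
  have hmem : ∀ v ∈ crossedIdeal (1 : kˣ) I, Γ.invForm v = 0 := fun v hv =>
    (Γ.mem_crossed.mp (hΓ ▸ hv)).2
  have hg : ∀ m, 0 < m → Γ.invForm (𝐠 * 𝐗 ^ m) = Γ.invForm (𝐗 ^ m) := fun m hm => by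
    have h := hmem _ (X_pow_mul_one_sub_g_pow_mem (h1 m hm))
    rw [pow_one, mul_sub, mul_one, map_sub, sub_eq_zero] at h
    rw [mul_comm, ← h]
  have hgg : Γ.invForm (𝐠 * 𝐠) = Γ.invForm 𝐠 + Γ.invForm 𝐠 := by
    have h := hmem _ (X_pow_mul_one_sub_g_pow_mem h0)
    rw [pow_zero, one_mul, pow_two, mul_sub, sub_mul, sub_mul] at h
    simp only [one_mul, mul_one, map_sub, Γ.invForm_one] at h
    rw [← sub_eq_zero, ← h]
    abel
  have hXn : Γ.invForm (𝐗 ^ n) = 0 := by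
    have h := hmem _ (X_pow_mul_one_sub_g_pow_mem h2)
    rwa [pow_zero, mul_one] at h
  have hcX : ∀ v, Γ.invForm (𝐗 * v) + op 𝐗 • Γ.invForm (𝐠 * v) =
      𝐗 • Γ.invForm v + counit (R := k) v • Γ.d 𝐗 := fun v => by
    rw [← Γ.sw_invForm_mul, sw_of_comul_eq_add (isBilinear_invForm_mul Γ v) QBorel.comul_X, op_one,
      one_smul]
  have hcg : ∀ v, op 𝐠 • Γ.invForm (𝐠 * v) =
      𝐠 • Γ.invForm v + counit (R := k) v • Γ.d 𝐠 := fun v => by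
    rw [← Γ.sw_invForm_mul, sw_of_comul_eq (isBilinear_invForm_mul Γ v) QBorel.comul_g]
  have hdX : Γ.d 𝐗 = Γ.invForm 𝐗 + op 𝐗 • Γ.invForm 𝐠 := by
    rw [Γ.d_eq_sw, sw_of_comul_eq_add (isBilinear_invForm Γ) QBorel.comul_X, op_one, one_smul]
  have hdg : Γ.d 𝐠 = op 𝐠 • Γ.invForm 𝐠 := by
    rw [Γ.d_eq_sw, sw_of_comul_eq (isBilinear_invForm Γ) QBorel.comul_g]
  have hε : ∀ i, counit (R := k) (𝐗 ^ (i + 1)) = 0 := fun i => by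
    rw [Bialgebra.counit_pow, QBorel.counit_X, zero_pow i.succ_ne_zero]
  have e0 : formElt k 0 = 𝐠 := if_pos rfl
  have e1 : ∀ i, formElt k (i + 1) = 𝐗 ^ (i + 1) := fun i => if_neg i.succ_ne_zero
  refine ⟨?_, by simp only [e0]; exact hdg, fun i hi => ?_, fun i hi => ?_⟩
  · simp only [e0, e1 0, zero_add, pow_one]
    exact hdX
  · rcases i with _ | i
    · have h := hcg 𝐠
      rw [QBorel.counit_g, one_smul, hgg, hdg, smul_add, add_left_inj] at h
      simp only [e0, h, sub_self]
    · have h := hcg (𝐗 ^ (i + 1))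
      rw [hε, zero_smul, add_zero, hg _ i.succ_pos] at h
      simp only [e1, h, sub_self]
  · rcases i with _ | i
    · have h := hcX 𝐠
      have hXg : Γ.invForm (𝐗 * 𝐠) = Γ.invForm 𝐗 := by
        rw [mul_comm]
        simpa using hg 1 one_pos
      rw [QBorel.counit_g, one_smul, hgg, hdX, hXg, smul_add,
        add_comm (𝐗 • Γ.invForm 𝐠), add_assoc, add_right_inj, add_right_inj] at h
      simp only [e0, ← h, sub_self, true_or, if_true]
    · have h := hcX (𝐗 ^ (i + 1))
      rw [hε, zero_smul, add_zero, hg _ i.succ_pos, ← pow_succ'] at h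
      have h3 : 𝐗 • Γ.invForm (formElt k (i + 1)) - op 𝐗 • Γ.invForm (formElt k (i + 1)) =
          Γ.invForm (𝐗 ^ (i + 1 + 1)) := by
        rw [e1, ← h, add_sub_cancel_right]
      refine h3.trans ?_
      by_cases hi' : i + 1 = n - 1
      · rw [if_pos (Or.inr hi'), show i + 1 + 1 = n by omega, hXn]
      · rw [if_neg (by omega), e1]

/-- The bounds `h0` and `h1` say that `H` and `X^i`, for the `i` in `s`, annihilate `M_I`. -/
theorem isDualSystem [CharZero k] {I : Finset ℕ+} (hI : I.Nonempty) {Γ : BicovCalculus k (CB k)}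
    (hΓ : Γ.crossed = crossedIdeal (1 : kˣ) I) {s : Finset ℕ}
    (h0 : 0 ∈ s → 1 < (I.filter (fun i : ℕ+ => 0 < (i : ℕ))).card)
    (h1 : ∀ m ∈ s, 0 < m → 0 < (I.filter (fun i : ℕ+ => m < (i : ℕ))).card)
    (hs : s.card + 1 = ∑ n ∈ I, (n : ℕ)) {φ : ℕ → UB k} (hφ : ∀ i ∈ s, φ i = tangentElt k i) :
    IsDualSystem UB.pairing Γ s (formElt k) φ := by
  obtain ⟨-, hfd, hrank, hcl⟩ := UB.crossedIdeal_closed (k := k) hI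
  rw [← hΓ] at hfd hrank hcl
  refine ⟨fun i hi => ?_, fun i hi j _ => by rw [hφ i hi, pairing_tangentElt], hcl, hfd, by omega⟩
  rw [hφ i hi, tangentElt, hΓ]
  split_ifs with hi0
  · subst hi0
    refine ⟨UB.counit_H, fun v hv => ?_⟩
    have h := UB.pairing_crossedIdeal_eq_zero (m := 0) (h := Polynomial.X) (by
      rw [Polynomial.degree_X]
      exact_mod_cast h0 hi) hv
    rwa [pow_zero, one_mul, Polynomial.aeval_X] at h
  · refine ⟨by rw [map_smul, Bialgebra.counit_pow, UB.counit_X, zero_pow hi0, smul_zero],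
      fun v hv => ?_⟩
    have h := UB.pairing_crossedIdeal_eq_zero (m := i) (h := 1) (by
      rw [Polynomial.degree_one]
      exact_mod_cast h1 i hi (Nat.pos_of_ne_zero hi0)) hv
    rw [map_one, mul_one] at h
    rw [map_smul, LinearMap.smul_apply, h, smul_zero]

theorem card_filter_pair {n : ℕ+} (hn : n ≠ 1) (m : ℕ) :
    (({1, n} : Finset ℕ+).filter (fun i : ℕ+ => m < (i : ℕ))).card =
      (if m < 1 then 1 else 0) + if m < n then 1 else 0 := by
  rw [Finset.card_filter, Finset.sum_pair (Ne.symm hn), PNat.one_coe]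

theorem card_filter_singleton (n : ℕ+) (m : ℕ) :
    (({n} : Finset ℕ+).filter (fun i : ℕ+ => m < (i : ℕ))).card = if m < n then 1 else 0 := by
  rw [Finset.card_filter, Finset.sum_singleton]

theorem ne_one_of_two_le {n : ℕ+} (hn : 2 ≤ n) : n ≠ 1 := by
  rintro rfl
  exact absurd hn (by decide)

section CharZero

variable [CharZero k] {n : ℕ+} (hn : 2 ≤ n) {Γ : BicovCalculus k (CB k)}

include hn

/-- The calculus of `{1, n}` has the basis `ω(g), ω(X), …, ω(X^{n-1})`. -/
theorem exists_basis_pair (hΓ : Γ.crossed = crossedIdeal (1 : kˣ) {1, n}) :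
    ∃ (η : ℕ → Γ.carrier) (φ : ℕ → UB k),
      Γ.IsRightInvBasis (Finset.range n) η ∧
      Relations n Γ η ∧
      IsDualBasis UB.pairing Γ (Finset.range n) η φ ∧
      (∀ i < (n : ℕ), ∀ f : CB k, braidedDeriv UB.pairing (φ i) f = derivation i f) ∧
      ∀ f : CB k, Γ.d f = ∑ i ∈ Finset.range n, op (derivation i f) • η i := by
  have hn2 : 2 ≤ (n : ℕ) := hn
  have hsum : ∑ i ∈ ({1, n} : Finset ℕ+), (i : ℕ) = n + 1 := by
    rw [Finset.sum_pair (Ne.symm (ne_one_of_two_le hn)), PNat.one_coe, add_comm]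
  have hcard := card_filter_pair (ne_one_of_two_le hn)
  have hsys := isDualSystem (Finset.insert_nonempty 1 {n}) hΓ (s := Finset.range n)
    (φ := tangentElt k) (fun _ => by rw [hcard]; split_ifs <;> omega)
    (fun m hm _ => by
      rw [hcard, if_pos (Finset.mem_range.mp hm)]
      omega)
    (by rw [Finset.card_range, hsum]) fun _ _ => rfl
  refine ⟨fun i => Γ.invForm (formElt k i), tangentElt k,
    hsys.isRightInvBasis UB.isHopfPairing_pairing,
    relations hn2 hΓ (by rw [hcard]; split_ifs <;> omega)
      (fun m hm => by rw [hcard]; split_ifs <;> omega) (by rw [hcard]; split_ifs <;> omega),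
    hsys.isDualBasis UB.isHopfPairing_pairing, fun i _ f => braidedDeriv_tangentElt i f,
    fun f => ?_⟩
  rw [hsys.d_eq UB.isHopfPairing_pairing]
  exact Finset.sum_congr rfl fun i _ => by rw [braidedDeriv_tangentElt]

/-- The calculus of `{n}` has the basis `ω(X), …, ω(X^{n-1})`, while `ω(g) = 0`. -/
theorem exists_basis_singleton (hΓ : Γ.crossed = crossedIdeal (1 : kˣ) {n}) :
    ∃ (η : ℕ → Γ.carrier) (φ : ℕ → UB k),
      η 0 = 0 ∧ φ 0 = 0 ∧
      Γ.IsRightInvBasis (Finset.Ico 1 n) η ∧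
      Relations n Γ η ∧
      IsDualBasis UB.pairing Γ (Finset.Ico 1 n) η φ ∧
      (∀ i ∈ Finset.Ico 1 (n : ℕ), ∀ f : CB k,
        braidedDeriv UB.pairing (φ i) f = derivation i f) ∧
      ∀ f : CB k, Γ.d f = ∑ i ∈ Finset.Ico 1 (n : ℕ), op (derivation i f) • η i := by
  have hn2 : 2 ≤ (n : ℕ) := hn
  have hsum : ∑ i ∈ ({n} : Finset ℕ+), (i : ℕ) = n := Finset.sum_singleton _ _
  have hcard := card_filter_singleton n
  have hφ : ∀ i ∈ Finset.Ico 1 (n : ℕ), Function.update (tangentElt k) 0 0 i =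
      tangentElt k i := fun i hi =>
    Function.update_of_ne (Nat.one_le_iff_ne_zero.mp (Finset.mem_Ico.mp hi).1) _ _
  have hsys := isDualSystem (Finset.singleton_nonempty n) hΓ (s := Finset.Ico 1 n)
    (φ := Function.update (tangentElt k) 0 0) (fun h0 => by simp at h0)
    (fun m hm _ => by
      rw [hcard, if_pos (Finset.mem_Ico.mp hm).2]
      exact one_pos)
    (by rw [Nat.card_Ico, hsum]; omega) hφ
  -- `1 - g` belongs to `M_{n}`
  have h0 : Γ.invForm (formElt k 0) = 0 := by
    have h1 : (QBorel.X ^ 0 * (1 - QBorel.g) ^ 1 : CB k) ∈ Γ.crossed := hΓ ▸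
      X_pow_mul_one_sub_g_pow_mem (by rw [hcard]; split_ifs <;> omega)
    have h2 := (Γ.mem_crossed.mp h1).2
    rw [pow_zero, one_mul, pow_one, map_sub, Γ.invForm_one, zero_sub, neg_eq_zero] at h2
    exact h2
  refine ⟨fun i => Γ.invForm (formElt k i), Function.update (tangentElt k) 0 0,
    h0, Function.update_self _ _ _,
    hsys.isRightInvBasis UB.isHopfPairing_pairing,
    relations hn2 hΓ (by rw [hcard]; split_ifs <;> omega)
      (fun m hm => by rw [hcard]; split_ifs <;> omega) (by rw [hcard]; split_ifs <;> omega),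
    hsys.isDualBasis UB.isHopfPairing_pairing,
    fun i hi f => by rw [hφ i hi, braidedDeriv_tangentElt], fun f => ?_⟩
  rw [hsys.d_eq UB.isHopfPairing_pairing]
  exact Finset.sum_congr rfl fun i hi => by rw [hφ i hi, braidedDeriv_tangentElt]

end CharZero

end CB

end

/-! ### The classification -/

theorem mainTheorem5 (k : Type u) [Field k] [CharZero k] :
    ∃ (Φ : {I : Finset ℕ+ // I.Nonempty} ≃ FinDimCalculi k (CB k))
      (Ψ : {I : Finset ℕ+ // I.Nonempty} ≃ FinDimTangentSpaces (UB.pairing (k := k)))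
      (Φq : {I : Finset ℕ+ // 1 ∈ I} ≃ FinDimCalculi (RatFunc k) (CqB k))
      (Ψq : {I : Finset ℕ+ // 1 ∈ I} ≃
        FinDimTangentSpaces (QBorel.pairing (K := RatFunc k) (q := qParam k))),
      -- the bijections for `C(B₊)` and `U(b₊)`, and the dimensions
      (∀ I (Γ : BicovCalculus k (CB k)) (h : Γ.FinDim),
        (Φ I = Quotient.mk _ ⟨Γ, h⟩ ↔ Γ.crossed = crossedIdeal 1 I.1) ∧
        (Φ I = Quotient.mk _ ⟨Γ, h⟩ →
          (Ψ I).1 = annKer UB.pairing Γ.crossed ∧ Γ.dim + 1 = ∑ n ∈ I.1, (n : ℕ))) ∧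
      (∀ I, Module.finrank k (Ψ I).1 + 1 = ∑ n ∈ I.1, (n : ℕ)) ∧
      -- the bijections for `C_q(B₊)` and `U_q(b₊)`, by the same sets `I`, with `1 ∈ I`
      (∀ I (Γ : BicovCalculus (RatFunc k) (CqB k)) (h : Γ.FinDim),
        (Φq I = Quotient.mk _ ⟨Γ, h⟩ ↔ Γ.crossed = crossedIdeal (qParam k) I.1) ∧
        (Φq I = Quotient.mk _ ⟨Γ, h⟩ →
          (Ψq I).1 = annKer QBorel.pairing Γ.crossed ∧ Γ.dim + 1 = ∑ n ∈ I.1, (n : ℕ))) ∧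
      (∀ I, Module.finrank (RatFunc k) (Ψq I).1 + 1 = ∑ n ∈ I.1, (n : ℕ)) ∧
      -- the coirreducible calculus of dimension `n` on `C_q(B₊)` is the one of `{1, n}`
      (∀ n : ℕ+, 2 ≤ n → ∀ (Γ : BicovCalculus (RatFunc k) (CqB k)) (h : Γ.FinDim),
        (Γ.Coirreducible ∧ Γ.dim = n) ↔
          Φq ⟨{1, n}, Finset.mem_insert_self 1 {n}⟩ = Quotient.mk _ ⟨Γ, h⟩) ∧
      -- the calculus of `{1, n}` on `C(B₊)`
      (∀ n : ℕ+, 2 ≤ n → ∀ (Γ : BicovCalculus k (CB k)) (h : Γ.FinDim),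
        Φ ⟨{1, n}, Finset.insert_nonempty 1 {n}⟩ = Quotient.mk _ ⟨Γ, h⟩ →
        Γ.dim = n ∧
        ∃ (η : ℕ → Γ.carrier) (φ : ℕ → UB k),
          Γ.IsRightInvBasis (Finset.range n) η ∧
          CB.Relations n Γ η ∧
          IsDualBasis UB.pairing Γ (Finset.range n) η φ ∧
          (∀ i < (n : ℕ), ∀ f : CB k, braidedDeriv UB.pairing (φ i) f = CB.derivation i f) ∧
          ∀ f : CB k, Γ.d f = ∑ i ∈ Finset.range n, op (CB.derivation i f) • η i) ∧
      -- the calculus of `{n}` on `C(B₊)`: the same with `η₀ = 0` and `∂₀ = 0`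
      (∀ n : ℕ+, 2 ≤ n → ∀ (Γ : BicovCalculus k (CB k)) (h : Γ.FinDim),
        Φ ⟨{n}, Finset.singleton_nonempty n⟩ = Quotient.mk _ ⟨Γ, h⟩ →
        Γ.dim + 1 = n ∧
        ∃ (η : ℕ → Γ.carrier) (φ : ℕ → UB k),
          η 0 = 0 ∧ φ 0 = 0 ∧
          Γ.IsRightInvBasis (Finset.Ico 1 n) η ∧
          CB.Relations n Γ η ∧
          IsDualBasis UB.pairing Γ (Finset.Ico 1 n) η φ ∧
          (∀ i ∈ Finset.Ico 1 (n : ℕ), ∀ f : CB k,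
            braidedDeriv UB.pairing (φ i) f = CB.derivation i f) ∧
          ∀ f : CB k, Γ.d f = ∑ i ∈ Finset.Ico 1 (n : ℕ), op (CB.derivation i f) • η i) := by
  have hq := QBorel.qParam_pow_ne_one k
  have hcr : ∀ I : {I : Finset ℕ+ // I.Nonempty}, IsCrossed (crossedIdeal (1 : kˣ) I.1) :=
    fun I => QBorel.isCrossed_crossedIdeal I.1 (UB.eval_one_idealPoly I.2)
  have hcrq : ∀ I : {I : Finset ℕ+ // 1 ∈ I}, IsCrossed (crossedIdeal (qParam k) I.1) :=
    fun I => QBorel.isCrossed_crossedIdeal I.1 (QBorel.eval_one_idealPoly I.2)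
  have hinj : Function.Injective fun I : {I : Finset ℕ+ // I.Nonempty} =>
      crossedIdeal (1 : kˣ) I.1 := fun I J h => Subtype.ext (QBorel.crossedIdeal_injective h)
  have hinjq : Function.Injective fun I : {I : Finset ℕ+ // 1 ∈ I} =>
      crossedIdeal (qParam k) I.1 := fun I J h => Subtype.ext (QBorel.crossedIdeal_injective h)
  obtain ⟨Φ, hΦ⟩ := exists_equiv_finDimCalculi hinj hcr
    (fun I => (QBorel.finrank_quotient_crossedIdeal_le I.1).1)
    fun N hN hfd => QBorel.exists_eq_crossedIdeal_one hN hfd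
  obtain ⟨Ψ, hΨ⟩ := exists_equiv_finDimTangentSpaces UB.isHopfPairing_pairing
    UB.pairing_right_nondegenerate UB.pairing_left_nondegenerate hinj hcr
    (fun I => (UB.crossedIdeal_closed I.2).2.1) (fun I => (UB.crossedIdeal_closed I.2).2.2.2)
    fun N hN hfd => QBorel.exists_eq_crossedIdeal_one hN hfd
  obtain ⟨Φq, hΦq⟩ := exists_equiv_finDimCalculi hinjq hcrq
    (fun I => (QBorel.finrank_quotient_crossedIdeal_le I.1).1)
    fun N hN hfd => QBorel.exists_eq_crossedIdeal_of_generic hq hN hfd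
  obtain ⟨Ψq, hΨq⟩ := exists_equiv_finDimTangentSpaces QBorel.isHopfPairing_pairing
    (QBorel.pairing_right_nondegenerate hq) (QBorel.pairing_left_nondegenerate hq) hinjq hcrq
    (fun I => (QBorel.crossedIdeal_closed_of_generic hq I.2).2.1)
    (fun I => (QBorel.crossedIdeal_closed_of_generic hq I.2).2.2.2)
    fun N hN hfd => QBorel.exists_eq_crossedIdeal_of_generic hq hN hfd
  have hdim : ∀ I (Γ : BicovCalculus k (CB k)) (h : Γ.FinDim), Φ I = Quotient.mk _ ⟨Γ, h⟩ →
      Γ.dim + 1 = ∑ n ∈ I.1, (n : ℕ) := fun I Γ h hI => by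
    rw [Γ.dim_add_one h, (hΦ I Γ h).mp hI, (UB.crossedIdeal_closed I.2).1]
  refine ⟨Φ, Ψ, Φq, Ψq, fun I Γ h => ⟨hΦ I Γ h, fun hI => ⟨?_, hdim I Γ h hI⟩⟩, fun I => ?_,
    fun I Γ h => ⟨hΦq I Γ h, fun hI => ⟨?_, ?_⟩⟩, fun I => ?_, fun n hn Γ h => ?_,
    fun n hn Γ h hI => ?_, fun n hn Γ h hI => ?_⟩
  · rw [hΨ, (hΦ I Γ h).mp hI]
  · rw [hΨ]
    exact (UB.crossedIdeal_closed I.2).2.2.1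
  · rw [hΨq, (hΦq I Γ h).mp hI]
  · exact QBorel.dim_add_one_of_generic hq I.2 h ((hΦq I Γ h).mp hI)
  · rw [hΨq]
    exact (QBorel.crossedIdeal_closed_of_generic hq I.2).2.2.1
  · rw [hΦq]
    exact QBorel.coirreducible_iff hq hn h
  · have hsum : ∑ i ∈ ({1, n} : Finset ℕ+), (i : ℕ) = n + 1 := by
      rw [Finset.sum_pair (Ne.symm (CB.ne_one_of_two_le hn)), PNat.one_coe, add_comm]
    have hd := (hdim _ Γ h hI).trans hsum
    have hΓ : Γ.crossed = crossedIdeal 1 {1, n} :=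
      (hΦ ⟨{1, n}, Finset.insert_nonempty 1 {n}⟩ Γ h).mp hI
    exact ⟨Nat.succ_injective hd, CB.exists_basis_pair hn hΓ⟩
  · have hΓ : Γ.crossed = crossedIdeal 1 {n} :=
      (hΦ ⟨{n}, Finset.singleton_nonempty n⟩ Γ h).mp hI
    exact ⟨(hdim _ Γ h hI).trans (Finset.sum_singleton _ _),
      CB.exists_basis_singleton hn hΓ⟩
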